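/- **Notation.** Let $n\ge 1$, $0\le k,\ell\le n$. $\Lambda^k$ is the space of complex-valued alternating $k$-forms on $\mathbb R^n$, with the action $\sigma_k$ of $SO(n)$, $\sigma_k(m)\eta=\eta\circ m^{-1}$; $\Lambda^k\otimes\Lambda^\ell$ has the inner product for which the $e_I^*\otimes e_J^*$ are orthonormal. $\mathcal E^{k,\ell}=C^\infty(\mathbb R^n\times\mathbb R^n,\Lambda^k\otimes\Lambda^\ell)$. Write $\varepsilon_j=e_j^*\wedge\cdot$, $\iota_j=\iota_{e_j}$, $d=\sum_m\varepsilon_m\partial_m$, $\delta=-\sum_m\iota_m\partial_m$ (with $\iota_j=0$, $\delta=0$ on $0$-forms). On $k$-forms put, for $s,\lambda\in\mathbb C$, $$\Box_{k,s}=(s+n-2k)(s-n+2k-2)\,\delta d+(s-n+2k)(s+n-2k-2)\,d\delta,$$ $$\nabla_{k,s,j}=(2-s)\big[(s+n-2k)(s-n+2k-2)\partial_j+2(s-n+2k)\varepsilon_j\delta+2(s+n-2k)d\iota_j\big],$$ $$\widetilde\Box_{k,\lambda}=(\lambda-n+k)(\lambda-k+1)\,\delta d+(\lambda-n+k+1)(\lambda-k)\,d\delta,$$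 $$\widetilde\nabla_{k,\lambda,j}=(\lambda-n+k)(\lambda-k+1)\partial_j-(\lambda-k)\varepsilon_j\delta-(\lambda-n+k)\,d\iota_j .$$ In $A\otimes B$ below, $A$ acts in the variable $x$ on $\Lambda^k$ and $B$ in the variable $y$ on $\Lambda^\ell$. Let $$E^{k,\ell}_{s,t}=-\|x-y\|^2\,\Box_{k,s}\otimes\Box_{\ell,t}+2\sum_j(x_j-y_j)\{\nabla_{k,s,j}\otimes\Box_{\ell,t}-\Box_{k,s}\otimes\nabla_{\ell,t,j}\}+2\sum_j\nabla_{k,s,j}\otimes\nabla_{\ell,t,j}$$ $$+(t-2)(t-n-2)(t-n+2\ell)(t+n-2\ell)\,\Box_{k,s}\otimes\mathrm{Id}+(s-2)(s-n-2)(s-n+2k)(s+n-2k)\,\mathrm{Id}\otimes\Box_{\ell,t}.$$ The source operator is $F^{k,\ell}_{\lambda,\mu}=-E^{k,\ell}_{n-2\lambda,n-2\mu}$, and for $m\ge1$, $F^{k,\ell}_{\lambda,\mu;m}=F^{k,\ell}_{\lambda+m-1,\mu+m-1}\circ\cdots\circ F^{k,\ell}_{\lambda,\mu}$. For an $SO(n)$-invariant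 subspace $\Gamma\subset\Lambda^k\otimes\Lambda^\ell$ let $\sigma_\Gamma$ be the restriction of $\sigma_k\otimes\sigma_\ell$, $p_\Gamma$ the orthogonal projection onto $\Gamma$, $(\mathrm{res}_\Gamma\,\omega)(x)=p_\Gamma(\omega(x,x))$, and $B^{k,\ell;\Gamma}_{\lambda,\mu;m}=\mathrm{res}_\Gamma\circ F^{k,\ell}_{\lambda,\mu;m}$. $G=SO_0(1,n+1)$ acts rationally on $\mathbb R^n$ by conformal maps through the stereographic projection, with conformal factor $\Omega(g,x)$. For $g\in G$, $$(\pi^k_\lambda\otimes\pi^\ell_\mu)(g)\,\omega(x,y)=\Omega(g^{-1},x)^\lambda\,\Omega(g^{-1},y)^\mu\,(L_{g^{-1}}^*\omega)(x,y).$$ With $g=\bar n(g)\,m(g)\,a_{t(g)}\,n(g)$ the decomposition in $\overline N MAN$ ($P=MAN$ the stabilizer of $0\in\mathbb R^n$, $M\simeq SO(n)$, $a_t(x)=e^{-t}x$, $\bar n_x$ the translation by $x$) and $\chi_\nu(a_t)=e^{\nu t}$, $\mathrm{Ind}_P^G(\tau\otimes\chi_\nu\otimes1)$ is realized by $(g f)(x)=e^{-\nu\,t(g^{-1}\bar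 n_x)}\,\tau(m(g^{-1}\bar n_x))^{-1}f(g^{-1}(x))$. An operator $B$ on $\mathcal E^{k,\ell}$ is *covariant* from $\pi^k_\lambda\otimes\pi^\ell_\mu$ to this representation if $B\big((\pi^k_\lambda\otimes\pi^\ell_\mu)(g)\omega\big)(x)=\big(g\,(B\omega)\big)(x)$ for all $g\in G$, $\omega\in\mathcal E^{k,\ell}$ and all $x$ at which $g^{-1}$ is defined. **Theorem.** 1. For every irreducible $SO(n)$-invariant subspace $\Gamma\subset\Lambda^k\otimes\Lambda^\ell$, all $\lambda,\mu\in\mathbb C$ and $m\ge1$: $B^{k,\ell;\Gamma}_{\lambda,\mu;m}$ is a bi-differential operator with smooth coefficients, and $B^{k,\ell;\Gamma}_{\lambda+k,\mu+\ell;m}$ is covariant from $\pi^k_\lambda\otimes\pi^\ell_\mu$ to $\mathrm{Ind}_P^G(\sigma_\Gamma\otimes\chi_{\lambda+\mu+k+\ell+2m}\otimes1)$. 2. Let $k+\ell\le n$. There are an $SO(n)$-invariant subspace $\Gamma\subset\Lambda^k\otimes\Lambda^\ell$ and an $SO(n)$-equivariant linear isomorphism $\Gamma\simeq\Lambda^{k+\ell}$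 under which $p_\Gamma(\omega\otimes\eta)=\omega\wedge\eta$. The assertions of 1 hold for this $\Gamma$ (even where it is reducible), and for $\omega\in C^\infty(\mathbb R^n,\Lambda^k)$, $\eta\in C^\infty(\mathbb R^n,\Lambda^\ell)$, with values identified with elements of $\Lambda^{k+\ell}$, $$B^{k,\ell;\Gamma}_{\lambda,\mu;1}(\omega\otimes\eta)=-32\Big\{(2\mu-n+2)(\mu+1)(\mu-\ell)(\mu-n+\ell)\,\widetilde\Box_{k,\lambda}\omega\wedge\eta+(2\lambda-n+2)(2\mu-n+2)\sum_j\widetilde\nabla_{k,\lambda,j}\omega\wedge\widetilde\nabla_{\ell,\mu,j}\eta$$ $$+(2\lambda-n+2)(\lambda+1)(\lambda-k)(\lambda-n+k)\,\omega\wedge\widetilde\Box_{\ell,\mu}\eta\Big\}.$$ 3. For $k=\ell=0$, $\Gamma=\Lambda^0\otimes\Lambda^0=\mathbb C$ is irreducible, and for $\omega,\eta\in C^\infty(\mathbb R^n)$, with $Q(\partial)=\sum_j\partial_j^2$, one recovers the multidimensional Rankin–Cohen operators $$B^{0,0;\mathbb C}_{\lambda,\mu;1}(\omega\otimes\eta)=-64(\lambda+1)(\lambda-n)(\mu+1)(\mu-n)\Big\{-\mu(\mu-\tfrac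 n2+1)\,(Q(\partial)\omega)\,\eta+2(\lambda-\tfrac n2+1)(\mu-\tfrac n2+1)\sum_j\partial_j\omega\,\partial_j\eta-\lambda(\lambda-\tfrac n2+1)\,\omega\,Q(\partial)\eta\Big\}.$$ -/

import Mathlib

open scoped ContDiff Matrix

noncomputable section

namespace ConfForms

/-! ## Alternating forms

`Λ^k` is the space of complex-valued alternating real-multilinear `k`-forms on `ℝⁿ`, and
`Λ^k ⊗ Λ^ℓ` is realised as the space of `k`-forms with values in `Λ^ℓ`, that is, of maps
`T(v₁,…,v_k)(w₁,…,w_ℓ)` alternating in the `v`'s and in the `w`'s. -/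

/-- `ℝⁿ` with its Euclidean structure. -/
abbrev E (n : ℕ) : Type := EuclideanSpace ℝ (Fin n)

/-- The standard basis vector `e_j`. -/
def e {n : ℕ} (j : Fin n) : E n := EuclideanSpace.single j 1

/-- `Λ^k`. -/
def Lam (n k : ℕ) : Type := E n [⋀^Fin k]→L[ℝ] ℂ

instance (n k : ℕ) : NormedAddCommGroup (Lam n k) :=
  inferInstanceAs (NormedAddCommGroup (E n [⋀^Fin k]→L[ℝ] ℂ))

instance (n k : ℕ) : NormedSpace ℝ (Lam n k) :=
  inferInstanceAs (NormedSpace ℝ (E n [⋀^Fin k]→L[ℝ] ℂ))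

instance (n k : ℕ) : NormedSpace ℂ (Lam n k) :=
  inferInstanceAs (NormedSpace ℂ (E n [⋀^Fin k]→L[ℝ] ℂ))

instance (n k : ℕ) : IsScalarTower ℝ ℂ (Lam n k) :=
  inferInstanceAs (IsScalarTower ℝ ℂ (E n [⋀^Fin k]→L[ℝ] ℂ))

instance (n k : ℕ) : SMulCommClass ℝ ℂ (Lam n k) :=
  inferInstanceAs (SMulCommClass ℝ ℂ (E n [⋀^Fin k]→L[ℝ] ℂ))

instance (n k : ℕ) : FunLike (Lam n k) (Fin k → E n) ℂ :=
  inferInstanceAs (FunLike (E n [⋀^Fin k]→L[ℝ] ℂ) (Fin k → E n) ℂ)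

theorem Lam.add_apply {n k : ℕ} (S T : Lam n k) (v : Fin k → E n) : (S + T) v = S v + T v := rfl

theorem Lam.smul_apply {n k : ℕ} (c : ℂ) (T : Lam n k) (v : Fin k → E n) :
    (c • T) v = c * T v := rfl

theorem Lam.real_smul_apply {n k : ℕ} (c : ℝ) (T : Lam n k) (v : Fin k → E n) :
    (c • T) v = c • T v := rfl

theorem Lam.ext {n k : ℕ} {S T : Lam n k} (h : ∀ v, S v = T v) : S = T := DFunLike.ext S T h

/-- `Λ^k ⊗ Λ^ℓ`. -/
abbrev BiLam (n k l : ℕ) : Type := E n [⋀^Fin k]→L[ℝ] Lam n l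

/-- The decomposable element `φ ⊗ ψ`. -/
def tensor {n k l : ℕ} (φ : Lam n k) (ψ : Lam n l) : BiLam n k l :=
  ((ContinuousLinearMap.toSpanSingleton ℂ ψ).restrictScalars ℝ).compContinuousAlternatingMap φ

/-- The flip `Λ^k ⊗ Λ^ℓ → Λ^ℓ ⊗ Λ^k`, `(swap T)(w)(v) = T(v)(w)`. -/
def swap {n k l : ℕ} (T : BiLam n k l) : BiLam n l k :=
  AlternatingMap.mkContinuousAlternating
    { toFun := fun w =>
        { toFun := fun v => T v w
          map_update_add' := fun v i x y => by rw [T.map_update_add]; rfl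
          map_update_smul' := fun v i c x => by rw [T.map_update_smul]; rfl
          map_eq_zero_of_eq' := fun v i j h hij => by
            rw [T.map_eq_zero_of_eq v h hij]; rfl }
      map_update_add' := fun w i x y => by
        ext v
        exact ContinuousAlternatingMap.map_update_add (T v) w i x y
      map_update_smul' := fun w i c x => by
        ext v
        exact ContinuousAlternatingMap.map_update_smul (T v) w i c x
      map_eq_zero_of_eq' := fun w i j h hij => by
        ext v
        exact ContinuousAlternatingMap.map_eq_zero_of_eq (T v) w h hij }
    ‖T‖ (fun w v => by
      calc ‖T v w‖ ≤ ‖T v‖ * ∏ i, ‖w i‖ := ContinuousAlternatingMap.le_opNorm (T v) w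
        _ ≤ (‖T‖ * ∏ i, ‖v i‖) * ∏ i, ‖w i‖ := by gcongr; exact T.le_opNorm v
        _ = (‖T‖ * ∏ i, ‖w i‖) * ∏ i, ‖v i‖ := by ring)

theorem swap_apply {n k l : ℕ} (T : BiLam n k l) (w : Fin l → E n) (v : Fin k → E n) :
    swap T w v = T v w := rfl

/-- Forgetting that a form is alternating. -/
def Lam.toMultilinear (n k : ℕ) :
    Lam n k →L[ℝ] ContinuousMultilinearMap ℝ (fun _ : Fin k => E n) ℂ :=
  (ContinuousAlternatingMap.toContinuousMultilinearMapCLM ℝ :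
    (E n [⋀^Fin k]→L[ℝ] ℂ) →L[ℝ] ContinuousMultilinearMap ℝ (fun _ : Fin k => E n) ℂ)

/-- The wedge product `Λ^k ⊗ Λ^ℓ → Λ^{k+ℓ}`, `φ ⊗ ψ ↦ φ ∧ ψ`:
`(∧T)(v) = (1 / (k! ℓ!)) ∑_σ sgn(σ) T(v_{σ(1)},…,v_{σ(k)})(v_{σ(k+1)},…,v_{σ(k+ℓ)})`. -/
def wedge {n k l : ℕ} (T : BiLam n k l) : Lam n (k + l) :=
  (((k.factorial * l.factorial : ℂ)⁻¹) •
    ContinuousMultilinearMap.alternatization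
      ((ContinuousMultilinearMap.uncurrySum
        ((Lam.toMultilinear n l).compContinuousMultilinearMap
          T.toContinuousMultilinearMap)).domDomCongr finSumFinEquiv) : E n [⋀^Fin (k + l)]→L[ℝ] ℂ)

theorem wedge_apply {n k l : ℕ} (T : BiLam n k l) (v : Fin (k + l) → E n) :
    wedge T v = ((k.factorial * l.factorial : ℂ)⁻¹) * ∑ σ : Equiv.Perm (Fin (k + l)),
      (Equiv.Perm.sign σ : ℤ) • T (fun i => v (σ (Fin.castAdd l i)))
        (fun i => v (σ (Fin.natAdd k i))) := by
  refine Eq.trans (congrArg (((k.factorial * l.factorial : ℂ)⁻¹) * ·)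
    (ContinuousMultilinearMap.alternatization_apply_apply _ v)) ?_
  rfl

section Fields

/-! ## Differential operators on forms on `ℝⁿ` with values in a complex normed space `V` -/

variable {n : ℕ} {V : Type*} [NormedAddCommGroup V] [NormedSpace ℝ V] [NormedSpace ℂ V]
  [SMulCommClass ℝ ℂ V]

/-- `V`-valued differential `k`-forms on `ℝⁿ` (no regularity included). -/
abbrev Form (n k : ℕ) (V : Type*) [NormedAddCommGroup V] [NormedSpace ℝ V] : Type _ :=
  E n → E n [⋀^Fin k]→L[ℝ] V

/-- `∂_j`. -/
def pd {F : Type*} [NormedAddCommGroup F] [NormedSpace ℝ F] (j : Fin n) (f : E n → F) :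
    E n → F := fun x => fderiv ℝ f x (e j)

/-- Exterior product `ε_j φ = e_j^* ∧ φ`. -/
def eps {k : ℕ} (j : Fin n) (T : E n [⋀^Fin k]→L[ℝ] V) : E n [⋀^Fin (k + 1)]→L[ℝ] V :=
  ContinuousAlternatingMap.alternatizeUncurryFin
    ((EuclideanSpace.proj j : E n →L[ℝ] ℝ).smulRight T)

/-- Interior product `ι_j φ = φ(e_j, ·)`. -/
def iota {k : ℕ} (j : Fin n) (T : E n [⋀^Fin (k + 1)]→L[ℝ] V) : E n [⋀^Fin k]→L[ℝ] V :=
  T.curryLeft (e j)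

/-- The co-differential `δ = - ∑_m ι_m ∂_m` on forms of positive degree. -/
def codiff {k : ℕ} (φ : Form n (k + 1) V) : Form n k V := fun x => - ∑ m, iota m (pd m φ x)

/-- `δ d`. -/
def codiffD {k : ℕ} (φ : Form n k V) : Form n k V := codiff (extDeriv φ)

/-- `d δ`, with `δ = 0` on `0`-forms. -/
def dCodiff : {k : ℕ} → Form n k V → Form n k V
  | 0, _ => 0
  | _ + 1, φ => extDeriv (codiff φ)

/-- `ε_j δ`, with `δ = 0` on `0`-forms. -/
def epsCodiff (j : Fin n) : {k : ℕ} → Form n k V → Form n k V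
  | 0, _ => 0
  | _ + 1, φ => fun x => eps j (codiff φ x)

/-- `d ι_j`, with `ι_j = 0` on `0`-forms. -/
def dIota (j : Fin n) : {k : ℕ} → Form n k V → Form n k V
  | 0, _ => 0
  | _ + 1, φ => extDeriv (fun x => iota j (φ x))

/-- `□_{k,s} = α_{k,s} δ d + β_{k,s} d δ`. -/
def box {k : ℕ} (s : ℂ) (φ : Form n k V) : Form n k V := fun x =>
  ((s + n - 2 * k) * (s - n + 2 * k - 2)) • codiffD φ x
    + ((s - n + 2 * k) * (s + n - 2 * k - 2)) • dCodiff φ x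

/-- `∇_{k,s,j}`. -/
def nabla {k : ℕ} (s : ℂ) (j : Fin n) (φ : Form n k V) : Form n k V := fun x =>
  (2 - s) • (((s + n - 2 * k) * (s - n + 2 * k - 2)) • pd j φ x
    + (2 * (s - n + 2 * k)) • epsCodiff j φ x
    + (2 * (s + n - 2 * k)) • dIota j φ x)

/-- `□̃_{k,λ} = (λ-n+k)(λ-k+1) δ d + (λ-n+k+1)(λ-k) d δ`. -/
def boxT {k : ℕ} (lam : ℂ) (φ : Form n k V) : Form n k V := fun x =>
  ((lam - n + k) * (lam - k + 1)) • codiffD φ x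
    + ((lam - n + k + 1) * (lam - k)) • dCodiff φ x

/-- `∇̃_{k,λ,j} = (λ-n+k)(λ-k+1) ∂_j - (λ-k) ε_j δ - (λ-n+k) d ι_j`. -/
def nablaT {k : ℕ} (lam : ℂ) (j : Fin n) (φ : Form n k V) : Form n k V := fun x =>
  ((lam - n + k) * (lam - k + 1)) • pd j φ x
    - (lam - k) • epsCodiff j φ x - (lam - n + k) • dIota j φ x

end Fields

/-! ## The source operator -/

/-- Forms of bidegree `(k,ℓ)` on `ℝⁿ × ℝⁿ` (no regularity included). -/
abbrev BiForm (n k l : ℕ) : Type := E n × E n → BiLam n k l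

/-- `A ⊗ Id`: the operator `A` on `k`-forms acting in the variable `x` and on the factor `Λ^k`. -/
def onX {n k l : ℕ} (A : Form n k (Lam n l) → Form n k (Lam n l)) (φ : BiForm n k l) :
    BiForm n k l := fun p => A (fun x => φ (x, p.2)) p.1

/-- `Id ⊗ A`: the operator `A` on `ℓ`-forms acting in the variable `y` and on the factor `Λ^ℓ`. -/
def onY {n k l : ℕ} (A : Form n l (Lam n k) → Form n l (Lam n k)) (φ : BiForm n k l) :
    BiForm n k l := fun p => swap (A (fun y => swap (φ (p.1, y))) p.2)

/-- The operator `E_{s,t}^{k,ℓ}` in normal form. -/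
def opE {n k l : ℕ} (s t : ℂ) (φ : BiForm n k l) : BiForm n k l := fun p =>
  - ((‖p.1 - p.2‖ ^ 2 : ℝ) : ℂ) • onX (box s) (onY (box t) φ) p
  + (2 : ℂ) • ∑ j, ((p.1 j - p.2 j : ℝ) : ℂ) •
      (onX (nabla s j) (onY (box t) φ) p - onX (box s) (onY (nabla t j) φ) p)
  + (2 : ℂ) • ∑ j, onX (nabla s j) (onY (nabla t j) φ) p
  + ((t - 2) * (t - n - 2) * (t - n + 2 * l) * (t + n - 2 * l)) • onX (box s) φ p
  + ((s - 2) * (s - n - 2) * (s - n + 2 * k) * (s + n - 2 * k)) • onY (box t) φ p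

/-- The source operator `F_{λ,μ}^{k,ℓ} = - E_{n-2λ,n-2μ}^{k,ℓ}`. -/
def sourceOp {n k l : ℕ} (lam mu : ℂ) (φ : BiForm n k l) : BiForm n k l :=
  - opE (n - 2 * lam) (n - 2 * mu) φ

/-- `F_{λ,μ;m} = F_{λ+m-1,μ+m-1} ∘ ⋯ ∘ F_{λ+1,μ+1} ∘ F_{λ,μ}`. -/
def sourceIter {n k l : ℕ} (lam mu : ℂ) : ℕ → BiForm n k l → BiForm n k l
  | 0, φ => φ
  | m + 1, φ => sourceOp (lam + m) (mu + m) (sourceIter lam mu m φ)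

/-! ## Representations of `SO(n)` on forms, orthogonal projections, the operators `B` -/

/-- `SO(n)`. -/
abbrev SO (n : ℕ) : Type := Matrix.specialOrthogonalGroup (Fin n) ℝ

/-- A matrix as a linear map of `ℝⁿ`. -/
abbrev matMap {n : ℕ} (m : Matrix (Fin n) (Fin n) ℝ) : E n →L[ℝ] E n :=
  Matrix.toEuclideanCLM (𝕜 := ℝ) m

/-- Pullback of a form: `(pullLam A T)(v) = T(A v₁,…,A v_p)`. -/
def pullLam {n p : ℕ} (A : E n →L[ℝ] E n) : Lam n p →L[ℝ] Lam n p :=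
  (ContinuousAlternatingMap.compContinuousLinearMapCLM A :
    (E n [⋀^Fin p]→L[ℝ] ℂ) →L[ℝ] (E n [⋀^Fin p]→L[ℝ] ℂ))

theorem pullLam_apply {n p : ℕ} (A : E n →L[ℝ] E n) (T : Lam n p) (v : Fin p → E n) :
    pullLam A T v = T (fun i => A (v i)) := rfl

/-- Pullback: `(pull A B T)(v)(w) = T(A v₁,…,A v_k)(B w₁,…,B w_ℓ)`. -/
def pull {n k l : ℕ} (A B : E n →L[ℝ] E n) (T : BiLam n k l) : BiLam n k l :=
  (pullLam B).compContinuousAlternatingMap (T.compContinuousLinearMap A)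

theorem pull_apply {n k l : ℕ} (A B : E n →L[ℝ] E n) (T : BiLam n k l)
    (v : Fin k → E n) (w : Fin l → E n) :
    pull A B T v w = T (fun i => A (v i)) (fun i => B (w i)) := rfl

theorem pullLam_one {n p : ℕ} (T : Lam n p) : pullLam 1 T = T := rfl

theorem pullLam_mul {n p : ℕ} (A B : E n →L[ℝ] E n) (T : Lam n p) :
    pullLam (A * B) T = pullLam B (pullLam A T) := rfl

theorem pull_one {n k l : ℕ} (T : BiLam n k l) : pull 1 1 T = T := rfl

theorem pull_mul {n k l : ℕ} (A B : E n →L[ℝ] E n) (T : BiLam n k l) :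
    pull (A * B) (A * B) T = pull B B (pull A A T) := rfl

/-- The representation `σ_p` of `SO(n)` on `Λ^p`. -/
def sigma (n p : ℕ) : Representation ℂ (SO n) (Lam n p) where
  toFun m :=
    { toFun := pullLam (matMap ((m⁻¹ : SO n) : Matrix _ _ ℝ))
      map_add' := fun _ _ => rfl
      map_smul' := fun _ _ => rfl }
  map_one' := by
    refine LinearMap.ext fun T => ?_
    change pullLam (matMap ((1⁻¹ : SO n) : Matrix _ _ ℝ)) T = T
    rw [inv_one, OneMemClass.coe_one, matMap, map_one, pullLam_one]
  map_mul' a b := by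
    refine LinearMap.ext fun T => ?_
    change pullLam (matMap (((a * b)⁻¹ : SO n) : Matrix _ _ ℝ)) T =
      pullLam (matMap ((a⁻¹ : SO n) : Matrix _ _ ℝ)) (pullLam (matMap ((b⁻¹ : SO n) : Matrix _ _ ℝ)) T)
    rw [mul_inv_rev, Submonoid.coe_mul, matMap, map_mul, pullLam_mul]

/-- The representation `σ_k ⊗ σ_ℓ` of `SO(n)` on `Λ^k ⊗ Λ^ℓ`. -/
def sigmaBi (n k l : ℕ) : Representation ℂ (SO n) (BiLam n k l) where
  toFun m :=
    { toFun := pull (matMap ((m⁻¹ : SO n) : Matrix _ _ ℝ)) (matMap ((m⁻¹ : SO n) : Matrix _ _ ℝ))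
      map_add' := fun _ _ => rfl
      map_smul' := fun _ _ => rfl }
  map_one' := by
    refine LinearMap.ext fun T => ?_
    change pull (matMap ((1⁻¹ : SO n) : Matrix _ _ ℝ)) (matMap ((1⁻¹ : SO n) : Matrix _ _ ℝ)) T = T
    rw [inv_one, OneMemClass.coe_one, matMap, map_one, pull_one]
  map_mul' a b := by
    refine LinearMap.ext fun T => ?_
    change pull (matMap (((a * b)⁻¹ : SO n) : Matrix _ _ ℝ))
        (matMap (((a * b)⁻¹ : SO n) : Matrix _ _ ℝ)) T =
      pull (matMap ((a⁻¹ : SO n) : Matrix _ _ ℝ)) (matMap ((a⁻¹ : SO n) : Matrix _ _ ℝ))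
        (pull (matMap ((b⁻¹ : SO n) : Matrix _ _ ℝ)) (matMap ((b⁻¹ : SO n) : Matrix _ _ ℝ)) T)
    rw [mul_inv_rev, Submonoid.coe_mul, matMap, map_mul, pull_mul]

/-- The components `T(e_{i₁},…,e_{i_k})(e_{j₁},…,e_{j_ℓ})` over all index tuples. The `ℓ²` inner
product of components is `k! ℓ!` times the inner product of `Λ^k ⊗ Λ^ℓ` for which the vectors
`e_I^* ⊗ e_J^*` (`I`, `J` increasing) form an orthonormal basis. -/
def comps {n k l : ℕ} :
    BiLam n k l →ₗ[ℂ] EuclideanSpace ℂ ((Fin k → Fin n) × (Fin l → Fin n)) where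
  toFun T := WithLp.toLp 2 fun a => T (fun i => e (a.1 i)) (fun i => e (a.2 i))
  map_add' _ _ := rfl
  map_smul' _ _ := rfl

theorem comps_injective {n k l : ℕ} : Function.Injective (comps : BiLam n k l →ₗ[ℂ] _) := by
  intro S T h
  have h' : ∀ (a : Fin k → Fin n) (b : Fin l → Fin n),
      S (fun i => e (a i)) (fun i => e (b i)) = T (fun i => e (a i)) (fun i => e (b i)) :=
    fun a b => congrFun (congrArg WithLp.ofLp h) (a, b)
  have hb : ∀ j : Fin n, (EuclideanSpace.basisFun (Fin n) ℝ).toBasis j = e j := by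
    intro j; simp [e]
  apply ContinuousAlternatingMap.toAlternatingMap_injective
  refine Module.Basis.ext_alternating (EuclideanSpace.basisFun (Fin n) ℝ).toBasis fun a _ => ?_
  simp only [hb]
  apply ContinuousAlternatingMap.toAlternatingMap_injective (R := ℝ) (M := E n) (N := ℂ)
  refine Module.Basis.ext_alternating (EuclideanSpace.basisFun (Fin n) ℝ).toBasis fun b _ => ?_
  simp only [hb]
  exact h' a b

/-- The orthogonal complement in `Λ^k ⊗ Λ^ℓ`. -/
def orth {n k l : ℕ} (W : Submodule ℂ (BiLam n k l)) : Submodule ℂ (BiLam n k l) :=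
  ((W.map comps)ᗮ).comap comps

theorem isCompl_orth {n k l : ℕ} (W : Submodule ℂ (BiLam n k l)) : IsCompl W (orth W) := by
  constructor
  · rw [Submodule.disjoint_def]
    intro T hT hT'
    apply comps_injective
    rw [map_zero]
    exact inner_self_eq_zero.mp (hT' (comps T) (Submodule.mem_map_of_mem hT))
  · rw [codisjoint_iff, eq_top_iff]
    intro T _
    obtain ⟨S, hS, hST⟩ := (W.map comps).starProjection_apply_mem (comps T)
    rw [Submodule.mem_sup]
    refine ⟨S, hS, T - S, ?_, by abel⟩
    change comps (T - S) ∈ (W.map comps)ᗮ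
    rw [map_sub, hST]
    exact Submodule.sub_starProjection_mem_orthogonal _

/-- The orthogonal projection `p_Γ : Λ^k ⊗ Λ^ℓ → Γ`. -/
def proj {n k l : ℕ} (W : Submodule ℂ (BiLam n k l)) : BiLam n k l →ₗ[ℂ] W :=
  Submodule.projectionOnto W (orth W) (isCompl_orth W)

/-- `B_{λ,μ;m}^{k,ℓ;Γ} = p_Γ ∘ res ∘ F_{λ,μ;m}`, where `(res φ)(x) = φ(x,x)`. -/
def opB {n k l : ℕ} (Γ : Subrepresentation (sigmaBi n k l)) (lam mu : ℂ) (m : ℕ)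
    (φ : BiForm n k l) (x : E n) : Γ.toSubmodule :=
  proj Γ.toSubmodule (sourceIter lam mu m φ (x, x))

/-! ## The conformal group and its action -/

/-- Indices `0`, `1,…,n`, `n+1` of the coordinates of `ℝ^{1,n+1}`. -/
abbrev Idx (n : ℕ) : Type := Unit ⊕ (Fin n ⊕ Unit)

/-- The matrix of `x₀² - (x₁² + ⋯ + x_{n+1}²)`. -/
def lorentz (n : ℕ) : Matrix (Idx n) (Idx n) ℝ :=
  Matrix.diagonal (Sum.elim (fun _ => 1) (fun _ => -1))

/-- `G = SO₀(1,n+1)`: the connected component of the identity in the isometry group. -/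
def G (n : ℕ) : Set (Matrix (Idx n) (Idx n) ℝ) :=
  connectedComponentIn {g | gᵀ * lorentz n * g = lorentz n} 1

/-- `(1, x') ∈ ℝ^{1,n+1}` for `x' ∈ S^n ⊂ ℝ^{n+1}`. -/
def sphereLift {n : ℕ} (x' : Fin n ⊕ Unit → ℝ) : Idx n → ℝ := Sum.elim (fun _ => 1) x'

/-- The action on the sphere: `(1, g(x')) = (g(1,x'))₀⁻¹ g(1,x')`. -/
def sphereAct {n : ℕ} (g : Matrix (Idx n) (Idx n) ℝ) (x' : Fin n ⊕ Unit → ℝ) : Fin n ⊕ Unit → ℝ :=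
  fun i => ((g *ᵥ sphereLift x') (Sum.inl ()))⁻¹ * (g *ᵥ sphereLift x') (Sum.inr i)

/-- The inverse stereographic projection `κ : ℝⁿ → S^n ∖ {-e_{n+1}}`. -/
def kappa {n : ℕ} (x : E n) : Fin n ⊕ Unit → ℝ :=
  Sum.elim (fun i => 2 * x i / (1 + ‖x‖ ^ 2)) (fun _ => (1 - ‖x‖ ^ 2) / (1 + ‖x‖ ^ 2))

/-- The stereographic projection, inverse to `kappa`. -/
def stereo {n : ℕ} (x' : Fin n ⊕ Unit → ℝ) : E n :=
  WithLp.toLp 2 fun i => x' (Sum.inl i) / (1 + x' (Sum.inr ()))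

/-- `g` is defined at `x ∈ ℝⁿ`: `g(κ(x)) ≠ -e_{n+1}` (a point of the sphere with last coordinate
`-1` is `-e_{n+1}`). -/
def DefinedAt {n : ℕ} (g : Matrix (Idx n) (Idx n) ℝ) (x : E n) : Prop :=
  sphereAct g (kappa x) (Sum.inr ()) ≠ -1

/-- The rational action of `G` on `ℝⁿ`. -/
def act {n : ℕ} (g : Matrix (Idx n) (Idx n) ℝ) (x : E n) : E n := stereo (sphereAct g (kappa x))

/-- The conformal factor `Ω(g,x)`. The differential `Dg(x)` multiplies lengths by a positive
constant, which (for `n ≥ 1`) is its operator norm. -/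
def Omega {n : ℕ} (g : Matrix (Idx n) (Idx n) ℝ) (x : E n) : ℝ := ‖fderiv ℝ (act g) x‖

/-- `(π_λ^k ⊗ π_μ^ℓ)(g) φ (x,y) = Ω(g⁻¹,x)^λ Ω(g⁻¹,y)^μ (L_{g⁻¹}^* φ)(x,y)`. -/
def tensorRep {n k l : ℕ} (lam mu : ℂ) (g : Matrix (Idx n) (Idx n) ℝ) (φ : BiForm n k l) :
    BiForm n k l := fun p =>
  ((Omega g⁻¹ p.1 : ℂ) ^ lam * (Omega g⁻¹ p.2 : ℂ) ^ mu) •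
    pull (fderiv ℝ (act g⁻¹) p.1) (fderiv ℝ (act g⁻¹) p.2) (φ (act g⁻¹ p.1, act g⁻¹ p.2))

/-- The elements of `M ≃ SO(n)`. -/
def matM {n : ℕ} (m : SO n) : Matrix (Idx n) (Idx n) ℝ :=
  Matrix.fromBlocks 1 0 0 (Matrix.fromBlocks (m : Matrix (Fin n) (Fin n) ℝ) 0 0 1)

/-- The elements `a_t` of `A`. -/
def matA {n : ℕ} (t : ℝ) : Matrix (Idx n) (Idx n) ℝ := Matrix.of fun
  | Sum.inl _, Sum.inl _ => Real.cosh t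
  | Sum.inl _, Sum.inr (Sum.inl _) => 0
  | Sum.inl _, Sum.inr (Sum.inr _) => Real.sinh t
  | Sum.inr (Sum.inl _), Sum.inl _ => 0
  | Sum.inr (Sum.inl i), Sum.inr (Sum.inl j) => if i = j then 1 else 0
  | Sum.inr (Sum.inl _), Sum.inr (Sum.inr _) => 0
  | Sum.inr (Sum.inr _), Sum.inl _ => Real.sinh t
  | Sum.inr (Sum.inr _), Sum.inr (Sum.inl _) => 0
  | Sum.inr (Sum.inr _), Sum.inr (Sum.inr _) => Real.cosh t

/-- The elements `n_x` of `N`. -/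
def matN {n : ℕ} (x : E n) : Matrix (Idx n) (Idx n) ℝ := Matrix.of fun
  | Sum.inl _, Sum.inl _ => 1 + ‖x‖ ^ 2 / 2
  | Sum.inl _, Sum.inr (Sum.inl j) => x j
  | Sum.inl _, Sum.inr (Sum.inr _) => -(‖x‖ ^ 2 / 2)
  | Sum.inr (Sum.inl i), Sum.inl _ => x i
  | Sum.inr (Sum.inl i), Sum.inr (Sum.inl j) => if i = j then 1 else 0
  | Sum.inr (Sum.inl i), Sum.inr (Sum.inr _) => -x i
  | Sum.inr (Sum.inr _), Sum.inl _ => ‖x‖ ^ 2 / 2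
  | Sum.inr (Sum.inr _), Sum.inr (Sum.inl j) => x j
  | Sum.inr (Sum.inr _), Sum.inr (Sum.inr _) => 1 - ‖x‖ ^ 2 / 2

/-- The elements `n̄_x` of the opposite group `N̄`. -/
def matNbar {n : ℕ} (x : E n) : Matrix (Idx n) (Idx n) ℝ := Matrix.of fun
  | Sum.inl _, Sum.inl _ => 1 + ‖x‖ ^ 2 / 2
  | Sum.inl _, Sum.inr (Sum.inl j) => x j
  | Sum.inl _, Sum.inr (Sum.inr _) => ‖x‖ ^ 2 / 2
  | Sum.inr (Sum.inl i), Sum.inl _ => x i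
  | Sum.inr (Sum.inl i), Sum.inr (Sum.inl j) => if i = j then 1 else 0
  | Sum.inr (Sum.inl i), Sum.inr (Sum.inr _) => x i
  | Sum.inr (Sum.inr _), Sum.inl _ => -(‖x‖ ^ 2 / 2)
  | Sum.inr (Sum.inr _), Sum.inr (Sum.inl j) => -x j
  | Sum.inr (Sum.inr _), Sum.inr (Sum.inr _) => 1 - ‖x‖ ^ 2 / 2

/-- The data `(y, m, t, z)` of the (unique, if it exists) decomposition `h = n̄_y m a_t n_z` in
`N̄ M A N`. -/
def bruhat {n : ℕ} (h : Matrix (Idx n) (Idx n) ℝ) : E n × SO n × ℝ × E n :=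
  Classical.epsilon fun p => h = matNbar p.1 * matM p.2.1 * matA p.2.2.1 * matN p.2.2.2

/-- `m(h)` in `h = n̄(h) m(h) a_{t(h)} n(h)`. -/
def mPart {n : ℕ} (h : Matrix (Idx n) (Idx n) ℝ) : SO n := (bruhat h).2.1

/-- `t(h)` in `h = n̄(h) m(h) a_{t(h)} n(h)`. -/
def tPart {n : ℕ} (h : Matrix (Idx n) (Idx n) ℝ) : ℝ := (bruhat h).2.2.1

/-- The noncompact realisation of `Ind_P^G (τ ⊗ χ_ν ⊗ 1)`, `χ_ν(a_t) = e^{νt}`, on functions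
`f : ℝⁿ → W`: `(g f)(x) = e^{-ν t(g⁻¹ n̄_x)} τ(m(g⁻¹ n̄_x))⁻¹ f(g⁻¹(x))`. -/
def indRep {n : ℕ} {W : Type*} [AddCommGroup W] [Module ℂ W] (τ : Representation ℂ (SO n) W)
    (nu : ℂ) (g : Matrix (Idx n) (Idx n) ℝ) (f : E n → W) : E n → W := fun x =>
  Complex.exp (-(nu * (tPart (g⁻¹ * matNbar x) : ℂ))) •
    τ (mPart (g⁻¹ * matNbar x))⁻¹ (f (act g⁻¹ x))

/-- `B` is covariant with respect to `π_λ^k ⊗ π_μ^ℓ` and `Ind_P^G (τ ⊗ χ_ν ⊗ 1)`. The group acts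
only locally on `ℝⁿ`, so the relation is required at every point where `g⁻¹` is defined. -/
def IsCovariant {n k l : ℕ} {W : Type*} [AddCommGroup W] [Module ℂ W]
    (B : BiForm n k l → E n → W) (lam mu : ℂ) (τ : Representation ℂ (SO n) W) (nu : ℂ) : Prop :=
  ∀ g ∈ G n, ∀ φ : BiForm n k l, ContDiff ℝ ∞ φ → ∀ x : E n, DefinedAt g⁻¹ x →
    B (tensorRep lam mu g φ) x = indRep τ nu g (B φ) x

/-- The mixed partial derivative `∂_{x_{u₁}} ⋯ ∂_{x_{u_r}} ∂_{y_{v₁}} ⋯ ∂_{y_{v_s}}`. -/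
def mixedPd {n k l : ℕ} (u v : List (Fin n)) (φ : BiForm n k l) : BiForm n k l :=
  u.foldr (fun j f p => fderiv ℝ f p (e j, 0)) (v.foldr (fun j f p => fderiv ℝ f p (0, e j)) φ)

/-- `B` is a bi-differential operator: `(B φ)(x)` is a finite sum of terms
`a(x) (∂_x^u ∂_y^v φ)(x,x)` whose coefficients `a` are smooth with values in the linear maps. -/
def IsBiDifferential {n k l : ℕ} {W : Submodule ℂ (BiLam n k l)}
    (B : BiForm n k l → E n → W) : Prop :=
  ∃ (S : Finset (List (Fin n) × List (Fin n)))
    (a : List (Fin n) × List (Fin n) → E n → (BiLam n k l →L[ℂ] BiLam n k l)),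
    (∀ w ∈ S, ContDiff ℝ ∞ (a w)) ∧
    ∀ φ : BiForm n k l, ContDiff ℝ ∞ φ → ∀ x : E n,
      (B φ x : BiLam n k l) = ∑ w ∈ S, a w x (mixedPd w.1 w.2 φ (x, x))

end ConfForms

end

/-! The operator E is a Lorentz contraction in disguise. Represent a point x of ℝⁿ by the null
vector X of ℝ^{1,n+1} (`coneLift`), and let Z_j = ∂_j X (`tangentLift`) and Y = `lc 0 0 1` be the
other members of the moving frame. Put D = X □ - ∑_j Z_j ∇_j - c Y (`tracD`), an operator from forms
to forms with values in ℝ^{1,n+1}. The pairings of the frame at x with the frame at y are multiples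
of ‖x-y‖², x_j-y_j, δ_ij and constants, and they turn -(1/2) ∑_a ± D_a ⊗ D_a into exactly E
(`opE_eq_tracD`).

The heart of the proof is the covariance of D (`tracD_covariant`): D of the pullback Ω^λ h^* φ,
where h is the action of g⁻¹, is g applied to the pullback with weight λ+1 of Dφ. Applied once in x
and once in y, this produces two factors g, which the invariance of the Lorentz form removes. Hence
F carries weights (λ, μ) to (λ+1, μ+1) (`sourceOp_covariant`).

Covariance of D is a statement about 2-jets. Near x₀ the decomposition g⁻¹ n̄_{x₀} = n̄_y m a_t n_z
presents h as x ↦ y + e^{-t} m(n_z(x - x₀)). If b is the gradient of log Ω, the derivatives of b and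
of the differential of h are explicit in b and the differential (`IsConformalAt`), so the 2-jet of a
pullback closes up (`confPull_jets`). All operators on forms are written through the endomorphisms
ε_i ι_j (`opN`), and three families of relations among these (`IsExteriorGl`) suffice. For the given
coefficients of □ and ∇ every term which is not a multiple of the pulled back □φ, ∇φ or φ cancels
(`IsExteriorGl.nabla_transform`, `IsExteriorGl.box_transform`). What survives is matched by the
effect of g on the frame X, Z_j, Y, with b = -2z at x₀.

F is local and covariant on the open set where g⁻¹ is defined, so it can be iterated there
(`sourceIter_covariant`). On the diagonal the differential of h is e^{-t} m, which turns the tensor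
product action into the inducing representation with exponent λ+μ+k+ℓ+2m. The orthogonal projection
commutes with SO(n) because the complement of an invariant subspace is invariant
(`isCovariant_opB`). Bi-differentiality holds because operators in the normal form ∑ a ∂_x^u ∂_y^v
are closed under composition (`IsMixedOp.comp`).

For the second assertion Γ is the orthogonal complement of the kernel of the wedge product. On the
diagonal the terms of E containing x-y vanish, and the substitution s = n-2λ gives the formula
(`wedge_opB_tensor`). On functions all ε_i ι_j vanish, and the Rankin–Cohen formula remains
(`opB_scalars`). -/

noncomputable section

namespace ConfForms

/-! ### The endomorphisms ε_i ι_j of the exterior powers and their relations -/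

section FormAlgebra

variable {n k : ℕ} {V : Type*} [NormedAddCommGroup V] [NormedSpace ℝ V]

/-- The derivation of the algebra of forms induced by an endomorphism of `ℝⁿ`. -/
def derivAct (W : E n →L[ℝ] E n) : (E n [⋀^Fin k]→L[ℝ] V) →L[ℝ] (E n [⋀^Fin k]→L[ℝ] V) :=
  (ContinuousAlternatingMap.fderivCompContinuousLinearMapCLM V
    (ContinuousLinearMap.id ℝ (E n))).flip W

theorem derivAct_apply (W : E n →L[ℝ] E n) (T : E n [⋀^Fin k]→L[ℝ] V) (v : Fin k → E n) :
    derivAct W T v = ∑ a, T (Function.update v a (W (v a))) := by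
  rw [derivAct, ContinuousLinearMap.flip_apply,
    ContinuousAlternatingMap.fderivCompContinuousLinearMapCLM_apply,
    ContinuousAlternatingMap.fderivCompContinuousLinearMap_apply]
  refine Finset.sum_congr rfl fun a _ => congrArg T (funext fun j => ?_)
  by_cases h : j = a
  · subst h; simp
  · simp [Function.update_of_ne h]

/-- The rank one endomorphism `v ↦ v_i e_m`. -/
def unitMap (i m : Fin n) : E n →L[ℝ] E n := (EuclideanSpace.proj i : E n →L[ℝ] ℝ).smulRight (e m)

theorem unitMap_apply (i m : Fin n) (v : E n) : unitMap i m v = v i • e m := rfl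

theorem derivAct_unitMap_apply (i m : Fin n) (T : E n [⋀^Fin k]→L[ℝ] V) (v : Fin k → E n) :
    derivAct (unitMap i m) T v = ∑ a, v a i • T (Function.update v a (e m)) := by
  simp only [derivAct_apply, unitMap_apply, ContinuousAlternatingMap.map_update_smul]

theorem e_apply (i j : Fin n) : (e i : E n) j = if j = i then 1 else 0 := by
  simp [e]

theorem sum_smul_e (v : E n) : ∑ i, v i • (e i : E n) = v := by
  ext j
  simp [e_apply]

/-- The normally ordered product of two elementary derivations. -/
def crossAct (i j p q : Fin n) (T : E n [⋀^Fin k]→L[ℝ] V) (v : Fin k → E n) : V :=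
  ∑ a, ∑ b, if a = b then 0 else (v a i * v b p) •
    T (Function.update (Function.update v a (e j)) b (e q))

/-- Each derivation replaces one slot at a time. If both act on the same slot, the p-th coordinate
of the inserted e_j gives the Kronecker symbol; distinct slots give the normally ordered part. -/
theorem derivAct_mul_apply (i j p q : Fin n) (T : E n [⋀^Fin k]→L[ℝ] V) (v : Fin k → E n) :
    derivAct (unitMap i j) (derivAct (unitMap p q) T) v =
      (if j = p then derivAct (unitMap i q) T v else 0) + crossAct i j p q T v := by
  have h : (if j = p then derivAct (unitMap i q) T v else 0) =
      ∑ a, (v a i * (if j = p then 1 else 0)) • T (Function.update v a (e q)) := by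
    split_ifs <;> simp [derivAct_unitMap_apply]
  rw [h, derivAct_unitMap_apply, crossAct, ← Finset.sum_add_distrib]
  refine Finset.sum_congr rfl fun a _ => ?_
  rw [derivAct_unitMap_apply, Finset.smul_sum]
  rw [← Finset.add_sum_erase _ _ (Finset.mem_univ a), ← Finset.add_sum_erase (Finset.univ)
    (fun b => if a = b then (0 : V) else _) (Finset.mem_univ a)]
  rw [if_pos rfl, zero_add]
  congr 1
  · rw [Function.update_self, Function.update_idem, e_apply, smul_smul]
    simp [eq_comm]
  · refine Finset.sum_congr rfl fun b hb => ?_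
    have hab : b ≠ a := (Finset.mem_erase.mp hb).1
    rw [if_neg hab.symm, Function.update_of_ne hab, smul_smul]

/-- The vectors e_j and e_q occupy two different slots, so exchanging them costs a sign. This is the
point where alternation of the form is used. -/
theorem crossAct_swap_vectors (i j p q : Fin n) (T : E n [⋀^Fin k]→L[ℝ] V) (v : Fin k → E n) :
    crossAct i j p q T v = - crossAct i q p j T v := by
  simp only [crossAct, ← Finset.sum_neg_distrib]
  refine Finset.sum_congr rfl fun a _ => Finset.sum_congr rfl fun b _ => ?_
  split_ifs with h
  · simp
  · rw [← smul_neg]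
    congr 1
    have := T.toAlternatingMap.map_swap (Function.update (Function.update v a (e q)) b (e j)) h
    refine Eq.trans (congrArg T ?_) this
    funext c
    rcases eq_or_ne c a with rfl | hca
    · simp [Function.update_of_ne h]
    rcases eq_or_ne c b with rfl | hcb
    · simp [Function.update_of_ne h]
    · simp [Equiv.swap_apply_of_ne_of_ne hca hcb, Function.update_of_ne hca,
        Function.update_of_ne hcb]

theorem crossAct_comm (i j p q : Fin n) (T : E n [⋀^Fin k]→L[ℝ] V) (v : Fin k → E n) :
    crossAct i j p q T v = crossAct p q i j T v := by
  rw [crossAct, Finset.sum_comm]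
  refine Finset.sum_congr rfl fun a _ => Finset.sum_congr rfl fun b _ => ?_
  by_cases h : a = b
  · simp [h]
  · rw [if_neg h, if_neg (Ne.symm h), mul_comm, Function.update_comm (Ne.symm h)]

variable [NormedSpace ℂ V] [SMulCommClass ℝ ℂ V]

/-- `ε_i ι_m` as a complex linear endomorphism of the space of `V`-valued `k`-forms. -/
def opN (i m : Fin n) : Module.End ℂ (E n [⋀^Fin k]→L[ℝ] V) where
  toFun := derivAct (unitMap i m)
  map_add' := map_add _
  map_smul' c T := by
    ext v
    simp only [derivAct_apply, RingHom.id_apply, ContinuousAlternatingMap.smul_apply,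
      Finset.smul_sum]

theorem opN_apply (i m : Fin n) (T : E n [⋀^Fin k]→L[ℝ] V) :
    opN i m T = derivAct (unitMap i m) T := rfl

theorem opN_apply_apply (i m : Fin n) (T : E n [⋀^Fin k]→L[ℝ] V) (v : Fin k → E n) :
    opN i m T v = ∑ a, v a i • T (Function.update v a (e m)) :=
  derivAct_unitMap_apply i m T v

theorem opN_mul_apply (i j p q : Fin n) (T : E n [⋀^Fin k]→L[ℝ] V) (v : Fin k → E n) :
    ((opN i j * opN p q : Module.End ℂ (E n [⋀^Fin k]→L[ℝ] V)) T) v =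
      ((if j = p then opN i q else 0 : Module.End ℂ (E n [⋀^Fin k]→L[ℝ] V)) T) v
        + crossAct i j p q T v := by
  have := derivAct_mul_apply i j p q T v
  refine this.trans ?_
  congr 1
  split_ifs <;> rfl

/-- The normally ordered parts cancel by `crossAct_swap_vectors`. Unlike the commutator relation,
valid in every representation of 𝔤𝔩_n, this quadratic relation is special to exterior powers. -/
theorem opN_mul_add_vectors (i j p q : Fin n) :
    (opN i j * opN p q + opN i q * opN p j : Module.End ℂ (E n [⋀^Fin k]→L[ℝ] V)) =
      (if j = p then opN i q else 0) + (if q = p then opN i j else 0) := by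
  ext T v
  simp only [LinearMap.add_apply, ContinuousAlternatingMap.add_apply, opN_mul_apply]
  rw [crossAct_swap_vectors i j p q]
  abel

theorem opN_mul_sub (i j p q : Fin n) :
    (opN i j * opN p q - opN p q * opN i j : Module.End ℂ (E n [⋀^Fin k]→L[ℝ] V)) =
      (if j = p then opN i q else 0) - (if q = i then opN p j else 0) := by
  ext T v
  simp only [LinearMap.sub_apply, ContinuousAlternatingMap.sub_apply, opN_mul_apply]
  rw [crossAct_comm i j p q]
  abel

/-- Expanding one slot in the standard basis reproduces the form, and there are k slots. -/
theorem sum_opN : (∑ i, opN i i : Module.End ℂ (E n [⋀^Fin k]→L[ℝ] V)) = (k : ℂ) • 1 := by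
  ext T v
  simp only [LinearMap.sum_apply, ContinuousAlternatingMap.sum_apply, opN_apply_apply]
  rw [Finset.sum_comm]
  have : ∀ a, ∑ i, v a i • T (Function.update v a (e i)) = T v := by
    intro a
    simp only [← ContinuousAlternatingMap.map_update_smul]
    have h := T.toAlternatingMap.map_update_sum Finset.univ a (fun i => v a i • e i) v
    rw [sum_smul_e, Function.update_eq_self] at h
    exact h.symm
  simp [this, Nat.cast_smul_eq_nsmul]

end FormAlgebra

/-! ### The operators □ and ∇ in terms of 1-jets and 2-jets -/

section Jets

open Filter Topology

variable {n k : ℕ} {V : Type*} [NormedAddCommGroup V] [NormedSpace ℝ V]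

/-- `eps` as a continuous linear map. -/
def epsL (j : Fin n) : (E n [⋀^Fin k]→L[ℝ] V) →L[ℝ] (E n [⋀^Fin (k + 1)]→L[ℝ] V) :=
  ContinuousAlternatingMap.alternatizeUncurryFinCLM ℝ (E n) V ∘L
    ContinuousLinearMap.smulRightL ℝ (E n) (E n [⋀^Fin k]→L[ℝ] V)
      (EuclideanSpace.proj j : E n →L[ℝ] ℝ)

/-- `iota` as a continuous linear map. -/
def iotaL (j : Fin n) : (E n [⋀^Fin (k + 1)]→L[ℝ] V) →L[ℝ] (E n [⋀^Fin k]→L[ℝ] V) :=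
  ContinuousLinearMap.apply ℝ _ (e j) ∘L
    (ContinuousAlternatingMap.curryLeftLI (𝕜 := ℝ) (E := E n) (F := V)
      (n := k)).toContinuousLinearMap

theorem epsL_apply (j : Fin n) (T : E n [⋀^Fin k]→L[ℝ] V) : epsL j T = eps j T := rfl

theorem iotaL_apply (j : Fin n) (T : E n [⋀^Fin (k + 1)]→L[ℝ] V) : iotaL j T = iota j T := rfl

theorem eps_apply (j : Fin n) (T : E n [⋀^Fin k]→L[ℝ] V) (v : Fin (k + 1) → E n) :
    eps j T v = ∑ a : Fin (k + 1), (-1 : ℤ) ^ (a : ℕ) • (v a j) • T (a.removeNth v) :=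
  ContinuousAlternatingMap.alternatizeUncurryFin_apply _ _

theorem iota_apply (j : Fin n) (T : E n [⋀^Fin (k + 1)]→L[ℝ] V) (v : Fin k → E n) :
    iota j T v = T (Matrix.vecCons (e j) v) := rfl

theorem insertNth_removeNth' {α : Type*} (a : Fin (k + 1)) (x : α) (v : Fin (k + 1) → α) :
    a.insertNth x (a.removeNth v) = Function.update v a x := by
  simp

/-- The sign of the a-th term of ε_i is undone by moving e_m from the front into slot a. The right
side also makes sense in degree 0, so degree 0 is treated uniformly later. -/
theorem eps_iota (i m : Fin n) (T : E n [⋀^Fin (k + 1)]→L[ℝ] V) :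
    eps i (iota m T) = derivAct (unitMap i m) T := by
  ext v
  rw [eps_apply, derivAct_unitMap_apply]
  refine Finset.sum_congr rfl fun a _ => ?_
  rw [iota_apply, ← T.neg_one_pow_smul_map_insertNth a, insertNth_removeNth', smul_comm (v a i),
    smul_smul, ← pow_add, Even.neg_one_pow ⟨_, rfl⟩, one_smul]

/-- Anticommutation of ε_i and ι_m: slot 0, filled by e_m, gives the Kronecker symbol, and each of
the other slots gives a term of ε_i ι_m with the opposite sign. -/
theorem iota_eps (i m : Fin n) (T : E n [⋀^Fin k]→L[ℝ] V) :
    iota m (eps i T) = (if i = m then T else 0) - derivAct (unitMap i m) T := by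
  ext v
  rw [iota_apply, eps_apply, Fin.sum_univ_succ, ContinuousAlternatingMap.sub_apply, sub_eq_add_neg]
  congr 1
  · have h : (0 : Fin (k + 1)).removeNth (Matrix.vecCons (e m) v) = v := rfl
    rw [h, Matrix.cons_val_zero, e_apply]
    split_ifs <;> simp
  · rw [derivAct_unitMap_apply, ← Finset.sum_neg_distrib]
    refine Finset.sum_congr rfl fun a _ => ?_
    rw [Matrix.cons_val_succ]
    cases k with
    | zero => exact a.elim0
    | succ k =>
      have h : a.succ.removeNth (Matrix.vecCons (e m) v) = Matrix.vecCons (e m) (a.removeNth v) := by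
        funext c
        refine Fin.cases ?_ (fun c => ?_) c
        · simp [Fin.removeNth]
        · simp [Fin.removeNth]
      rw [h, ← T.neg_one_pow_smul_map_insertNth a, insertNth_removeNth', smul_comm (v a i),
        smul_smul, Fin.val_succ, ← pow_add]
      have : Odd ((a : ℕ) + 1 + a) := ⟨a, by ring⟩
      rw [this.neg_one_pow, neg_one_smul]

theorem linearMap_eq_sum_proj {F : Type*} [NormedAddCommGroup F] [NormedSpace ℝ F]
    (f : E n →L[ℝ] F) :
    f = ∑ i, (EuclideanSpace.proj i : E n →L[ℝ] ℝ).smulRight (f (e i)) := by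
  ext v
  conv_lhs => rw [← sum_smul_e v]
  simp

/-- This turns the invariant definition of the exterior derivative into d = ∑ ε_i ∂_i. -/
theorem alternatizeUncurryFin_eq_sum (f : E n →L[ℝ] E n [⋀^Fin k]→L[ℝ] V) :
    ContinuousAlternatingMap.alternatizeUncurryFin f = ∑ i, eps i (f (e i)) := by
  conv_lhs => rw [linearMap_eq_sum_proj f]
  rw [← ContinuousAlternatingMap.alternatizeUncurryFinCLM_apply, map_sum]
  rfl

/-- `φ` is differentiable near `x` and twice differentiable at `x`. -/
def TwiceDiffAt {F : Type*} [NormedAddCommGroup F] [NormedSpace ℝ F] (φ : E n → F) (x : E n) :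
    Prop :=
  (∀ᶠ y in 𝓝 x, DifferentiableAt ℝ φ y) ∧ DifferentiableAt ℝ (fderiv ℝ φ) x

/-- Second partial derivatives. -/
def pd2 {F : Type*} [NormedAddCommGroup F] [NormedSpace ℝ F] (i j : Fin n) (φ : E n → F)
    (x : E n) : F := fderiv ℝ (fderiv ℝ φ) x (e i) (e j)

section TwiceDiff

variable {F : Type*} [NormedAddCommGroup F] [NormedSpace ℝ F] {φ φ' : E n → F} {x : E n}

/-- Pointwise regularity is the right notion here, since a conformally pulled back form is
controlled only near points where the conformal map is defined. -/
theorem _root_.ContDiffAt.twiceDiffAt (h : ContDiffAt ℝ ∞ φ x) : TwiceDiffAt φ x := by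
  constructor
  · have h1 : ContDiffAt ℝ 1 φ x := h.of_le (by exact_mod_cast le_top)
    exact (h1.eventually (by simp)).mono fun y hy => hy.differentiableAt (by simp)
  · exact (h.fderiv_right (m := 1) (by norm_cast)).differentiableAt (by simp)

theorem TwiceDiffAt.differentiableAt (h : TwiceDiffAt φ x) : DifferentiableAt ℝ φ x :=
  h.1.self_of_nhds

theorem TwiceDiffAt.pd2_comm (h : TwiceDiffAt φ x) (i j : Fin n) : pd2 i j φ x = pd2 j i φ x :=
  second_derivative_symmetric_of_eventually (𝕜 := ℝ)
    (h.1.mono fun _ hy => hy.hasFDerivAt) h.2.hasFDerivAt (e i) (e j)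

theorem pd_congr (h : φ' =ᶠ[𝓝 x] φ) (i : Fin n) : pd i φ' x = pd i φ x := by
  rw [pd, pd, h.fderiv_eq]

theorem pd2_eq_pd_pd (h : DifferentiableAt ℝ (fderiv ℝ φ) x) (i j : Fin n) :
    pd2 i j φ x = pd i (pd j φ) x := by
  change _ = fderiv ℝ (fun y => fderiv ℝ φ y (e j)) x (e i)
  rw [fderiv_clm_apply h (differentiableAt_const _)]
  simp [pd2]

theorem TwiceDiffAt.sum {ι : Type*} (s : Finset ι) {f : ι → E n → F}
    (h : ∀ i ∈ s, TwiceDiffAt (f i) x) :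
    TwiceDiffAt (fun y => ∑ i ∈ s, f i y) x ∧
      (∀ j, pd j (fun y => ∑ i ∈ s, f i y) x = ∑ i ∈ s, pd j (f i) x) ∧
      ∀ j l, pd2 j l (fun y => ∑ i ∈ s, f i y) x = ∑ i ∈ s, pd2 j l (f i) x := by
  have h1 : ∀ᶠ y in 𝓝 x, ∀ i ∈ s, DifferentiableAt ℝ (f i) y :=
    (Finset.eventually_all s).2 fun i hi => (h i hi).1
  have h2 : fderiv ℝ (fun y => ∑ i ∈ s, f i y) =ᶠ[𝓝 x] fun y => ∑ i ∈ s, fderiv ℝ (f i) y :=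
    h1.mono fun y hy => fderiv_fun_sum hy
  refine ⟨⟨h1.mono fun y hy => DifferentiableAt.fun_sum hy, ?_⟩, fun j => ?_, fun j l => ?_⟩
  · exact (DifferentiableAt.fun_sum fun i hi => (h i hi).2).congr_of_eventuallyEq h2
  · rw [pd, h2.self_of_nhds]; simp [pd]
  · rw [pd2, h2.fderiv_eq, fderiv_fun_sum fun i hi => (h i hi).2]; simp [pd2]

theorem TwiceDiffAt.clm {F' : Type*} [NormedAddCommGroup F'] [NormedSpace ℝ F'] (L : F →L[ℝ] F')
    (h : TwiceDiffAt φ x) :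
    TwiceDiffAt (fun y => L (φ y)) x ∧ (∀ j, pd j (fun y => L (φ y)) x = L (pd j φ x)) ∧
      ∀ j l, pd2 j l (fun y => L (φ y)) x = L (pd2 j l φ x) := by
  have h2 : fderiv ℝ (fun y => L (φ y)) =ᶠ[𝓝 x]
      fun y => (ContinuousLinearMap.compL ℝ (E n) F F' L) (fderiv ℝ φ y) :=
    h.1.mono fun y hy => (L.hasFDerivAt.comp y hy.hasFDerivAt).fderiv
  have h3 := (ContinuousLinearMap.compL ℝ (E n) F F' L).hasFDerivAt.comp x h.2.hasFDerivAt
  refine ⟨⟨h.1.mono fun y hy => L.differentiableAt.comp y hy, ?_⟩, fun j => ?_, fun j l => ?_⟩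
  · exact h3.differentiableAt.congr_of_eventuallyEq h2
  · rw [pd, h2.self_of_nhds]; simp [pd]
  · rw [pd2, h2.fderiv_eq]
    have : fderiv ℝ (fun y => (ContinuousLinearMap.compL ℝ (E n) F F' L) (fderiv ℝ φ y)) x = _ :=
      h3.fderiv
    rw [this]; simp [pd2]

end TwiceDiff

theorem codiff_eq {φ : Form n (k + 1) V} (x : E n) :
    codiff φ x = - ∑ m, iota m (pd m φ x) := rfl

variable [NormedSpace ℂ V] [SMulCommClass ℝ ℂ V]

/-- The coefficient `α_{k,s}`. -/
def alphaC (n k : ℕ) (s : ℂ) : ℂ := (s + n - 2 * k) * (s - n + 2 * k - 2)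

/-- The coefficient `β_{k,s}`. -/
def betaC (n k : ℕ) (s : ℂ) : ℂ := (s - n + 2 * k) * (s + n - 2 * k - 2)

/-- `□_{k,s}` in terms of second derivatives. -/
def boxJet (s : ℂ) (H : Fin n → Fin n → E n [⋀^Fin k]→L[ℝ] V) : E n [⋀^Fin k]→L[ℝ] V :=
  (-alphaC n k s) • ∑ i, H i i + (alphaC n k s - betaC n k s) • ∑ i, ∑ m, opN i m (H i m)

/-- `∇_{k,s,j}` in terms of first derivatives. -/
def nablaJet (s : ℂ) (j : Fin n) (G : Fin n → E n [⋀^Fin k]→L[ℝ] V) : E n [⋀^Fin k]→L[ℝ] V :=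
  (2 - s) • (alphaC n k s • G j - (2 * (s - n + 2 * k)) • ∑ m, opN j m (G m)
    + (2 * (s + n - 2 * k)) • ∑ m, opN m j (G m))

/-- Moving ι_m past ε_i in -∑ ι_m ε_i ∂_i ∂_m splits off the Laplacian and leaves a sum of ε_i ι_m
∂_i ∂_m; symmetry of second derivatives makes the order of ∂_i and ∂_m irrelevant. -/
theorem codiffD_eq {φ : Form n k V} {x : E n} (h : TwiceDiffAt φ x) :
    codiffD φ x = -∑ i, pd2 i i φ x + ∑ i, ∑ m, opN i m (pd2 i m φ x) := by
  have h1 : ∀ m, pd m (extDeriv φ) x = ∑ i, eps i (pd2 i m φ x) := by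
    intro m
    have : HasFDerivAt (extDeriv φ)
        ((ContinuousAlternatingMap.alternatizeUncurryFinCLM ℝ (E n) V) ∘L
          fderiv ℝ (fderiv ℝ φ) x) x :=
      (ContinuousAlternatingMap.alternatizeUncurryFinCLM ℝ (E n) V).hasFDerivAt.comp x
        h.2.hasFDerivAt
    rw [pd, this.fderiv, ContinuousLinearMap.comp_apply,
      ContinuousAlternatingMap.alternatizeUncurryFinCLM_apply, alternatizeUncurryFin_eq_sum]
    exact Finset.sum_congr rfl fun i _ => congrArg _ (h.pd2_comm m i)
  have h2 : ∀ m, iota m (pd m (extDeriv φ) x) = pd2 m m φ x - ∑ i, opN i m (pd2 i m φ x) := by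
    intro m
    rw [h1, ← iotaL_apply, map_sum]
    simp only [iotaL_apply, iota_eps, Finset.sum_sub_distrib, Finset.sum_ite_eq', Finset.mem_univ,
      if_true]
    rfl
  rw [codiffD, codiff_eq, Finset.sum_congr rfl fun m _ => h2 m, Finset.sum_sub_distrib,
    Finset.sum_comm]
  abel

/-- In degree 0 both sides vanish, because there is no slot for ε_i ι_m to act on. In positive
degree ε_i ι_m appears directly from d = ∑ ε_i ∂_i and δ = -∑ ι_m ∂_m. -/
theorem dCodiff_eq {φ : Form n k V} {x : E n} (h : TwiceDiffAt φ x) :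
    dCodiff φ x = -∑ i, ∑ m, opN i m (pd2 i m φ x) := by
  cases k with
  | zero =>
    have : ∀ (i m : Fin n) (T : E n [⋀^Fin 0]→L[ℝ] V), opN i m T = 0 := by
      intro i m T; ext v; simp [opN_apply_apply]
    simp [this, dCodiff]
  | succ k =>
    have h1 : HasFDerivAt (codiff φ) ((-∑ m, iotaL m ∘L ContinuousLinearMap.apply ℝ _ (e m)) ∘L
        fderiv ℝ (fderiv ℝ φ) x) x := by
      have := (-∑ m, iotaL (k := k) (V := V) m ∘L
        ContinuousLinearMap.apply ℝ _ (e m)).hasFDerivAt.comp x h.2.hasFDerivAt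
      refine this.congr_of_eventuallyEq (Eventually.of_forall fun y => ?_)
      simp [codiff, pd, iotaL_apply]
    change extDeriv (codiff φ) x = _
    rw [extDeriv, h1.fderiv, alternatizeUncurryFin_eq_sum, ← Finset.sum_neg_distrib]
    refine Finset.sum_congr rfl fun i _ => ?_
    rw [← epsL_apply]
    simp only [ContinuousLinearMap.comp_apply, _root_.neg_apply, _root_.sum_apply, map_neg, map_sum,
      ContinuousLinearMap.apply_apply, epsL_apply, iotaL_apply, eps_iota]
    rfl

theorem box_eq {s : ℂ} {φ : Form n k V} {x : E n} (h : TwiceDiffAt φ x) :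
    box s φ x = boxJet s (fun i m => pd2 i m φ x) := by
  rw [box, codiffD_eq h, dCodiff_eq h, boxJet, alphaC, betaC]
  module

theorem epsCodiff_eq (j : Fin n) (φ : Form n k V) (x : E n) :
    epsCodiff j φ x = -∑ m, opN j m (pd m φ x) := by
  cases k with
  | zero =>
    have : ∀ (i m : Fin n) (T : E n [⋀^Fin 0]→L[ℝ] V), opN i m T = 0 := by
      intro i m T; ext v; simp [opN_apply_apply]
    simp [this, epsCodiff]
  | succ k =>
    change eps j (codiff φ x) = _
    rw [codiff_eq, ← epsL_apply, map_neg, map_sum]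
    simp only [epsL_apply, eps_iota]
    rfl

theorem dIota_eq (j : Fin n) {φ : Form n k V} {x : E n} (h : DifferentiableAt ℝ φ x) :
    dIota j φ x = ∑ m, opN m j (pd m φ x) := by
  cases k with
  | zero =>
    have : ∀ (i m : Fin n) (T : E n [⋀^Fin 0]→L[ℝ] V), opN i m T = 0 := by
      intro i m T; ext v; simp [opN_apply_apply]
    simp [this, dIota]
  | succ k =>
    have h1 : HasFDerivAt (fun x => iota j (φ x)) (iotaL j ∘L fderiv ℝ φ x) x := by
      have := (iotaL (k := k) (V := V) j).hasFDerivAt.comp x h.hasFDerivAt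
      exact this
    change extDeriv (fun x => iota j (φ x)) x = _
    rw [extDeriv, h1.fderiv, alternatizeUncurryFin_eq_sum]
    simp only [ContinuousLinearMap.comp_apply, iotaL_apply, eps_iota]
    rfl

theorem nabla_eq {s : ℂ} (j : Fin n) {φ : Form n k V} {x : E n} (h : DifferentiableAt ℝ φ x) :
    nabla s j φ x = nablaJet s j (fun m => pd m φ x) := by
  rw [nabla, epsCodiff_eq, dIota_eq j h, nablaJet, alphaC]
  module

end Jets

/-! ### Contractions with the logarithmic gradient and the cancellations -/

section JetAlgebra

/-- The relations satisfied by the operators `N i j = ε_i ι_j` on forms of degree `κ`. -/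
structure IsExteriorGl {n : ℕ} {F : Type*} [AddCommGroup F] [Module ℂ F]
    (N : Fin n → Fin n → Module.End ℂ F) (κ : ℂ) : Prop where
  add_vectors : ∀ i j p q, N i j * N p q + N i q * N p j =
    (if j = p then N i q else 0) + (if q = p then N i j else 0)
  comm : ∀ i j p q, N i j * N p q - N p q * N i j =
    (if j = p then N i q else 0) - (if q = i then N p j else 0)
  trace : ∑ i, N i i = κ • (1 : Module.End ℂ F)

theorem isExteriorGl_opN {n k : ℕ} {V : Type*} [NormedAddCommGroup V] [NormedSpace ℝ V]
    [NormedSpace ℂ V] [SMulCommClass ℝ ℂ V] :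
    IsExteriorGl (fun i j => (opN i j : Module.End ℂ (E n [⋀^Fin k]→L[ℝ] V))) k :=
  ⟨opN_mul_add_vectors, opN_mul_sub, sum_opN⟩

variable {n : ℕ} {F : Type*} [AddCommGroup F] [Module ℂ F]
  {N : Fin n → Fin n → Module.End ℂ F} {κ : ℂ}

/-- With coinciding second indices the relation `add_vectors` contains the same product twice,
whence the factor 1/2. -/
theorem IsExteriorGl.sum_right_right (hN : IsExteriorGl N κ) (j p : Fin n) : ∑ m, N j m * N p m = N j p := by
  have h : ∑ m, (N j m * N p m + N j m * N p m) = N j p + N j p := by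
    simp only [hN.add_vectors, Finset.sum_add_distrib, Finset.sum_ite_eq', Finset.mem_univ, if_true]
  rw [Finset.sum_add_distrib] at h
  linear_combination (norm := module) (1 / 2 : ℂ) • h

/-- The dual quadratic relation is a consequence of `add_vectors` and the commutators, so it need
not be an axiom. -/
theorem IsExteriorGl.add_covectors (hN : IsExteriorGl N κ) (i j p q : Fin n) : N i j * N p q + N p j * N i q =
    (if j = p then N i q else 0) + (if j = i then N p q else 0) := by
  have h1 := hN.add_vectors p j i q
  have h2 := hN.comm i j p q
  linear_combination (norm := module) h1 + h2

theorem IsExteriorGl.sum_left_left (hN : IsExteriorGl N κ) (j p : Fin n) : ∑ m, N m j * N m p = N j p := by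
  have h : ∑ m, (N m j * N m p + N m j * N m p) = N j p + N j p := by
    simp only [hN.add_covectors, Finset.sum_add_distrib, Finset.sum_ite_eq, Finset.mem_univ,
      if_true]
  rw [Finset.sum_add_distrib] at h
  linear_combination (norm := module) (1 / 2 : ℂ) • h

/-- Pairing N_jm N_mp with N_jp N_mm in `add_vectors` brings in the trace, which is how the degree κ
enters. -/
theorem IsExteriorGl.sum_right_left (hN : IsExteriorGl N κ) (j p : Fin n) :
    ∑ m, N j m * N m p = ((n : ℂ) - κ + 1) • N j p := by
  have h : ∑ m, (N j m * N m p + N j p * N m m) = (n : ℂ) • N j p + N j p := by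
    simp only [hN.add_vectors, Finset.sum_add_distrib, Finset.sum_ite_eq, Finset.mem_univ,
      if_true, Finset.sum_const, Finset.card_univ, Fintype.card_fin, Nat.cast_smul_eq_nsmul]
  rw [Finset.sum_add_distrib, ← Finset.mul_sum, hN.trace, mul_smul_comm, mul_one] at h
  linear_combination (norm := module) h

theorem IsExteriorGl.sum_left_right (hN : IsExteriorGl N κ) (j p : Fin n) :
    ∑ m, N m j * N p m = (if j = p then κ • (1 : Module.End ℂ F) else 0) - (κ - 1) • N p j := by
  have h : ∑ m, (N m j * N p m - N p m * N m j) =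
      (if j = p then κ • (1 : Module.End ℂ F) else 0) - (n : ℂ) • N p j := by
    simp only [hN.comm, Finset.sum_sub_distrib, if_true, Finset.sum_const, Finset.card_univ,
      Fintype.card_fin, Nat.cast_smul_eq_nsmul]
    split_ifs with h
    · rw [hN.trace]
    · simp
  rw [Finset.sum_sub_distrib, hN.sum_right_left] at h
  linear_combination (norm := module) h

variable (b : Fin n → ℂ)

/-- Contraction of the lower index with `b`. -/
def ctrP (N : Fin n → Fin n → Module.End ℂ F) (b : Fin n → ℂ) (j : Fin n) : Module.End ℂ F :=
  ∑ m, b m • N m j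

/-- Contraction of the upper index with `b`. -/
def ctrQ (N : Fin n → Fin n → Module.End ℂ F) (b : Fin n → ℂ) (j : Fin n) : Module.End ℂ F :=
  ∑ m, b m • N j m

/-- The double contraction with `b`. -/
def ctrT (N : Fin n → Fin n → Module.End ℂ F) (b : Fin n → ℂ) : Module.End ℂ F :=
  ∑ j, b j • ctrP N b j

/-- The zeroth order part of the derivative of a conformally pulled back form. -/
def ctrS (N : Fin n → Fin n → Module.End ℂ F) (ρ : ℂ) (b : Fin n → ℂ) (j : Fin n) :
    Module.End ℂ F := (ρ * b j) • 1 + ∑ m, b m • (N m j - N j m)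

theorem ctrS_eq (ρ : ℂ) (j : Fin n) :
    ctrS N ρ b j = (ρ * b j) • 1 + ctrP N b j - ctrQ N b j := by
  simp only [ctrS, ctrP, ctrQ, smul_sub, Finset.sum_sub_distrib]
  abel

theorem sum_smul_ctrQ : ∑ j, b j • ctrQ N b j = ctrT N b := by
  simp only [ctrT, ctrQ, ctrP, Finset.smul_sum, smul_smul]
  rw [Finset.sum_comm]
  simp only [mul_comm]

theorem IsExteriorGl.sum_mul_P (hN : IsExteriorGl N κ) (j : Fin n) : ∑ m, N j m * ctrP N b m = ctrQ N b j := by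
  simp only [ctrP, ctrQ, Finset.mul_sum, mul_smul_comm]
  rw [Finset.sum_comm]
  simp only [← Finset.smul_sum, hN.sum_right_right]

theorem IsExteriorGl.sum_mul_Q (hN : IsExteriorGl N κ) (j : Fin n) :
    ∑ m, N j m * ctrQ N b m = ((n : ℂ) - κ + 1) • ctrQ N b j := by
  simp only [ctrQ, Finset.mul_sum, mul_smul_comm]
  rw [Finset.sum_comm]
  simp only [← Finset.smul_sum, hN.sum_right_left]
  simp only [Finset.smul_sum, smul_smul, mul_comm]

theorem IsExteriorGl.sum_mul_P' (hN : IsExteriorGl N κ) (j : Fin n) :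
    ∑ m, N m j * ctrP N b m = (κ * b j) • 1 - (κ - 1) • ctrP N b j := by
  simp only [ctrP, Finset.mul_sum, mul_smul_comm]
  rw [Finset.sum_comm]
  simp only [← Finset.smul_sum, hN.sum_left_right, smul_sub, Finset.sum_sub_distrib, smul_ite,
    smul_zero, Finset.sum_ite_eq, Finset.mem_univ, if_true]
  simp only [Finset.smul_sum, smul_smul, mul_comm]

theorem IsExteriorGl.sum_mul_Q' (hN : IsExteriorGl N κ) (j : Fin n) : ∑ m, N m j * ctrQ N b m = ctrQ N b j := by
  simp only [ctrQ, Finset.mul_sum, mul_smul_comm]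
  rw [Finset.sum_comm]
  simp only [← Finset.smul_sum, hN.sum_left_left]

theorem sum_ctrP_mul (R : Fin n → Module.End ℂ F) :
    ∑ m, ctrP N b m * R m = ∑ j, b j • ∑ m, N j m * R m := by
  simp only [ctrP, Finset.sum_mul, smul_mul_assoc, Finset.smul_sum]
  rw [Finset.sum_comm]

theorem sum_ctrQ_mul (R : Fin n → Module.End ℂ F) :
    ∑ m, ctrQ N b m * R m = ∑ j, b j • ∑ m, N m j * R m := by
  simp only [ctrQ, Finset.sum_mul, smul_mul_assoc, Finset.smul_sum]
  rw [Finset.sum_comm]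

theorem IsExteriorGl.sum_mul_S (hN : IsExteriorGl N κ) (ρ : ℂ) (j : Fin n) :
    ∑ m, N j m * ctrS N ρ b m = (ρ - n + κ) • ctrQ N b j := by
  have h : ∑ m, N j m * ctrS N ρ b m =
      ρ • ctrQ N b j + ∑ m, N j m * ctrP N b m - ∑ m, N j m * ctrQ N b m := by
    simp only [ctrS_eq, mul_sub, mul_add, Finset.sum_sub_distrib, Finset.sum_add_distrib,
      mul_smul_comm, mul_one]
    simp only [ctrQ, Finset.smul_sum, smul_smul]
  rw [h, hN.sum_mul_P, hN.sum_mul_Q]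
  module

theorem IsExteriorGl.sum_mul_S' (hN : IsExteriorGl N κ) (ρ : ℂ) (j : Fin n) :
    ∑ m, N m j * ctrS N ρ b m =
      (ρ - κ + 1) • ctrP N b j + (κ * b j) • 1 - ctrQ N b j := by
  have h : ∑ m, N m j * ctrS N ρ b m =
      ρ • ctrP N b j + ∑ m, N m j * ctrP N b m - ∑ m, N m j * ctrQ N b m := by
    simp only [ctrS_eq, mul_sub, mul_add, Finset.sum_sub_distrib, Finset.sum_add_distrib,
      mul_smul_comm, mul_one]
    simp only [ctrP, Finset.smul_sum, smul_smul]
  rw [h, hN.sum_mul_P', hN.sum_mul_Q']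
  module

theorem IsExteriorGl.sum_P_S (hN : IsExteriorGl N κ) (ρ : ℂ) :
    ∑ m, ctrP N b m * ctrS N ρ b m = (ρ - n + κ) • ctrT N b := by
  rw [sum_ctrP_mul]
  simp only [hN.sum_mul_S, smul_comm _ (ρ - n + κ), ← Finset.smul_sum, sum_smul_ctrQ]

theorem IsExteriorGl.sum_Q_S (hN : IsExteriorGl N κ) (ρ : ℂ) :
    ∑ m, ctrQ N b m * ctrS N ρ b m = (ρ - κ) • ctrT N b + (κ * ∑ m, b m * b m) • 1 := by
  rw [sum_ctrQ_mul]
  simp only [hN.sum_mul_S', smul_sub, smul_add, Finset.sum_add_distrib, Finset.sum_sub_distrib,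
    sum_smul_ctrQ, smul_comm _ (ρ - κ + 1), ← Finset.smul_sum]
  rw [← ctrT]
  simp only [smul_smul, ← Finset.sum_smul, mul_left_comm _ κ, ← Finset.mul_sum]
  module

/-- Only the left factor has to be expanded: its scalar part contracts S with b, where the two
rotation terms cancel, and its P and Q parts are already known. -/
theorem IsExteriorGl.sum_S_S (hN : IsExteriorGl N κ) (ρ : ℂ) :
    ∑ m, ctrS N ρ b m * ctrS N ρ b m =
      ((ρ * ρ - κ) * ∑ m, b m * b m) • 1 - (n - 2 * κ) • ctrT N b := by
  have h : ∑ m, ctrS N ρ b m * ctrS N ρ b m = ρ • ∑ m, b m • ctrS N ρ b m +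
      ∑ m, ctrP N b m * ctrS N ρ b m - ∑ m, ctrQ N b m * ctrS N ρ b m := by
    conv_lhs => enter [2, m, 1]; rw [ctrS_eq]
    simp only [sub_mul, add_mul, Finset.sum_sub_distrib, Finset.sum_add_distrib, smul_mul_assoc,
      one_mul, Finset.smul_sum, smul_smul]
  have h' : ∑ m, b m • ctrS N ρ b m = (ρ * ∑ m, b m * b m) • 1 := by
    simp only [ctrS_eq, smul_sub, smul_add, Finset.sum_sub_distrib, Finset.sum_add_distrib,
      sum_smul_ctrQ]
    rw [← ctrT, add_sub_cancel_right]
    simp only [smul_smul, ← Finset.sum_smul, mul_left_comm _ ρ, ← Finset.mul_sum]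
  rw [h, h', hN.sum_P_S, hN.sum_Q_S]
  module

/-- The transformation of the first order operators. -/
theorem IsExteriorGl.nabla_transform (hN : IsExteriorGl N κ) {ρ A B : ℂ} (hA : A = 2 * (n - ρ - κ))
    (hB : B = -2 * (ρ - κ)) (j : Fin n) :
    (A * (B - 2)) • ctrS N ρ b j - (2 * B) • ∑ m, N j m * ctrS N ρ b m
      + (2 * A) • ∑ m, N m j * ctrS N ρ b m = (A * B * (ρ + 1) * b j) • 1 := by
  -- Everything is now a combination of b_j, P_j and Q_j. The coefficient of P_j is A(B + 2(ρ-κ))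
  -- and that of Q_j is -B(A + 2(ρ-n+κ)); both vanish for the prescribed A and B.
  rw [hN.sum_mul_S, hN.sum_mul_S', ctrS_eq]
  subst hA hB
  module

/-- The zeroth order part of the second derivatives of a conformally pulled back form. -/
def ctrD (N : Fin n → Fin n → Module.End ℂ F) (ρ : ℂ) (b : Fin n → ℂ) (i j : Fin n) :
    Module.End ℂ F :=
  ctrS N ρ (fun m => b i * b m - if i = m then (∑ p, b p * b p) / 2 else 0) j
    + ctrS N ρ b j * ctrS N ρ b i

/-- The vector inserted into S_j in `ctrD` is ∂_i b, as dictated by the differential equation of b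
for Möbius maps; the product S_j S_i comes from differentiating the form itself. -/
theorem ctrD_eq (ρ : ℂ) (i j : Fin n) :
    ctrD N ρ b i j = (ρ * b i * b j) • 1 - (if i = j then ρ * (∑ p, b p * b p) / 2 else 0) • 1
      + b i • (ctrP N b j - ctrQ N b j) - ((∑ p, b p * b p) / 2) • (N i j - N j i)
      + ctrS N ρ b j * ctrS N ρ b i := by
  have h : ctrS N ρ (fun m => b i * b m - if i = m then (∑ p, b p * b p) / 2 else 0) j =
      (ρ * (b i * b j - if i = j then (∑ p, b p * b p) / 2 else 0)) • 1
      + (b i • (ctrP N b j - ctrQ N b j) - ((∑ p, b p * b p) / 2) • (N i j - N j i)) := by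
    rw [ctrS]
    congr 1
    simp only [sub_smul, Finset.sum_sub_distrib, ite_smul, zero_smul, Finset.sum_ite_eq,
      Finset.mem_univ, if_true, ctrP, ctrQ, ← Finset.smul_sum, mul_smul, smul_sub]
    abel
  rw [ctrD, h]
  split_ifs <;> module

theorem IsExteriorGl.sum_D (hN : IsExteriorGl N κ) (ρ : ℂ) :
    ∑ i, ctrD N ρ b i i = ((ρ * (1 - n / 2) + ρ * ρ - κ) * ∑ m, b m * b m) • 1
      - (n - 2 * κ) • ctrT N b := by
  have h1 : ∑ i, (ρ * b i * b i) • (1 : Module.End ℂ F) = (ρ * ∑ m, b m * b m) • 1 := by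
    rw [← Finset.sum_smul, Finset.mul_sum]
    simp only [mul_assoc]
  simp only [ctrD_eq, Finset.sum_add_distrib, Finset.sum_sub_distrib, hN.sum_S_S, h1, smul_sub,
    sum_smul_ctrQ, if_true, Finset.sum_const, Finset.card_univ, Fintype.card_fin, sub_self,
    smul_zero]
  rw [← ctrT, ← Nat.cast_smul_eq_nsmul ℂ]
  module

/-- Of all quadratic expressions in b only the double contraction T and the scalar |b|² survive. The
coefficient of T is the one needed to cancel the T term of `IsExteriorGl.sum_D`. -/
theorem IsExteriorGl.sum_mul_D (hN : IsExteriorGl N κ) (ρ : ℂ) :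
    ∑ i, ∑ j, N i j * ctrD N ρ b i j =
      (ρ * ρ + ρ - n * ρ - (n - κ) * (1 - κ)) • ctrT N b
        + (κ / 2 * (ρ - (n - κ)) * ∑ m, b m * b m) • 1 := by
  have h1 : ∑ i, ∑ j, (ρ * b i * b j) • N i j = ρ • ctrT N b := by
    rw [← sum_smul_ctrQ]
    simp only [ctrQ, Finset.smul_sum, smul_smul, mul_assoc]
  have h2 : ∑ i, ∑ j, (if i = j then ρ * (∑ p, b p * b p) / 2 else 0) • N i j =
      (κ * (ρ * (∑ p, b p * b p) / 2)) • (1 : Module.End ℂ F) := by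
    simp only [ite_smul, zero_smul, Finset.sum_ite_eq, Finset.mem_univ, if_true,
      ← Finset.smul_sum, hN.trace, smul_smul, mul_comm]
  have h3 : ∑ i, ∑ j, b i • (N i j * ctrP N b j) = ctrT N b := by
    simp only [← Finset.smul_sum, hN.sum_mul_P, sum_smul_ctrQ]
  have h4 : ∑ i, ∑ j, b i • (N i j * ctrQ N b j) = ((n : ℂ) - κ + 1) • ctrT N b := by
    simp only [← Finset.smul_sum, hN.sum_mul_Q, smul_comm _ ((n : ℂ) - κ + 1), sum_smul_ctrQ]
  have h5 : ∑ i, ∑ j, N i j * N i j = κ • (1 : Module.End ℂ F) := by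
    simp only [hN.sum_right_right, hN.trace]
  have h6 : ∑ i, ∑ j, N i j * N j i = (((n : ℂ) - κ + 1) * κ) • (1 : Module.End ℂ F) := by
    simp only [hN.sum_right_left, ← Finset.smul_sum, hN.trace, smul_smul]
  have h7 : ∑ i, ∑ j, N i j * (ctrS N ρ b j * ctrS N ρ b i) =
      (ρ - n + κ) • ((ρ - κ) • ctrT N b + (κ * ∑ m, b m * b m) • 1) := by
    simp only [← mul_assoc, ← Finset.sum_mul, hN.sum_mul_S]
    rw [← hN.sum_Q_S, Finset.smul_sum]
    simp only [smul_mul_assoc]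
  simp only [ctrD_eq, mul_add, mul_sub, mul_smul_comm, mul_one, smul_sub, Finset.sum_add_distrib,
    Finset.sum_sub_distrib, h1, h2, h3, h4, h7]
  simp only [← Finset.smul_sum, h5, h6]
  module

/-- The transformation of the second order operators. -/
theorem IsExteriorGl.box_transform (hN : IsExteriorGl N κ) {ρ A B : ℂ}
    (hA : A = 2 * (n - ρ - κ)) (hB : B = -2 * (ρ - κ)) (φ₀ : F) (φ₁ : Fin n → F)
    (φ₂ : Fin n → Fin n → F) :
    let ψ₂ : Fin n → Fin n → F := fun i j => ctrD N ρ b i j φ₀ + ctrS N ρ b j (φ₁ i)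
      + ctrS N ρ b i (φ₁ j) + b i • φ₁ j + b j • φ₁ i - (if i = j then ∑ m, b m • φ₁ m else 0)
      + φ₂ i j
    (-(A * (B - 2))) • ∑ i, ψ₂ i i + (2 * B - 2 * A) • ∑ i, ∑ j, N i j (ψ₂ i j) =
      ((-(A * (B - 2))) • ∑ i, φ₂ i i + (2 * B - 2 * A) • ∑ i, ∑ j, N i j (φ₂ i j))
      - ∑ j, b j • ((2 + 2 * ρ - n) • ((A * (B - 2)) • φ₁ j - (2 * B) • ∑ m, N j m (φ₁ m)
          + (2 * A) • ∑ m, N m j (φ₁ m)))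
      - ((2 + 2 * ρ - n) * (ρ + 1) * A * B / 2 * ∑ m, b m * b m) • φ₀ := by
  intro ψ₂
  -- All terms linear in b and in the first derivatives reduce to three contractions, with b, with P
  -- and with Q.
  set X := ∑ m, b m • φ₁ m with hX
  set XP := ∑ m, ctrP N b m (φ₁ m) with hXP
  set XQ := ∑ m, ctrQ N b m (φ₁ m) with hXQ
  have hS : ∑ m, ctrS N ρ b m (φ₁ m) = ρ • X + XP - XQ := by
    simp only [ctrS_eq, LinearMap.sub_apply, LinearMap.add_apply, Finset.sum_sub_distrib,
      Finset.sum_add_distrib, LinearMap.smul_apply, Module.End.one_apply, hX, hXP, hXQ,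
      Finset.smul_sum, smul_smul]
  have hP' : ∑ j, b j • ∑ m, N j m (φ₁ m) = XP := by
    simp only [hXP, ctrP, LinearMap.sum_apply, LinearMap.smul_apply, Finset.smul_sum]
    rw [Finset.sum_comm]
  have hQ' : ∑ j, b j • ∑ m, N m j (φ₁ m) = XQ := by
    simp only [hXQ, ctrQ, LinearMap.sum_apply, LinearMap.smul_apply, Finset.smul_sum]
    rw [Finset.sum_comm]
  have hD : ∑ i, ctrD N ρ b i i φ₀ = (∑ i, ctrD N ρ b i i) φ₀ := by rw [LinearMap.sum_apply]
  have hND : ∑ i, ∑ j, N i j (ctrD N ρ b i j φ₀) = (∑ i, ∑ j, N i j * ctrD N ρ b i j) φ₀ := by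
    simp only [LinearMap.sum_apply, Module.End.mul_apply]
  have hNS : ∑ i, ∑ j, N i j (ctrS N ρ b j (φ₁ i)) = (ρ - n + κ) • XQ := by
    have : ∀ i, ∑ j, N i j (ctrS N ρ b j (φ₁ i)) = ((ρ - n + κ) • ctrQ N b i) (φ₁ i) := by
      intro i
      rw [← hN.sum_mul_S]
      simp only [LinearMap.sum_apply, Module.End.mul_apply]
    simp only [this, LinearMap.smul_apply, ← Finset.smul_sum, hXQ]
  have hNS' : ∑ i, ∑ j, N i j (ctrS N ρ b i (φ₁ j)) = (ρ - κ + 1) • XP + κ • X - XQ := by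
    have : ∀ j, ∑ i, N i j (ctrS N ρ b i (φ₁ j)) =
        ((ρ - κ + 1) • ctrP N b j + (κ * b j) • 1 - ctrQ N b j) (φ₁ j) := by
      intro j
      rw [← hN.sum_mul_S']
      simp only [LinearMap.sum_apply, Module.End.mul_apply]
    rw [Finset.sum_comm]
    simp only [this, LinearMap.smul_apply, LinearMap.add_apply, LinearMap.sub_apply,
      Finset.sum_add_distrib, Finset.sum_sub_distrib, ← Finset.smul_sum, hXQ, hXP, hX, mul_smul,
      Module.End.one_apply]
  have hNb : ∑ i, ∑ j, b i • N i j (φ₁ j) = XP := by simp only [← Finset.smul_sum, hP']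
  have hNb' : ∑ i, ∑ j, b j • N i j (φ₁ i) = XQ := by
    rw [Finset.sum_comm]; simp only [← Finset.smul_sum, hQ']
  have hNt : ∑ i, N i i X = κ • X := by
    rw [← LinearMap.sum_apply, hN.trace, LinearMap.smul_apply, Module.End.one_apply]
  have e1 : ∑ i, ψ₂ i i = (∑ i, ctrD N ρ b i i) φ₀ + (2 : ℂ) • (ρ • X + XP - XQ)
      + (2 : ℂ) • X - (n : ℂ) • X + ∑ i, φ₂ i i := by
    simp only [ψ₂, Finset.sum_add_distrib, Finset.sum_sub_distrib, hS, hD, if_true,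
      Finset.sum_const, Finset.card_univ, Fintype.card_fin, ← hX]
    rw [← Nat.cast_smul_eq_nsmul ℂ]
    module
  have e2 : ∑ i, ∑ j, N i j (ψ₂ i j) = (∑ i, ∑ j, N i j * ctrD N ρ b i j) φ₀
      + (ρ - n + κ) • XQ + ((ρ - κ + 1) • XP + κ • X - XQ) + XP + XQ - κ • X
      + ∑ i, ∑ j, N i j (φ₂ i j) := by
    simp only [ψ₂, map_add, map_sub, map_smul, Finset.sum_add_distrib, Finset.sum_sub_distrib,
      hND, hNS, hNS', hNb, hNb', apply_ite (N _ _), map_zero, Finset.sum_ite_eq, Finset.mem_univ,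
      if_true, ← hX, hNt]
  have e3 : ∑ j, b j • ((2 + 2 * ρ - n) • ((A * (B - 2)) • φ₁ j - (2 * B) • ∑ m, N j m (φ₁ m)
          + (2 * A) • ∑ m, N m j (φ₁ m))) =
      (2 + 2 * ρ - n) • ((A * (B - 2)) • X - (2 * B) • XP + (2 * A) • XQ) := by
    simp only [hX, ← hP', ← hQ', smul_add, smul_sub, Finset.sum_add_distrib,
      Finset.sum_sub_distrib, Finset.smul_sum, smul_comm (b _)]
  -- The T terms cancel, since (n-ρ-κ)(ρ-κ+1) = -(ρ²+ρ-nρ-(n-κ)(1-κ)), and X, XP, XQ assemble into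
  -- the contraction of b with the first order operator.
  rw [e1, e2, e3, hN.sum_D, hN.sum_mul_D]
  simp only [LinearMap.add_apply, LinearMap.sub_apply, LinearMap.smul_apply, Module.End.one_apply]
  subst hA hB
  module

end JetAlgebra

/-! ### The 2-jet of a conformally pulled back form -/

section ConformalPullback

open Filter Topology

/-- The endomorphism `v ↦ ⟨b,a⟩ v + ⟨b,v⟩ a - ⟨a,v⟩ b`. -/
def conformalMap {n : ℕ} (b a : E n) : E n →L[ℝ] E n :=
  inner ℝ b a • ContinuousLinearMap.id ℝ (E n) + (innerSL ℝ b).smulRight a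
    - (innerSL ℝ a).smulRight b

theorem conformalMap_apply {n : ℕ} (b a v : E n) :
    conformalMap b a v = inner ℝ b a • v + inner ℝ b v • a - inner ℝ a v • b := rfl

theorem inner_e_right {n : ℕ} (b : E n) (j : Fin n) : inner ℝ b (e j) = b j := by
  simp [e, EuclideanSpace.inner_single_right]

theorem inner_e_left {n : ℕ} (b : E n) (j : Fin n) : inner ℝ (e j) b = b j := by
  simp [e, EuclideanSpace.inner_single_left]

theorem inner_eq_sum {n : ℕ} (b v : E n) : inner ℝ b v = ∑ m, b m * v m := by
  simp [PiLp.inner_apply, mul_comm]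

/-- A dilation plus an infinitesimal rotation. On k-forms the dilation contributes k b_j, which adds
to λ b_j from Ω^λ; this is why ρ = λ + k below. -/
theorem conformalMap_e {n : ℕ} (b : E n) (j : Fin n) :
    conformalMap b (e j) = b j • ContinuousLinearMap.id ℝ (E n)
      + ∑ m, b m • (unitMap m j - unitMap j m) := by
  ext v p
  simp only [conformalMap_apply, inner_eq_sum, smul_sub, Finset.sum_sub_distrib]
  simp only [unitMap_apply, WithLp.ofLp_sub, WithLp.ofLp_add, WithLp.ofLp_smul, Pi.sub_apply,
    Pi.add_apply, Pi.smul_apply, smul_eq_mul, e_apply, _root_.add_apply, _root_.sub_apply,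
    _root_.smul_apply, _root_.sum_apply, ContinuousLinearMap.id_apply, WithLp.ofLp_sum,
    Finset.sum_apply]
  simp [mul_comm, add_sub_assoc]

variable {n k : ℕ} {V : Type*} [NormedAddCommGroup V] [NormedSpace ℝ V]

theorem derivAct_id (T : E n [⋀^Fin k]→L[ℝ] V) :
    derivAct (ContinuousLinearMap.id ℝ (E n)) T = k • T := by
  ext v
  simp [derivAct_apply]

theorem derivAct_add (W W' : E n →L[ℝ] E n) (T : E n [⋀^Fin k]→L[ℝ] V) :
    derivAct (W + W') T = derivAct W T + derivAct W' T :=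
  map_add ((ContinuousAlternatingMap.fderivCompContinuousLinearMapCLM V
    (ContinuousLinearMap.id ℝ (E n))) T) W W'

theorem derivAct_smul (c : ℝ) (W : E n →L[ℝ] E n) (T : E n [⋀^Fin k]→L[ℝ] V) :
    derivAct (c • W) T = c • derivAct W T :=
  map_smul ((ContinuousAlternatingMap.fderivCompContinuousLinearMapCLM V
    (ContinuousLinearMap.id ℝ (E n))) T) c W

theorem derivAct_sub (W W' : E n →L[ℝ] E n) (T : E n [⋀^Fin k]→L[ℝ] V) :
    derivAct (W - W') T = derivAct W T - derivAct W' T :=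
  map_sub ((ContinuousAlternatingMap.fderivCompContinuousLinearMapCLM V
    (ContinuousLinearMap.id ℝ (E n))) T) W W'

theorem derivAct_sum {ι : Type*} (s : Finset ι) (W : ι → E n →L[ℝ] E n)
    (T : E n [⋀^Fin k]→L[ℝ] V) : derivAct (∑ i ∈ s, W i) T = ∑ i ∈ s, derivAct (W i) T :=
  map_sum ((ContinuousAlternatingMap.fderivCompContinuousLinearMapCLM V
    (ContinuousLinearMap.id ℝ (E n))) T) W s

/-- A variation of A of the form A ∘ W can be moved to the outside of the pullback, so it acts
through the derivation of W on the pulled back form. -/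
theorem fderivComp_comp (T : E n [⋀^Fin k]→L[ℝ] V) (A W : E n →L[ℝ] E n) :
    T.fderivCompContinuousLinearMap A (A ∘L W) = derivAct W (T.compContinuousLinearMap A) := by
  ext v
  rw [ContinuousAlternatingMap.fderivCompContinuousLinearMap_apply, derivAct_apply]
  refine Finset.sum_congr rfl fun a _ => congrArg T (funext fun j => ?_)
  by_cases h : j = a
  · subst h; simp
  · simp [Function.update_of_ne h]

variable [NormedSpace ℂ V] [SMulCommClass ℝ ℂ V] [IsScalarTower ℝ ℂ V]

theorem ofReal_smul' {W : Type*} [AddCommGroup W] [Module ℝ W] [Module ℂ W] [IsScalarTower ℝ ℂ W]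
    (c : ℝ) (x : W) : (c : ℂ) • x = c • x :=
  algebraMap_smul ℂ c x

/-- A map with differential `A`, conformal with factor `Ω`, `b = grad log Ω`, near a point `x`. -/
structure IsConformalAt (h : E n → E n) (A : E n → E n →L[ℝ] E n) (Ω : E n → ℝ) (b : E n → E n)
    (x : E n) : Prop where
  map : HasFDerivAt h (A x) x
  diff : ∃ A' : E n →L[ℝ] E n →L[ℝ] E n, HasFDerivAt A A' x ∧
    ∀ a, A' a = A x ∘L conformalMap (b x) a
  pos : 0 < Ω x
  factor : HasFDerivAt Ω (Ω x • innerSL ℝ (b x)) x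
  logGrad : ∃ b' : E n →L[ℝ] E n, HasFDerivAt b b' x ∧
    ∀ a, b' a = inner ℝ (b x) a • b x - (inner ℝ (b x) (b x) / 2) • a

/-- The conformal pullback `Ω^λ h^*` of forms. -/
def confPull (lam : ℂ) (h : E n → E n) (A : E n → E n →L[ℝ] E n) (Ω : E n → ℝ) (φ : Form n k V) :
    Form n k V := fun x => ((Ω x : ℂ) ^ lam) • (φ (h x)).compContinuousLinearMap (A x)

/-- The components of a real vector, as complex numbers. -/
def cvec (b : E n) : Fin n → ℂ := fun m => (b m : ℂ)

theorem ctrS_cvec (ρ : ℂ) (b : E n) (j : Fin n) (T : E n [⋀^Fin k]→L[ℝ] V) :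
    ctrS opN ρ (cvec b) j T = (ρ * b j) • T
      + ∑ m, b m • (derivAct (unitMap m j - unitMap j m) T) := by
  simp only [ctrS, LinearMap.add_apply, LinearMap.smul_apply, Module.End.one_apply,
    LinearMap.sum_apply, cvec, ofReal_smul', LinearMap.sub_apply, derivAct_sub, opN_apply]

variable {h : E n → E n} {A : E n → E n →L[ℝ] E n} {Ω : E n → ℝ} {b : E n → E n} {x : E n}

theorem IsConformalAt.hasFDerivAt_cpow (H : IsConformalAt h A Ω b x) (lam : ℂ) :
    HasFDerivAt (fun y => (Ω y : ℂ) ^ lam)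
      ((lam * (Ω x : ℂ) ^ lam) • (Complex.ofRealCLM ∘L innerSL ℝ (b x))) x := by
  have h1 : HasFDerivAt (fun y => (Ω y : ℂ)) (Complex.ofRealCLM ∘L (Ω x • innerSL ℝ (b x))) x :=
    Complex.ofRealCLM.hasFDerivAt.comp x H.factor
  have hne : (Ω x : ℂ) ≠ 0 := by exact_mod_cast H.pos.ne'
  have h2 : HasDerivAt (fun z : ℂ => z ^ lam) (lam * (Ω x : ℂ) ^ (lam - 1) * 1) (Ω x : ℂ) :=
    (hasDerivAt_id _).cpow_const (Or.inl (by simpa using H.pos))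
  have h3 := h2.hasFDerivAt.restrictScalars ℝ |>.comp x h1
  refine h3.congr_fderiv ?_
  ext v
  simp [Complex.cpow_sub _ _ hne]
  field_simp

/-- Three sources: the power of Ω and the variation of A combine into S_j applied to the pullback,
and the chain rule gives pullbacks of the derivatives of φ. -/
theorem IsConformalAt.pd_confPull (H : IsConformalAt h A Ω b x) (lam : ℂ) {φ : Form n k V}
    (hφ : DifferentiableAt ℝ φ (h x)) :
    DifferentiableAt ℝ (confPull lam h A Ω φ) x ∧
    ∀ j, pd j (confPull lam h A Ω φ) x =
      ctrS opN (lam + k) (cvec (b x)) j (confPull lam h A Ω φ x)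
        + ∑ p, (A x (e j)) p • confPull lam h A Ω (pd p φ) x := by
  obtain ⟨A', hA', hAW⟩ := H.diff
  have h1 : HasFDerivAt (fun y => φ (h y)) (fderiv ℝ φ (h x) ∘L A x) x :=
    hφ.hasFDerivAt.comp x H.map
  have h2 := (H.hasFDerivAt_cpow lam).smul
    (h1.continuousAlternatingMapCompContinuousLinearMap hA')
  refine ⟨h2.differentiableAt, fun j => ?_⟩
  have h3 : pd j (confPull lam h A Ω φ) x = _ := congrArg (fun L => L (e j)) h2.fderiv
  rw [h3, ctrS_cvec]
  have h4 : (fderiv ℝ φ (h x) (A x (e j))).compContinuousLinearMap (A x) =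
      ∑ p, (A x (e j)) p • (pd p φ (h x)).compContinuousLinearMap (A x) := by
    change ContinuousAlternatingMap.compContinuousLinearMapCLM (A x) _ =
      ∑ p, (A x (e j)) p • ContinuousAlternatingMap.compContinuousLinearMapCLM (A x) _
    conv_lhs => rw [← sum_smul_e (A x (e j))]
    simp only [map_sum, map_smul, pd]
  have h5 : ∀ T : E n [⋀^Fin k]→L[ℝ] V, T.fderivCompContinuousLinearMap (A x) (A' (e j)) =
      b x j • (k • T.compContinuousLinearMap (A x)) + ∑ m, b x m •
        derivAct (unitMap m j - unitMap j m) (T.compContinuousLinearMap (A x)) := by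
    intro T
    rw [hAW, fderivComp_comp, conformalMap_e, derivAct_add, derivAct_smul, derivAct_id,
      derivAct_sum]
    simp only [derivAct_smul]
  have h6 : ∀ p, confPull lam h A Ω (pd p φ) x = (Ω x : ℂ) ^ lam •
      ContinuousAlternatingMap.compContinuousLinearMapCLM (A x) (pd p φ (h x)) := fun p => rfl
  have h8 : confPull lam h A Ω φ x = (Ω x : ℂ) ^ lam •
      (φ (h x)).compContinuousLinearMap (A x) := rfl
  have h9 : ∀ T : E n [⋀^Fin k]→L[ℝ] V, ContinuousAlternatingMap.compContinuousLinearMapCLM (A x) T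
    = T.compContinuousLinearMap (A x) := fun T => rfl
  simp only [h6, h8, h9]
  simp only [_root_.add_apply, _root_.smul_apply, ContinuousLinearMap.smulRight_apply,
    ContinuousLinearMap.comp_apply, h9, h4, h5, innerSL_apply_apply, inner_e_right,
    Complex.ofRealCLM_apply, smul_add, Finset.smul_sum]
  have h7 : ∀ (W : E n →L[ℝ] E n) (c : ℂ) (T : E n [⋀^Fin k]→L[ℝ] V),
      derivAct W (c • T) = c • derivAct W T := by
    intro W c T
    ext v
    simp only [derivAct_apply, ContinuousAlternatingMap.smul_apply, Finset.smul_sum]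
  simp only [h7]
  simp only [← ofReal_smul', ← Nat.cast_smul_eq_nsmul ℂ, smul_smul, smul_eq_mul]
  simp only [mul_comm ((Ω x : ℂ) ^ lam)]
  module

theorem TwiceDiffAt.of_pd {F : Type*} [NormedAddCommGroup F] [NormedSpace ℝ F] {φ : E n → F}
    {x : E n} (h : ∀ᶠ y in 𝓝 x, DifferentiableAt ℝ φ y) (h' : ∀ j, DifferentiableAt ℝ (pd j φ) x) :
    TwiceDiffAt φ x := by
  refine ⟨h, ?_⟩
  have : fderiv ℝ φ = fun y => ∑ i,
      (ContinuousLinearMap.smulRightL ℝ (E n) F (EuclideanSpace.proj i)) (pd i φ y) :=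
    funext fun y => linearMap_eq_sum_proj _
  rw [this]
  exact DifferentiableAt.fun_sum fun i _ =>
    (ContinuousLinearMap.differentiableAt _).comp x (h' i)

/-- The 2-jet of a conformal pullback. -/
theorem confPull_jets (H : ∀ᶠ y in 𝓝 x, IsConformalAt h A Ω b y) (lam : ℂ) {φ : Form n k V}
    (hφ : ContDiff ℝ ∞ φ) :
    let ψ := confPull lam h A Ω φ
    let S := ctrS (opN (k := k) (V := V)) (lam + k) (cvec (b x))
    let φ₁ : Fin n → E n [⋀^Fin k]→L[ℝ] V := fun j =>
      ∑ p, (A x (e j)) p • confPull lam h A Ω (pd p φ) x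
    let φ₂ : Fin n → Fin n → E n [⋀^Fin k]→L[ℝ] V := fun i j =>
      ∑ p, (A x (e j)) p • ∑ q, (A x (e i)) q • confPull lam h A Ω (pd q (pd p φ)) x
    TwiceDiffAt ψ x ∧ (∀ j, pd j ψ x = S j (ψ x) + φ₁ j) ∧
      ∀ i j, pd2 i j ψ x = ctrD opN (lam + k) (cvec (b x)) i j (ψ x) + S j (φ₁ i) + S i (φ₁ j)
        + cvec (b x) i • φ₁ j + cvec (b x) j • φ₁ i
        - (if i = j then ∑ m, cvec (b x) m • φ₁ m else 0) + φ₂ i j := by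
  intro ψ S φ₁ φ₂
  have hpd : ∀ p, ContDiff ℝ ∞ (pd p φ) := fun p =>
    (hφ.fderiv_right (m := ∞) (by norm_cast)).clm_apply contDiff_const
  have hdiff : ∀ {χ : Form n k V}, ContDiff ℝ ∞ χ → ∀ y, DifferentiableAt ℝ χ y :=
    fun hχ y => (hχ.differentiable (by simp)) y
  have H0 := H.self_of_nhds
  obtain ⟨A', hA', hAW⟩ := H0.diff
  obtain ⟨b', hb', hbW⟩ := H0.logGrad
  -- The first derivative formula holds in a neighbourhood of x, so it may be differentiated once
  -- more.
  have h1 : ∀ j, pd j ψ =ᶠ[𝓝 x] fun y => ((lam + k) * (b y j : ℝ)) • ψ y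
      + ∑ m, b y m • derivAct (unitMap m j - unitMap j m) (ψ y)
      + ∑ p, (A y (e j)) p • confPull lam h A Ω (pd p φ) y := fun j =>
    H.mono fun y hy => by rw [(hy.pd_confPull lam (hdiff hφ _)).2 j, ctrS_cvec]
  have hψ : HasFDerivAt ψ (fderiv ℝ ψ x) x :=
    (H0.pd_confPull lam (hdiff hφ _)).1.hasFDerivAt
  have hχ : ∀ p, HasFDerivAt (confPull lam h A Ω (pd p φ))
      (fderiv ℝ (confPull lam h A Ω (pd p φ)) x) x := fun p =>
    (H0.pd_confPull lam (hdiff (hpd p) _)).1.hasFDerivAt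
  have hbj : ∀ j, HasFDerivAt (fun y => b y j)
      ((EuclideanSpace.proj j : E n →L[ℝ] ℝ) ∘L b') x := fun j =>
    (EuclideanSpace.proj j : E n →L[ℝ] ℝ).hasFDerivAt.comp x hb'
  have hbc : ∀ j, HasFDerivAt (fun y => (lam + k) * ((b y j : ℝ) : ℂ))
      ((lam + k) • (Complex.ofRealCLM ∘L ((EuclideanSpace.proj j : E n →L[ℝ] ℝ) ∘L b'))) x :=
    fun j => (Complex.ofRealCLM.hasFDerivAt.comp x (hbj j)).const_mul _
  have hAj : ∀ j p, HasFDerivAt (fun y => (A y (e j)) p)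
      ((EuclideanSpace.proj p : E n →L[ℝ] ℝ) ∘L (ContinuousLinearMap.apply ℝ (E n) (e j) ∘L A')) x :=
    fun j p => (EuclideanSpace.proj p : E n →L[ℝ] ℝ).hasFDerivAt.comp x
      ((ContinuousLinearMap.apply ℝ (E n) (e j)).hasFDerivAt.comp x hA')
  have h2 := fun j => (((hbc j).smul hψ).add (HasFDerivAt.fun_sum (u := Finset.univ) fun m _ =>
    (hbj m).smul ((derivAct (unitMap m j - unitMap j m)).hasFDerivAt.comp x hψ))).add
      (HasFDerivAt.fun_sum (u := Finset.univ) fun p _ => (hAj j p).smul (hχ p))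
  have h3 : ∀ j, DifferentiableAt ℝ (pd j ψ) x := fun j =>
    (h2 j).differentiableAt.congr_of_eventuallyEq (h1 j)
  have h4 : TwiceDiffAt ψ x :=
    TwiceDiffAt.of_pd (H.mono fun y hy => (hy.pd_confPull lam (hdiff hφ _)).1) h3
  have h5 : ∀ j, pd j ψ x = S j (ψ x) + φ₁ j := (H0.pd_confPull lam (hdiff hφ _)).2
  refine ⟨h4, h5, fun i j => ?_⟩
  have h6 : pd2 i j ψ x = _ := (pd2_eq_pd_pd h4.2 i j).trans ((pd_congr (h1 j) i).trans
    (congrArg (fun L => L (e i)) (h2 j).fderiv))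
  have h7 : ∀ p, fderiv ℝ (confPull lam h A Ω (pd p φ)) x (e i) = S i (confPull lam h A Ω (pd p φ) x)
      + ∑ q, (A x (e i)) q • confPull lam h A Ω (pd q (pd p φ)) x := fun p =>
    (H0.pd_confPull lam (hdiff (hpd p) _)).2 i
  have h8 : fderiv ℝ ψ x (e i) = S i (ψ x) + φ₁ i := h5 i
  rw [h6]
  simp only [_root_.add_apply, _root_.smul_apply, ContinuousLinearMap.smulRight_apply,
    ContinuousLinearMap.comp_apply, _root_.sum_apply, h7, h8, hAW, hbW,
    ContinuousLinearMap.apply_apply]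
  set v := conformalMap (b x) (e i) (e j) with hv
  set w := inner ℝ (b x) (e i) • b x - (inner ℝ (b x) (b x) / 2) • e i with hw
  -- The vector w is the derivative of b in the direction e_i, and this is the argument appearing in
  -- `ctrD`.
  have hsum : cvec w = fun m => cvec (b x) i * cvec (b x) m
      - if i = m then (∑ p, cvec (b x) p * cvec (b x) p) / 2 else 0 := by
    funext m
    simp only [cvec, hw, inner_e_right, inner_eq_sum (b x) (b x), PiLp.sub_apply, PiLp.smul_apply, smul_eq_mul,
      e_apply, eq_comm (a := m)]
    split_ifs <;> push_cast <;> ring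
  have g1 : S j (S i (ψ x) + φ₁ i) = ((lam + k) * (b x j : ℝ)) • (S i (ψ x) + φ₁ i)
      + ∑ m, b x m • derivAct (unitMap m j - unitMap j m) (S i (ψ x) + φ₁ i) := ctrS_cvec _ _ _ _
  have g2 : ctrS opN (lam + k) (cvec w) j (ψ x) = ((lam + k) * (w j : ℝ)) • ψ x
      + ∑ m, w m • derivAct (unitMap m j - unitMap j m) (ψ x) := ctrS_cvec _ _ _ _
  have g3 : S i (φ₁ j) = ∑ p, (A x (e j)) p • S i (confPull lam h A Ω (pd p φ) x) := by
    simp only [φ₁, map_sum, ← ofReal_smul', map_smul]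
  -- This is the contribution of the second derivative of h: v = b_i e_j + b_j e_i - δ_ij b, and the
  -- expression is linear in v.
  have g4 : ∑ p, (A x v) p • confPull lam h A Ω (pd p φ) x = cvec (b x) i • φ₁ j
      + cvec (b x) j • φ₁ i - (if i = j then ∑ m, cvec (b x) m • φ₁ m else 0) := by
    have hlin : ∀ u : E n, ∑ p, (A x u) p • confPull lam h A Ω (pd p φ) x =
        ∑ m, cvec u m • φ₁ m := by
      intro u
      conv_lhs => rw [← sum_smul_e u]
      simp only [map_sum, map_smul, WithLp.ofLp_sum, WithLp.ofLp_smul, Finset.sum_apply,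
        Pi.smul_apply, Finset.sum_smul, smul_assoc, φ₁, cvec, ofReal_smul']
      rw [Finset.sum_comm]
      simp only [Finset.smul_sum]
    have hve : v = b x i • e j + b x j • e i - (if i = j then (1 : ℝ) else 0) • b x := by
      rw [hv, conformalMap_apply, inner_e_right, inner_e_right, inner_e_left, e_apply]
    have hlin2 : ∀ u u' : E n, ∀ c : ℝ, ∑ m, cvec (u + c • u') m • φ₁ m =
        ∑ m, cvec u m • φ₁ m + (c : ℂ) • ∑ m, cvec u' m • φ₁ m := by
      intro u u' c
      simp only [cvec, PiLp.add_apply, PiLp.smul_apply, Complex.ofReal_add, add_smul, smul_eq_mul,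
        Complex.ofReal_mul, mul_smul, Finset.sum_add_distrib, Finset.smul_sum]
    have hlin3 : ∀ m, ∑ p, cvec (e m) p • φ₁ p = φ₁ m := by
      intro m
      simp only [cvec, e_apply, Complex.ofReal_one, Complex.ofReal_zero, apply_ite Complex.ofReal,
        ite_smul, one_smul, zero_smul, Finset.sum_ite_eq', Finset.mem_univ, if_true]
    rw [hlin, hve, sub_eq_add_neg, ← neg_smul, hlin2, hlin2, ← zero_add (b x i • e j), hlin2, hlin3,
      hlin3]
    split_ifs <;> simp [cvec, sub_eq_add_neg]
  have g5 : ctrD opN (lam + k) (cvec (b x)) i j (ψ x) =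
      ctrS opN (lam + k) (cvec w) j (ψ x) + S j (S i (ψ x)) := by
    rw [hsum, ctrD]; rfl
  rw [g5]
  have g6 := map_add (S j) (S i (ψ x)) (φ₁ i)
  rw [g2, add_assoc (_ + _) (S j (S i (ψ x))), ← g6, g1, g3,
    add_assoc _ (cvec (b x) i • φ₁ j), add_sub_assoc _ _ (ite _ _ _), ← g4]
  have hproj : ∀ p (u : E n), (EuclideanSpace.proj p : E n →L[ℝ] ℝ) u = u p := fun _ _ => rfl
  simp only [Finset.sum_add_distrib, smul_add, hproj, Function.comp_apply,
    Complex.ofRealCLM_apply, smul_eq_mul, φ₂]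
  abel

end ConformalPullback

/-! ### The Möbius maps n_z: inversion, translation by z, inversion -/

section Moebius

open Filter Topology

variable {n : ℕ}

/-- The denominator of the action of `n_z`. -/
def moebQ (z u : E n) : ℝ := 1 + 2 * inner ℝ z u + inner ℝ z z * inner ℝ u u

/-- The action of `n_z`. -/
def moeb (z u : E n) : E n := (moebQ z u)⁻¹ • (u + inner ℝ u u • z)

/-- The logarithmic gradient of the conformal factor of `n_z`. -/
def moebB (z u : E n) : E n := (-2 * (moebQ z u)⁻¹) • (z + inner ℝ z z • u)

/-- The bilinear map `(u, w) ↦ ⟨u, ·⟩ w`. -/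
def innerRight : E n →L[ℝ] E n →L[ℝ] E n →L[ℝ] E n :=
  ContinuousLinearMap.smulRightL ℝ (E n) (E n) ∘L innerSL ℝ

theorem innerRight_apply (u w v : E n) : innerRight u w v = inner ℝ u v • w := rfl

/-- The differential of the action of `n_z`. -/
def moebA (z u : E n) : E n →L[ℝ] E n :=
  (moebQ z u)⁻¹ • (ContinuousLinearMap.id ℝ (E n) + (2 : ℝ) • innerRight u z)
    + innerRight (moebB z u) (moeb z u)

theorem moebA_apply (z u v : E n) : moebA z u v =
    (moebQ z u)⁻¹ • (v + (2 * inner ℝ u v) • z) + inner ℝ (moebB z u) v • moeb z u := by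
  simp [moebA, innerRight_apply, smul_smul, mul_assoc]

theorem hasFDerivAt_inner_self (u : E n) :
    HasFDerivAt (fun u : E n => inner ℝ u u) ((2 : ℝ) • innerSL ℝ u) u := by
  refine ((hasFDerivAt_id u).inner ℝ (hasFDerivAt_id u)).congr_fderiv ?_
  ext v
  simp [fderivInnerCLM_apply, real_inner_comm, two_mul]

theorem hasFDerivAt_moebQ (z u : E n) :
    HasFDerivAt (moebQ z) ((2 : ℝ) • innerSL ℝ (z + inner ℝ z z • u)) u := by
  have h := ((((innerSL ℝ z).hasFDerivAt (x := u)).const_mul 2).const_add 1).add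
    ((hasFDerivAt_inner_self u).const_mul (inner ℝ z z))
  refine h.congr_fderiv ?_
  ext v
  simp [inner_add_left, inner_smul_left]
  ring

variable {z u : E n}

theorem hasFDerivAt_moebQ_inv (h : moebQ z u ≠ 0) :
    HasFDerivAt (fun u => (moebQ z u)⁻¹) ((moebQ z u)⁻¹ • innerSL ℝ (moebB z u)) u := by
  refine ((hasDerivAt_inv h).comp_hasFDerivAt u (hasFDerivAt_moebQ z u)).congr_fderiv ?_
  ext v
  simp [moebB, inner_smul_left]
  field_simp

theorem hasFDerivAt_moeb (h : moebQ z u ≠ 0) : HasFDerivAt (moeb z) (moebA z u) u := by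
  refine ((hasFDerivAt_moebQ_inv h).smul ((hasFDerivAt_id u).add
    ((hasFDerivAt_inner_self u).smul_const z))).congr_fderiv ?_
  ext1 v
  simp only [moebA_apply, moeb, _root_.add_apply, _root_.smul_apply,
    ContinuousLinearMap.smulRight_apply, innerSL_apply_apply, ContinuousLinearMap.id_apply,
    smul_eq_mul, id, Pi.add_apply]
  module

/-- The vector z + |z|² u has squared length |z|² Q, so one factor Q cancels. -/
theorem inner_moebB_self (h : moebQ z u ≠ 0) :
    inner ℝ (moebB z u) (moebB z u) = 4 * (moebQ z u)⁻¹ * inner ℝ z z := by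
  simp only [moebB, inner_smul_left, inner_smul_right, inner_add_left, inner_add_right,
    real_inner_comm z u, conj_trivial]
  field_simp
  rw [moebQ]
  ring

/-- Differentiating Q⁻¹ gives ⟨b,a⟩ b, and differentiating |z|² u gives -2 Q⁻¹ |z|² a, which is
-(|b|²/2) a by `inner_moebB_self`. -/
theorem hasFDerivAt_moebB (h : moebQ z u ≠ 0) :
    ∃ b' : E n →L[ℝ] E n, HasFDerivAt (moebB z) b' u ∧
      ∀ a, b' a = inner ℝ (moebB z u) a • moebB z u
        - (inner ℝ (moebB z u) (moebB z u) / 2) • a := by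
  refine ⟨_, (((hasFDerivAt_moebQ_inv h).const_mul (-2)).smul
    (((hasFDerivAt_id u).const_smul (inner ℝ z z)).const_add z)), fun a => ?_⟩
  rw [inner_moebB_self h]
  conv_rhs => enter [1, 2]; rw [moebB]
  simp only [_root_.add_apply, _root_.smul_apply, ContinuousLinearMap.smulRight_apply,
    innerSL_apply_apply, ContinuousLinearMap.id_apply, smul_eq_mul, id, Pi.smul_apply]
  module

/-- With A the differential of n_z, the left side is A b - (|b|²/2) n_z(u). It is the coefficient of
⟨a,v⟩ in the comparison of the derivative of A with A ∘ `conformalMap`, the only coefficient there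
that is not a formal identity. -/
theorem moebB_relation (h : moebQ z u ≠ 0) :
    (moebQ z u)⁻¹ • (moebB z u + (2 * inner ℝ u (moebB z u)) • z)
      + (2 * (moebQ z u)⁻¹ * inner ℝ z z) • moeb z u = (-2 * (moebQ z u)⁻¹) • z := by
  have hq : moebQ z u = 1 + 2 * inner ℝ z u + inner ℝ z z * inner ℝ u u := rfl
  simp only [moebB, moeb, inner_smul_right, inner_add_right, real_inner_comm z u]
  match_scalars
  · field_simp
    rw [hq]
    ring
  · field_simp
    ring

theorem hasFDerivAt_moebA (h : moebQ z u ≠ 0) :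
    ∃ A' : E n →L[ℝ] E n →L[ℝ] E n, HasFDerivAt (moebA z) A' u ∧
      ∀ a, A' a = moebA z u ∘L conformalMap (moebB z u) a := by
  obtain ⟨b', hb', hb⟩ := hasFDerivAt_moebB h
  refine ⟨_, ((hasFDerivAt_moebQ_inv h).smul (((innerRight.flip z).hasFDerivAt.const_smul
    (2 : ℝ)).const_add (ContinuousLinearMap.id ℝ (E n)))).add
    (innerRight.hasFDerivAt_of_bilinear hb' (hasFDerivAt_moeb h)), fun a => ?_⟩
  ext1 v
  have hrel := moebB_relation h
  simp only [_root_.add_apply, _root_.smul_apply, ContinuousLinearMap.smulRight_apply,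
    innerSL_apply_apply, ContinuousLinearMap.id_apply, smul_eq_mul,
    ContinuousLinearMap.comp_apply, ContinuousLinearMap.precompR_apply,
    ContinuousLinearMap.precompL_apply, ContinuousLinearMap.compL_apply, ContinuousLinearMap.flip_apply, innerRight_apply,
    conformalMap_apply, moebA_apply, hb, inner_moebB_self h, inner_sub_left, inner_add_left,
    inner_smul_left, inner_sub_right, inner_add_right, inner_smul_right, conj_trivial,
    Pi.smul_apply]
  linear_combination (norm := module) inner ℝ a v • hrel

theorem inner_moebA_self (h : moebQ z u ≠ 0) (v : E n) :
    inner ℝ (moebA z u v) (moebA z u v) = ((moebQ z u)⁻¹) ^ 2 * inner ℝ v v := by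
  have hq : moebQ z u = 1 + 2 * inner ℝ z u + inner ℝ z z * inner ℝ u u := rfl
  simp only [moebA_apply, moeb, moebB, inner_add_left, inner_smul_left, inner_add_right,
    inner_smul_right, conj_trivial, real_inner_comm z u, real_inner_comm v u, real_inner_comm v z]
  generalize (inner ℝ z u : ℝ) = p at *
  generalize (inner ℝ z z : ℝ) = zz at *
  generalize (inner ℝ u u : ℝ) = uu at *
  field_simp
  rw [hq]
  ring

theorem moebQ_zero (z : E n) : moebQ z 0 = 1 := by simp [moebQ]

theorem moeb_zero (z : E n) : moeb z 0 = 0 := by simp [moeb]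

theorem moebB_zero (z : E n) : moebB z 0 = (-2 : ℝ) • z := by simp [moebB, moebQ]

theorem moebA_zero (z : E n) : moebA z 0 = ContinuousLinearMap.id ℝ (E n) := by
  ext1 v; simp [moebA_apply, moebQ, moeb]

theorem eventually_moebQ_pos (z x₀ : E n) : ∀ᶠ x in 𝓝 x₀, 0 < moebQ z (x - x₀) := by
  have h : ContinuousAt (fun x => moebQ z (x - x₀)) x₀ := by
    unfold moebQ; fun_prop
  refine h.eventually_const_lt ?_
  simp [moebQ]

/-- The maps `x ↦ y + c m(n_z(x - x₀))` are conformal. -/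
theorem isConformalAt_moeb {x₀ x : E n} (y z : E n) {c : ℝ} (hc : 0 < c) (m : E n →L[ℝ] E n)
    (h : 0 < moebQ z (x - x₀)) :
    IsConformalAt (fun x => y + c • m (moeb z (x - x₀))) (fun x => c • m ∘L moebA z (x - x₀))
      (fun x => c * (moebQ z (x - x₀))⁻¹) (fun x => moebB z (x - x₀)) x := by
  have hs : HasFDerivAt (fun x : E n => x - x₀) (ContinuousLinearMap.id ℝ (E n)) x :=
    (hasFDerivAt_id x).sub_const x₀
  obtain ⟨A', hA', hA⟩ := hasFDerivAt_moebA h.ne'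
  obtain ⟨b', hb', hb⟩ := hasFDerivAt_moebB h.ne'
  refine ⟨?_, ⟨_, ((ContinuousLinearMap.compL ℝ (E n) (E n) (E n) (c • m)).hasFDerivAt.comp x
    (hA'.comp x hs)).congr_of_eventuallyEq ?_, fun a => ?_⟩, by positivity, ?_,
    ⟨b', (hb'.comp x hs : HasFDerivAt (moebB z ∘ fun x => x - x₀) _ x), fun a => ?_⟩⟩
  · exact (((c • m).hasFDerivAt.comp x ((hasFDerivAt_moeb h.ne').comp x hs)).const_add y)
  · exact Eventually.of_forall fun y => rfl
  · ext1 v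
    simp [hA]
  · refine (((hasFDerivAt_moebQ_inv h.ne').comp x hs).const_mul c).congr_fderiv ?_
    ext v
    simp [mul_assoc]
  · simp [hb]

end Moebius

/-! ### The Lorentz group, the null cone and the decomposition N̄MAN -/

section LorentzGroup

open Filter Topology

variable {n : ℕ}

/-- Light cone coordinates on `ℝ^{1,n+1}`. -/
def lc (p : ℝ) (u : E n) (q : ℝ) : Idx n → ℝ :=
  Sum.elim (fun _ => p + q) (Sum.elim (fun i => 2 * u i) (fun _ => p - q))

theorem exists_eq_lc (v : Idx n → ℝ) : ∃ p u q, v = lc p u q := by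
  refine ⟨(v (Sum.inl ()) + v (Sum.inr (Sum.inr ()))) / 2,
    WithLp.toLp 2 fun i => v (Sum.inr (Sum.inl i)) / 2,
    (v (Sum.inl ()) - v (Sum.inr (Sum.inr ()))) / 2, ?_⟩
  funext a
  rcases a with ⟨⟩ | i | ⟨⟩ <;> simp [lc] <;> ring

theorem lc_add (p p' q q' : ℝ) (u u' : E n) :
    lc p u q + lc p' u' q' = lc (p + p') (u + u') (q + q') := by
  funext a
  rcases a with ⟨⟩ | i | ⟨⟩ <;> simp [lc] <;> ring

theorem smul_lc (c p q : ℝ) (u : E n) : c • lc p u q = lc (c * p) (c • u) (c * q) := by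
  funext a
  rcases a with ⟨⟩ | i | ⟨⟩ <;> simp [lc] <;> ring

theorem matrix_ext_lc {g g' : Matrix (Idx n) (Idx n) ℝ}
    (h : ∀ p u q, g *ᵥ lc p u q = g' *ᵥ lc p u q) : g = g' := by
  refine Matrix.mulVec_injective (funext fun v => ?_)
  obtain ⟨p, u, q, rfl⟩ := exists_eq_lc v
  exact h p u q

/-- In light cone coordinates N, N̄, A and M act by short formulas; products of matrices are
therefore compared through their action on these coordinates rather than entrywise. -/
theorem matN_mulVec (z : E n) (p : ℝ) (u : E n) (q : ℝ) : matN z *ᵥ lc p u q =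
    lc (p + 2 * inner ℝ z u + inner ℝ z z * q) (u + q • z) q := by
  rw [real_inner_self_eq_norm_sq, inner_eq_sum]
  funext a
  rcases a with ⟨⟩ | i | ⟨⟩
  · simp [Matrix.mulVec, dotProduct, matN, lc, Fintype.sum_sum_type, Finset.mul_sum, mul_left_comm]
    ring
  · simp [Matrix.mulVec, dotProduct, matN, lc, Fintype.sum_sum_type]
    ring
  · simp [Matrix.mulVec, dotProduct, matN, lc, Fintype.sum_sum_type, Finset.mul_sum, mul_left_comm]
    ring

theorem matNbar_mulVec (y : E n) (p : ℝ) (u : E n) (q : ℝ) : matNbar y *ᵥ lc p u q =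
    lc p (u + p • y) (q + 2 * inner ℝ y u + inner ℝ y y * p) := by
  rw [real_inner_self_eq_norm_sq, inner_eq_sum]
  funext a
  rcases a with ⟨⟩ | i | ⟨⟩
  · simp [Matrix.mulVec, dotProduct, matNbar, lc, Fintype.sum_sum_type, Finset.mul_sum,
      mul_left_comm]
    ring
  · simp [Matrix.mulVec, dotProduct, matNbar, lc, Fintype.sum_sum_type]
    ring
  · simp [Matrix.mulVec, dotProduct, matNbar, lc, Fintype.sum_sum_type, Finset.mul_sum,
      mul_left_comm]
    ring

theorem matA_mulVec (t p : ℝ) (u : E n) (q : ℝ) : matA t *ᵥ lc p u q =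
    lc (Real.exp t * p) u (Real.exp (-t) * q) := by
  funext a
  rcases a with ⟨⟩ | i | ⟨⟩
  · simp [Matrix.mulVec, dotProduct, matA, lc, Fintype.sum_sum_type, Real.cosh_eq, Real.sinh_eq]
    ring
  · simp [Matrix.mulVec, dotProduct, matA, lc, Fintype.sum_sum_type]
  · simp [Matrix.mulVec, dotProduct, matA, lc, Fintype.sum_sum_type, Real.cosh_eq, Real.sinh_eq]
    ring

theorem matMap_apply (m : Matrix (Fin n) (Fin n) ℝ) (u : E n) (i : Fin n) :
    matMap m u i = ∑ j, m i j * u j := rfl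

theorem fromBlocks_mulVec (m : Matrix (Fin n) (Fin n) ℝ) (p : ℝ) (u : E n) (q : ℝ) :
    (Matrix.fromBlocks 1 0 0 (Matrix.fromBlocks m 0 0 1) : Matrix (Idx n) (Idx n) ℝ) *ᵥ lc p u q =
      lc p (matMap m u) q := by
  funext a
  rcases a with ⟨⟩ | i | ⟨⟩
  · simp [Matrix.mulVec, dotProduct, lc, Fintype.sum_sum_type]
  · simp only [lc, Sum.elim_inl, Sum.elim_inr, matMap_apply, Matrix.mulVec, dotProduct,
      Fintype.sum_sum_type, Matrix.fromBlocks_apply₂₁, Matrix.fromBlocks_apply₂₂,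
      Matrix.fromBlocks_apply₁₁, Matrix.fromBlocks_apply₁₂, Matrix.zero_apply, zero_mul,
      Finset.sum_const_zero, zero_add, add_zero, Finset.mul_sum, mul_left_comm]
  · simp [Matrix.mulVec, dotProduct, lc, Fintype.sum_sum_type]

theorem matM_mulVec (m : SO n) (p : ℝ) (u : E n) (q : ℝ) : matM m *ᵥ lc p u q =
    lc p (matMap (m : Matrix _ _ ℝ) u) q :=
  fromBlocks_mulVec _ p u q

/-- The Lorentz form. -/
def lform (v w : Idx n → ℝ) : ℝ := v ⬝ᵥ (lorentz n *ᵥ w)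

theorem lform_lc (p p' q q' : ℝ) (u u' : E n) : lform (lc p u q) (lc p' u' q') =
    2 * (p * q' + q * p') - 4 * inner ℝ u u' := by
  rw [inner_eq_sum, lform, lorentz]
  simp only [Matrix.mulVec_diagonal, dotProduct, lc, Fintype.sum_sum_type, Sum.elim_inl,
    Sum.elim_inr, Finset.univ_unique, Finset.sum_singleton]
  have : ∑ i, 2 * u i * (-1 * (2 * u' i)) = -(4 * ∑ i, u i * u' i) := by
    rw [Finset.mul_sum, ← Finset.sum_neg_distrib]
    exact Finset.sum_congr rfl fun i _ => by ring
  rw [this]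
  ring

/-- The matrices of isometries of the Lorentz form. -/
def IsLorentz (g : Matrix (Idx n) (Idx n) ℝ) : Prop := gᵀ * lorentz n * g = lorentz n

theorem IsLorentz.lform {g : Matrix (Idx n) (Idx n) ℝ} (hg : IsLorentz g) (v w : Idx n → ℝ) :
    lform (g *ᵥ v) (g *ᵥ w) = lform v w := by
  unfold ConfForms.lform
  rw [Matrix.mulVec_mulVec, Matrix.dotProduct_mulVec, ← Matrix.vecMul_transpose,
    Matrix.vecMul_vecMul, ← mul_assoc, hg, ← Matrix.dotProduct_mulVec]

theorem isLorentz_of_lform {g : Matrix (Idx n) (Idx n) ℝ}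
    (h : ∀ p u q p' u' q', lform (g *ᵥ lc p u q) (g *ᵥ lc p' u' q') =
      lform (lc p u q) (lc p' u' q')) : IsLorentz g := by
  refine Matrix.mulVec_injective (funext fun w => dotProduct_eq _ _ fun v => ?_)
  obtain ⟨p, u, q, rfl⟩ := exists_eq_lc v
  obtain ⟨p', u', q', rfl⟩ := exists_eq_lc w
  rw [dotProduct_comm _ (lc p u q), dotProduct_comm _ (lc p u q)]
  refine Eq.trans ?_ (h p u q p' u' q')
  unfold lform
  rw [Matrix.mulVec_mulVec, Matrix.dotProduct_mulVec (g *ᵥ _), ← Matrix.vecMul_transpose g,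
    Matrix.vecMul_vecMul, ← mul_assoc, ← Matrix.dotProduct_mulVec]

theorem lorentz_mul_self : lorentz n * lorentz n = 1 := by
  rw [lorentz, Matrix.diagonal_mul_diagonal, ← Matrix.diagonal_one]
  congr 1
  funext a
  rcases a with ⟨⟩ | i <;> simp

theorem IsLorentz.inv_mul {g : Matrix (Idx n) (Idx n) ℝ} (hg : IsLorentz g) :
    (lorentz n * gᵀ * lorentz n) * g = 1 := by
  have h : gᵀ * lorentz n * g = lorentz n := hg
  rw [mul_assoc, mul_assoc, ← mul_assoc gᵀ, h, lorentz_mul_self]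

theorem IsLorentz.inv_eq {g : Matrix (Idx n) (Idx n) ℝ} (hg : IsLorentz g) :
    g⁻¹ = lorentz n * gᵀ * lorentz n := Matrix.inv_eq_left_inv hg.inv_mul

theorem IsLorentz.isUnit_det {g : Matrix (Idx n) (Idx n) ℝ} (hg : IsLorentz g) : IsUnit g.det :=
  (Matrix.isUnit_iff_isUnit_det g).mp (IsUnit.of_mul_eq_one_right _ hg.inv_mul)

theorem IsLorentz.mul {g g' : Matrix (Idx n) (Idx n) ℝ} (hg : IsLorentz g) (hg' : IsLorentz g') :
    IsLorentz (g * g') := by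
  have h : gᵀ * lorentz n * g = lorentz n := hg
  have h' : g'ᵀ * lorentz n * g' = lorentz n := hg'
  rw [IsLorentz, Matrix.transpose_mul, mul_assoc, mul_assoc, ← mul_assoc (lorentz n), ← mul_assoc gᵀ,
    ← mul_assoc gᵀ, h, ← mul_assoc, h']

theorem IsLorentz.inv {g : Matrix (Idx n) (Idx n) ℝ} (hg : IsLorentz g) : IsLorentz g⁻¹ := by
  have h : gᵀ * lorentz n * g = lorentz n := hg
  have h1 : g * g⁻¹ = 1 := Matrix.mul_nonsing_inv g hg.isUnit_det
  rw [IsLorentz]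
  conv_lhs => rw [← h]
  have h2 : (g⁻¹)ᵀ * gᵀ = 1 := by rw [← Matrix.transpose_mul, h1, Matrix.transpose_one]
  calc (g⁻¹)ᵀ * (gᵀ * lorentz n * g) * g⁻¹ = ((g⁻¹)ᵀ * gᵀ) * lorentz n * (g * g⁻¹) := by
        simp only [mul_assoc]
    _ = lorentz n := by rw [h1, h2, one_mul, mul_one]

theorem IsLorentz.det_sq {g : Matrix (Idx n) (Idx n) ℝ} (hg : IsLorentz g) : g.det ^ 2 = 1 := by
  have h := congrArg Matrix.det (show gᵀ * lorentz n * g = lorentz n from hg)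
  have h0 : (lorentz n).det * (lorentz n).det = 1 := by
    rw [← Matrix.det_mul, lorentz_mul_self, Matrix.det_one]
  rw [Matrix.det_mul, Matrix.det_mul, Matrix.det_transpose] at h
  have hne : (lorentz n).det ≠ 0 := left_ne_zero_of_mul_eq_one h0
  refine mul_right_cancel₀ hne ?_
  linarith

theorem inner_matMap {m : Matrix (Fin n) (Fin n) ℝ} (hm : mᵀ * m = 1) (u v : E n) :
    inner ℝ (matMap m u) (matMap m v) = inner ℝ u v := by
  have h : ∀ w : E n, inner ℝ u w = (u : Fin n → ℝ) ⬝ᵥ w := fun w => inner_eq_sum u w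
  have h' : inner ℝ (matMap m u) (matMap m v) = (m *ᵥ u) ⬝ᵥ (m *ᵥ v) := inner_eq_sum _ _
  rw [h', h, Matrix.dotProduct_mulVec, ← Matrix.vecMul_transpose, Matrix.vecMul_vecMul, hm,
    Matrix.vecMul_one]

theorem SO.transpose_mul (m : SO n) : (m : Matrix (Fin n) (Fin n) ℝ)ᵀ * m = 1 :=
  (Matrix.mem_orthogonalGroup_iff' (Fin n) ℝ).mp (Matrix.mem_specialOrthogonalGroup_iff.mp m.2).1

theorem isLorentz_matN (z : E n) : IsLorentz (matN z) := isLorentz_of_lform fun p u q p' u' q' => by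
  simp only [matN_mulVec, lform_lc, inner_add_left, inner_add_right, inner_smul_left,
    inner_smul_right, conj_trivial, real_inner_comm z u]
  ring

theorem isLorentz_matNbar (y : E n) : IsLorentz (matNbar y) :=
  isLorentz_of_lform fun p u q p' u' q' => by
    simp only [matNbar_mulVec, lform_lc, inner_add_left, inner_add_right, inner_smul_left,
      inner_smul_right, conj_trivial, real_inner_comm y u]
    ring

theorem isLorentz_matA (t : ℝ) : IsLorentz (matA t : Matrix (Idx n) (Idx n) ℝ) :=
  isLorentz_of_lform fun p u q p' u' q' => by
    simp only [matA_mulVec, lform_lc, Real.exp_neg]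
    field_simp

theorem isLorentz_matM (m : SO n) : IsLorentz (matM m) :=
  isLorentz_of_lform fun p u q p' u' q' => by
    simp only [matM_mulVec, lform_lc, inner_matMap (SO.transpose_mul m)]

theorem IsLorentz.det_mul_self {g : Matrix (Idx n) (Idx n) ℝ} (hg : IsLorentz g) :
    (g * g).det = 1 := by
  rw [Matrix.det_mul, ← sq, hg.det_sq]

/-- An isometry of the Lorentz form has determinant ±1, and n_z is the square of n_{z/2}. -/
theorem det_matN (z : E n) : (matN z).det = 1 := by
  have : matN z = matN ((1 / 2 : ℝ) • z) * matN ((1 / 2 : ℝ) • z) := matrix_ext_lc fun p u q => by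
    rw [← Matrix.mulVec_mulVec]
    simp only [matN_mulVec, inner_add_right, inner_smul_left, inner_smul_right, conj_trivial]
    congr 1
    · ring
    · module
  rw [this, (isLorentz_matN _).det_mul_self]

theorem det_matNbar (y : E n) : (matNbar y).det = 1 := by
  have : matNbar y = matNbar ((1 / 2 : ℝ) • y) * matNbar ((1 / 2 : ℝ) • y) :=
    matrix_ext_lc fun p u q => by
      rw [← Matrix.mulVec_mulVec]
      simp only [matNbar_mulVec, inner_add_right, inner_smul_left, inner_smul_right, conj_trivial]
      congr 1
      · module
      · ring
  rw [this, (isLorentz_matNbar _).det_mul_self]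

theorem det_matA (t : ℝ) : (matA t : Matrix (Idx n) (Idx n) ℝ).det = 1 := by
  have : (matA t : Matrix (Idx n) (Idx n) ℝ) = matA (t / 2) * matA (t / 2) :=
    matrix_ext_lc fun p u q => by
      rw [← Matrix.mulVec_mulVec]
      simp only [matA_mulVec, ← mul_assoc, ← Real.exp_add]
      congr 2 <;> ring_nf
  rw [this, (isLorentz_matA _).det_mul_self]

theorem isLorentz_of_mem_G {g : Matrix (Idx n) (Idx n) ℝ} (hg : g ∈ G n) : IsLorentz g :=
  connectedComponentIn_subset {g | gᵀ * lorentz n * g = lorentz n} 1 hg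

theorem one_mem_G : (1 : Matrix (Idx n) (Idx n) ℝ) ∈ G n :=
  mem_connectedComponentIn (by simp)

/-- A continuous function without zeros on the Lorentz group keeps its sign on `G`. -/
theorem pos_of_mem_G {f : Matrix (Idx n) (Idx n) ℝ → ℝ} (hf : Continuous f)
    (h : ∀ g, IsLorentz g → f g ≠ 0) (h1 : 0 < f 1) {g : Matrix (Idx n) (Idx n) ℝ} (hg : g ∈ G n) :
    0 < f g := by
  by_contra hneg
  obtain ⟨g', hg', h0⟩ := (isPreconnected_connectedComponentIn :
    IsPreconnected (G n)).intermediate_value hg one_mem_G hf.continuousOn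
    (show (0 : ℝ) ∈ Set.Icc (f g) (f 1) from ⟨not_lt.mp hneg, h1.le⟩)
  exact h g' (isLorentz_of_mem_G hg') h0

theorem det_of_mem_G {g : Matrix (Idx n) (Idx n) ℝ} (hg : g ∈ G n) : g.det = 1 := by
  have h0 : 0 < g.det := pos_of_mem_G (f := Matrix.det) (by fun_prop)
    (fun g hg => hg.isUnit_det.ne_zero) (by simp) hg
  have := (isLorentz_of_mem_G hg).det_sq
  nlinarith

/-- The null vector representing a point of `ℝⁿ`. -/
def coneLift (x : E n) : Idx n → ℝ := lc 1 x (inner ℝ x x)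

theorem matNbar_mulVec_coneLift (y x : E n) : matNbar y *ᵥ coneLift x = coneLift (y + x) := by
  rw [coneLift, coneLift, matNbar_mulVec, one_smul, mul_one, add_comm x y]
  congr 1
  simp only [inner_add_left, inner_add_right, real_inner_comm y x]
  ring

/-- The lifted point of the sphere and `coneLift` lie on the same null line. The action is
projective, so `coneLift` may be used instead, and stereographic projection becomes u/p. -/
theorem sphereLift_kappa (x : E n) : sphereLift (kappa x) = (1 + ‖x‖ ^ 2)⁻¹ • coneLift x := by
  have h : (1 + ‖x‖ ^ 2) ≠ 0 := by positivity
  funext a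
  rcases a with ⟨⟩ | i | ⟨⟩
  · simp [sphereLift, coneLift, lc, real_inner_self_eq_norm_sq, inv_mul_cancel₀ h]
  · simp [sphereLift, coneLift, lc, kappa]
    ring
  · simp [sphereLift, coneLift, lc, kappa, real_inner_self_eq_norm_sq]
    ring

theorem sphereAct_kappa (g : Matrix (Idx n) (Idx n) ℝ) (x : E n) {p q : ℝ} {u : E n}
    (h : g *ᵥ coneLift x = lc p u q) : sphereAct g (kappa x) =
      Sum.elim (fun i => 2 * u i / (p + q)) (fun _ => (p - q) / (p + q)) := by
  have h1 : (1 + ‖x‖ ^ 2)⁻¹ ≠ 0 := by positivity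
  funext a
  rw [sphereAct, sphereLift_kappa, Matrix.mulVec_smul, h]
  rcases a with i | ⟨⟩
  · simp only [lc, Pi.smul_apply, Sum.elim_inl, Sum.elim_inr, smul_eq_mul, mul_inv]
    field_simp
  · simp only [lc, Pi.smul_apply, Sum.elim_inl, Sum.elim_inr, smul_eq_mul, mul_inv]
    field_simp

/-- The excluded pole is the null line p = 0: the last coordinate of the image on the sphere is
(p-q)/(p+q). -/
theorem definedAt_iff (g : Matrix (Idx n) (Idx n) ℝ) (x : E n) {p q : ℝ} {u : E n}
    (h : g *ᵥ coneLift x = lc p u q) (hpq : p + q ≠ 0) : DefinedAt g x ↔ p ≠ 0 := by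
  rw [DefinedAt, sphereAct_kappa g x h, Sum.elim_inr, ne_eq, div_eq_iff hpq, not_iff_not]
  constructor <;> intro h <;> linarith

theorem act_eq (g : Matrix (Idx n) (Idx n) ℝ) (x : E n) {p q : ℝ} {u : E n}
    (h : g *ᵥ coneLift x = lc p u q) (hp : p ≠ 0) (hpq : p + q ≠ 0) : act g x = p⁻¹ • u := by
  rw [act, sphereAct_kappa g x h]
  ext i
  have : 1 + (p - q) / (p + q) ≠ 0 := by
    rw [show 1 + (p - q) / (p + q) = 2 * p / (p + q) by field_simp; ring]
    positivity
  simp only [stereo, Sum.elim_inl, Sum.elim_inr, PiLp.smul_apply, smul_eq_mul]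
  rw [show 1 + (p - q) / (p + q) = 2 * p / (p + q) by field_simp; ring]
  field_simp

theorem lform_coneLift (x : E n) : lform (coneLift x) (coneLift x) = 0 := by
  rw [coneLift, lform_lc]
  ring

theorem IsLorentz.coneLift_null {g : Matrix (Idx n) (Idx n) ℝ} (hg : IsLorentz g) {x : E n}
    {p q : ℝ} {u : E n} (h : g *ᵥ coneLift x = lc p u q) : p * q = inner ℝ u u := by
  have := hg.lform (coneLift x) (coneLift x)
  rw [h, lform_lc, lform_coneLift] at this
  linarith

/-- The image is null, so p q = |u|² ≥ 0. If p + q = 0 then p, q and u all vanish, contradicting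
invertibility of g. -/
theorem IsLorentz.coneLift_ne {g : Matrix (Idx n) (Idx n) ℝ} (hg : IsLorentz g) {x : E n}
    {p q : ℝ} {u : E n} (h : g *ᵥ coneLift x = lc p u q) : p + q ≠ 0 := by
  intro h0
  have h1 := hg.coneLift_null h
  have h2 : 0 ≤ inner ℝ u u := real_inner_self_nonneg
  have hq : q = -p := by linarith
  have h3 : p = 0 := by
    subst hq
    nlinarith
  have h4 : u = 0 := by
    rw [← inner_self_eq_zero (𝕜 := ℝ), ← h1, h3, zero_mul]
  have h5 : g *ᵥ coneLift x = 0 := by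
    rw [h, hq, h3, h4]
    funext a
    rcases a with ⟨⟩ | i | ⟨⟩ <;> simp [lc]
  have h6 : coneLift x = 0 := by
    have := congrArg (fun v => g⁻¹ *ᵥ v) h5
    simpa [Matrix.mulVec_mulVec, Matrix.nonsing_inv_mul g hg.isUnit_det] using this
  have h7 := congrFun h6 (Sum.inl ())
  have h8 : 0 ≤ inner ℝ x x := real_inner_self_nonneg
  simp only [coneLift, lc, Sum.elim_inl, Pi.zero_apply] at h7
  linarith

/-- The inverse of an element of `G` preserves the future light cone. -/
theorem future_of_mem_G {g : Matrix (Idx n) (Idx n) ℝ} (hg : g ∈ G n) {x : E n}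
    {p q : ℝ} {u : E n} (h : g⁻¹ *ᵥ coneLift x = lc p u q) : 0 < p + q := by
  -- The inverse is replaced by J gᵀ J, which is continuous on all matrices, so that the sign
  -- argument on the connected set G applies.
  have key : 0 < ((lorentz n * gᵀ * lorentz n) *ᵥ coneLift x) (Sum.inl ()) := by
    refine pos_of_mem_G
      (f := fun g => ((lorentz n * gᵀ * lorentz n) *ᵥ coneLift x) (Sum.inl ())) ?_ ?_ ?_ hg
    · have : Continuous fun g : Matrix (Idx n) (Idx n) ℝ =>
          (lorentz n * gᵀ * lorentz n) *ᵥ coneLift x := by fun_prop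
      exact (continuous_apply (Sum.inl () : Idx n)).comp this
    · intro g' hg'
      obtain ⟨p', u', q', h'⟩ := exists_eq_lc ((lorentz n * g'ᵀ * lorentz n) *ᵥ coneLift x)
      have := hg'.inv.coneLift_ne (x := x) (p := p') (u := u') (q := q') (by rw [hg'.inv_eq, h'])
      simpa [h', lc] using this
    · rw [Matrix.transpose_one, mul_one, lorentz_mul_self, Matrix.one_mulVec]
      have h8 : 0 ≤ inner ℝ x x := real_inner_self_nonneg
      simp only [coneLift, lc, Sum.elim_inl]
      linarith
  rw [← (isLorentz_of_mem_G hg).inv_eq, h] at key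
  simpa [lc] using key

theorem det_matM (m : Matrix (Fin n) (Fin n) ℝ) :
    (Matrix.fromBlocks 1 0 0 (Matrix.fromBlocks m 0 0 1) : Matrix (Idx n) (Idx n) ℝ).det =
      m.det := by
  rw [Matrix.det_fromBlocks_zero₂₁, Matrix.det_fromBlocks_zero₂₁]
  simp

/-- A Lorentz transformation of determinant one fixing both null axes belongs to `M`. -/
theorem exists_eq_matM {k : Matrix (Idx n) (Idx n) ℝ} (hk : IsLorentz k) (hdet : k.det = 1)
    (h1 : k *ᵥ lc 1 0 0 = lc 1 0 0) (h2 : k *ᵥ lc 0 0 1 = lc 0 0 1) : ∃ m : SO n, k = matM m := by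
  -- Fixing both null axes, k preserves their Lorentz orthogonal complement, the copy of ℝⁿ.
  have h3 : ∀ u, ∃ w, k *ᵥ lc 0 u 0 = lc 0 w 0 := by
    intro u
    obtain ⟨p, w, q, hw⟩ := exists_eq_lc (k *ᵥ lc 0 u 0)
    have e1 := hk.lform (lc 0 u 0) (lc 1 0 0)
    have e2 := hk.lform (lc 0 u 0) (lc 0 0 1)
    rw [h1, hw, lform_lc, lform_lc] at e1
    rw [h2, hw, lform_lc, lform_lc] at e2
    simp only [inner_zero_right, mul_zero, mul_one, zero_add, add_zero, sub_zero] at e1 e2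
    have hp : p = 0 := by linarith
    have hq : q = 0 := by linarith
    exact ⟨w, by rw [hw, hp, hq]⟩
  choose w hw using h3
  have hw' : ∀ u i, w u i = ∑ j, (k (Sum.inr (Sum.inl i)) (Sum.inr (Sum.inl j))) * u j := by
    intro u i
    have := congrFun (hw u) (Sum.inr (Sum.inl i))
    simp only [lc, Matrix.mulVec, dotProduct, Fintype.sum_sum_type, Sum.elim_inl, Sum.elim_inr,
      add_zero, sub_zero, mul_zero, Finset.sum_const_zero, zero_add, mul_left_comm,
      ← Finset.mul_sum] at this
    linarith
  set m : Matrix (Fin n) (Fin n) ℝ :=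
    Matrix.of fun i j => k (Sum.inr (Sum.inl i)) (Sum.inr (Sum.inl j)) with hm
  have hwm : ∀ u, w u = matMap m u := fun u => by
    ext i
    rw [hw', matMap_apply]
    rfl
  have hkm : k = Matrix.fromBlocks 1 0 0 (Matrix.fromBlocks m 0 0 1) := by
    refine matrix_ext_lc fun p u q => ?_
    rw [fromBlocks_mulVec, ← hwm]
    have : lc p u q = p • lc 1 0 0 + lc 0 u 0 + q • lc 0 0 1 := by
      simp [smul_lc, lc_add]
    rw [this, Matrix.mulVec_add, Matrix.mulVec_add, Matrix.mulVec_smul, Matrix.mulVec_smul, h1, h2,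
      hw]
    simp [smul_lc, lc_add]
  have hdm : m.det = 1 := by rw [← det_matM, ← hkm, hdet]
  have hinner : ∀ u v : E n, inner ℝ (matMap m u) (matMap m v) = inner ℝ u v := by
    intro u v
    have := hk.lform (lc 0 u 0) (lc 0 v 0)
    rw [hw, hw, lform_lc, lform_lc, hwm, hwm] at this
    linarith
  have horth : mᵀ * m = 1 := by
    ext i j
    have := hinner (e i) (e j)
    rw [inner_e_right, e_apply, inner_eq_sum] at this
    simp only [matMap_apply, e_apply, mul_ite, mul_one, mul_zero, Finset.sum_ite_eq',
      Finset.mem_univ, if_true] at this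
    rw [Matrix.mul_apply, Matrix.one_apply]
    simp only [Matrix.transpose_apply, this, eq_comm]
  exact ⟨⟨m, Matrix.mem_specialOrthogonalGroup_iff.mpr
    ⟨(Matrix.mem_orthogonalGroup_iff' (Fin n) ℝ).mpr horth, hdm⟩⟩, hkm⟩

theorem matM_mul_matA (m : SO n) (t : ℝ) : matM m * matA t = matA t * matM m :=
  matrix_ext_lc fun p u q => by
    rw [← Matrix.mulVec_mulVec, ← Matrix.mulVec_mulVec]
    simp only [matA_mulVec, matM_mulVec]

theorem coneLift_zero : coneLift (0 : E n) = lc 1 0 0 := by simp [coneLift]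

/-- Decomposition in `N̄MAN`. -/
theorem exists_decomposition {h : Matrix (Idx n) (Idx n) ℝ} (hh : IsLorentz h) (hdet : h.det = 1)
    {p q : ℝ} {u : E n} (hp : 0 < p) (hX : h *ᵥ lc 1 0 0 = lc p u q) :
    ∃ (y : E n) (m : SO n) (t : ℝ) (z : E n), h = matNbar y * matM m * matA t * matN z := by
  have hnull : p * q = inner ℝ u u := hh.coneLift_null (x := 0) (by rw [coneLift_zero, hX])
  -- A product n̄_y m a_t n_z sends the base vector to e^t (1, y, |y|²), so y and t are read off
  -- from its image under h.
  set t := Real.log p with ht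
  set y : E n := p⁻¹ • u with hy
  have hexp : Real.exp t = p := Real.exp_log hp
  set k := h⁻¹ * (matNbar y * matA t) with hk
  have hkL : IsLorentz k := hh.inv.mul ((isLorentz_matNbar y).mul (isLorentz_matA t))
  have hkd : k.det = 1 := by
    rw [hk, Matrix.det_mul, Matrix.det_mul, det_matNbar, det_matA, Matrix.det_nonsing_inv, hdet]
    simp
  have hhu := hh.isUnit_det
  have hk1 : k *ᵥ lc 1 0 0 = lc 1 0 0 := by
    have h1 : (matNbar y * matA t) *ᵥ lc 1 0 0 = h *ᵥ lc 1 0 0 := by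
      rw [← Matrix.mulVec_mulVec, matA_mulVec, matNbar_mulVec, hX, hexp]
      simp only [hy, mul_one, smul_smul, mul_inv_cancel₀ hp.ne', one_smul, inner_zero_right,
        mul_zero, inner_smul_left, inner_smul_right, conj_trivial, ← hnull, zero_add]
      congr 1
      field_simp
    rw [hk, ← Matrix.mulVec_mulVec, h1, Matrix.mulVec_mulVec, Matrix.nonsing_inv_mul h hhu,
      Matrix.one_mulVec]
  -- The matrix k fixes the base vector and, being an isometry, must send Y to (|z|², z, 1).
  -- Multiplying by n_{-z} makes it fix both null axes, which leaves an element of M.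
  obtain ⟨p', z, q', hk2⟩ := exists_eq_lc (k *ᵥ lc 0 0 1)
  have e1 := hkL.lform (lc 0 0 1) (lc 1 0 0)
  have e2 := hkL.lform (lc 0 0 1) (lc 0 0 1)
  rw [hk1, hk2, lform_lc, lform_lc] at e1
  rw [hk2, lform_lc, lform_lc] at e2
  simp only [inner_zero_right, mul_zero, mul_one, zero_add, add_zero, sub_zero] at e1 e2
  have hq' : q' = 1 := by linarith
  have hp' : p' = inner ℝ z z := by rw [hq'] at e2; linarith
  obtain ⟨m, hm⟩ := exists_eq_matM (k := matN (-z) * k) ((isLorentz_matN _).mul hkL)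
    (by rw [Matrix.det_mul, det_matN, hkd, mul_one])
    (by rw [← Matrix.mulVec_mulVec, hk1, matN_mulVec]; simp)
    (by
      rw [← Matrix.mulVec_mulVec, hk2, matN_mulVec, hq', hp']
      simp
      ring_nf)
  refine ⟨y, m⁻¹, t, -z, ?_⟩
  have hmm : matM m⁻¹ * matM m = 1 := matrix_ext_lc fun p u q => by
    rw [← Matrix.mulVec_mulVec, Matrix.one_mulVec, matM_mulVec, matM_mulVec]
    congr 1
    have : matMap ((m⁻¹ : SO n) : Matrix (Fin n) (Fin n) ℝ) * matMap (m : Matrix (Fin n) (Fin n) ℝ) = 1 := by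
      rw [matMap, matMap, ← map_mul, ← Submonoid.coe_mul, inv_mul_cancel, OneMemClass.coe_one,
        map_one]
    exact congrArg (fun L => L u) this
  calc h = h * (k * k⁻¹) := by
        rw [Matrix.mul_nonsing_inv k hkL.isUnit_det, mul_one]
    _ = (h * h⁻¹) * (matNbar y * matA t) * k⁻¹ := by rw [hk]; simp only [mul_assoc]
    _ = matNbar y * matA t * k⁻¹ := by rw [Matrix.mul_nonsing_inv h hhu, one_mul]
    _ = matNbar y * matA t * (matM m⁻¹ * matM m) * k⁻¹ := by rw [hmm, mul_one]
    _ = matNbar y * matA t * matM m⁻¹ * matN (-z) * (k * k⁻¹) := by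
        rw [← hm]; simp only [mul_assoc]
    _ = matNbar y * (matA t * matM m⁻¹) * matN (-z) := by
        rw [Matrix.mul_nonsing_inv k hkL.isUnit_det, mul_one, mul_assoc (matNbar y)]
    _ = matNbar y * matM m⁻¹ * matA t * matN (-z) := by
        rw [← matM_mul_matA]; simp only [mul_assoc]

/-- Near a point where it is defined, the action of `g⁻¹` is given by the decomposition of
`g⁻¹ n̄_x`. -/
theorem act_inv_of_decomposition {g : Matrix (Idx n) (Idx n) ℝ} {x₀ y z : E n} {m : SO n} {t : ℝ}
    (h : g⁻¹ * matNbar x₀ = matNbar y * matM m * matA t * matN z) {x : E n}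
    (hx : 0 < moebQ z (x - x₀)) :
    act g⁻¹ x = y + Real.exp (-t) • matMap (m : Matrix _ _ ℝ) (moeb z (x - x₀)) := by
  have h1 : g⁻¹ *ᵥ coneLift x = lc (Real.exp t * moebQ z (x - x₀))
      (matMap (m : Matrix _ _ ℝ) ((x - x₀) + inner ℝ (x - x₀) (x - x₀) • z)
        + (Real.exp t * moebQ z (x - x₀)) • y)
      (Real.exp (-t) * inner ℝ (x - x₀) (x - x₀) + 2 * inner ℝ y
        (matMap (m : Matrix _ _ ℝ) ((x - x₀) + inner ℝ (x - x₀) (x - x₀) • z))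
        + inner ℝ y y * (Real.exp t * moebQ z (x - x₀))) := by
    have : coneLift x = matNbar x₀ *ᵥ coneLift (x - x₀) := by
      rw [matNbar_mulVec_coneLift, add_sub_cancel]
    rw [this, Matrix.mulVec_mulVec, h, ← Matrix.mulVec_mulVec, ← Matrix.mulVec_mulVec,
      ← Matrix.mulVec_mulVec, coneLift, matN_mulVec, matA_mulVec, matM_mulVec, matNbar_mulVec]
    rfl
  have hpos : 0 < Real.exp t * moebQ z (x - x₀) := by positivity
  have hnull : ∀ p u q, g⁻¹ *ᵥ coneLift x = lc p u q → p * q = inner ℝ u u := by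
    intro p u q hpq
    have hL : IsLorentz (g⁻¹ * matNbar x₀) := by
      rw [h]
      exact (((isLorentz_matNbar y).mul (isLorentz_matM m)).mul (isLorentz_matA t)).mul
        (isLorentz_matN z)
    refine hL.coneLift_null (x := x - x₀) ?_
    rw [← Matrix.mulVec_mulVec, matNbar_mulVec_coneLift, add_sub_cancel, hpq]
  rw [act_eq _ _ h1 hpos.ne', moeb, smul_add, smul_smul, inv_mul_cancel₀ hpos.ne', one_smul,
    add_comm, map_smul, smul_smul, mul_inv, Real.exp_neg]
  -- The image is null with p > 0, so q ≥ 0 and p + q ≠ 0, which is the remaining condition of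
  -- `act_eq`.
  have h2 := hnull _ _ _ h1
  have h3 : 0 ≤ (Real.exp t * moebQ z (x - x₀)) * (Real.exp (-t) * inner ℝ (x - x₀) (x - x₀)
      + 2 * inner ℝ y (matMap (m : Matrix _ _ ℝ) ((x - x₀) + inner ℝ (x - x₀) (x - x₀) • z))
        + inner ℝ y y * (Real.exp t * moebQ z (x - x₀))) := by
    rw [h2]; exact real_inner_self_nonneg
  have h4 := nonneg_of_mul_nonneg_right h3 hpos
  positivity

/-- Since p + q > 0 (future cone), p q ≥ 0 (null) and p ≠ 0 (g⁻¹ is defined at x), p is positive and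
a decomposition exists. The choice made in `bruhat` is then a decomposition, and uniqueness plays no
role. -/
theorem bruhat_spec {g : Matrix (Idx n) (Idx n) ℝ} (hg : g ∈ G n) {x : E n}
    (hx : DefinedAt g⁻¹ x) : ∃ y z : E n, g⁻¹ * matNbar x =
      matNbar y * matM (mPart (g⁻¹ * matNbar x)) * matA (tPart (g⁻¹ * matNbar x)) * matN z := by
  obtain ⟨p, u, q, h⟩ := exists_eq_lc (g⁻¹ *ᵥ coneLift x)
  have hL := isLorentz_of_mem_G hg
  have hfut := future_of_mem_G hg h
  have hp0 := (definedAt_iff _ _ h hfut.ne').mp hx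
  have hnull := hL.inv.coneLift_null h
  have hp : 0 < p := by
    have h2 : 0 ≤ inner ℝ u u := real_inner_self_nonneg
    rcases lt_or_gt_of_ne hp0 with h3 | h3
    · nlinarith
    · exact h3
  obtain ⟨y, m, t, z, hd⟩ := exists_decomposition (h := g⁻¹ * matNbar x)
    (hL.inv.mul (isLorentz_matNbar x))
    (by rw [Matrix.det_mul, det_matNbar, Matrix.det_nonsing_inv, det_of_mem_G hg]; simp) hp
    (by rw [← coneLift_zero, ← Matrix.mulVec_mulVec, matNbar_mulVec_coneLift, add_zero, h])
  have := Classical.epsilon_spec (p := fun p : E n × SO n × ℝ × E n => g⁻¹ * matNbar x =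
    matNbar p.1 * matM p.2.1 * matA p.2.2.1 * matN p.2.2.2) ⟨(y, m, t, z), hd⟩
  exact ⟨_, _, this⟩

end LorentzGroup

/-! ### Equivariance of index contractions under rotations -/

section Rotation

variable {n : ℕ} {F : Type*} [AddCommGroup F] [Module ℂ F] {N : Fin n → Fin n → Module.End ℂ F}
  {R : Module.End ℂ F} {M : Fin n → Fin n → ℂ}

theorem orthogonal_contract (hM : ∀ q r, ∑ m, M q m * M r m = if q = r then 1 else 0)
    (r : Fin n) (x : Fin n → F) : ∑ m, M r m • ∑ q, M q m • x q = x r := by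
  simp only [Finset.smul_sum, smul_smul]
  rw [Finset.sum_comm]
  simp only [← Finset.sum_smul, hM, ite_smul, one_smul, zero_smul, Finset.sum_ite_eq,
    Finset.mem_univ, if_true]

variable (hM : ∀ q r, ∑ m, M q m * M r m = if q = r then 1 else 0)
  (hNR : ∀ i j T, N i j (R T) = ∑ p, M p i • ∑ q, M q j • R (N p q T))

include hM hNR

/-- If R intertwines N with its rotated copy, a contraction of N with a rotated family is the
rotated contraction: the summed index meets two rows of M, which are orthonormal. -/
theorem sum_rotate_right (j : Fin n) (f : Fin n → F) :
    ∑ m, N j m (∑ p, M p m • R (f p)) = ∑ p, M p j • R (∑ q, N p q (f q)) := by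
  have h : ∀ m, N j m (∑ p, M p m • R (f p)) =
      ∑ r, M r m • ∑ q, M q m • ∑ p, M p j • R (N p q (f r)) := by
    intro m
    simp only [map_sum, map_smul, hNR]
    refine Finset.sum_congr rfl fun r _ => congrArg _ ?_
    simp only [Finset.smul_sum]
    rw [Finset.sum_comm]
    exact Finset.sum_congr rfl fun p _ => Finset.sum_congr rfl fun q _ => smul_comm _ _ _
  simp only [h]
  rw [Finset.sum_comm]
  simp only [orthogonal_contract hM]
  simp only [map_sum, Finset.smul_sum]
  rw [Finset.sum_comm]

theorem sum_rotate_left (j : Fin n) (f : Fin n → F) :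
    ∑ m, N m j (∑ p, M p m • R (f p)) = ∑ q, M q j • R (∑ p, N p q (f p)) := by
  simp only [map_sum, map_smul, hNR]
  rw [Finset.sum_comm]
  simp only [orthogonal_contract hM]
  simp only [Finset.smul_sum]
  rw [Finset.sum_comm]

theorem sum_rotate_both (g : Fin n → Fin n → F) :
    ∑ i, ∑ j, N i j (∑ p, M p j • ∑ q, M q i • R (g q p)) = R (∑ i, ∑ j, N i j (g i j)) := by
  have h : ∀ i, ∑ j, N i j (∑ p, M p j • ∑ q, M q i • R (g q p)) =
      ∑ p, M p i • R (∑ q, N p q (∑ r, M r i • g r q)) := by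
    intro i
    rw [← sum_rotate_right hM hNR]
    simp only [map_sum, map_smul]
  simp only [h]
  have h2 : ∀ i p, R (∑ q, N p q (∑ r, M r i • g r q)) = ∑ r, M r i • R (∑ q, N p q (g r q)) := by
    intro i p
    simp only [map_sum, map_smul, Finset.smul_sum]
    rw [Finset.sum_comm]
  simp only [h2]
  rw [Finset.sum_comm]
  simp only [orthogonal_contract hM, map_sum]

omit hM hNR in
theorem sum_smul_comb (f : Fin n → ℂ) (a α β γ : ℂ) (X Y Z : Fin n → F) :
    ∑ p, f p • a • (α • X p - β • Y p + γ • Z p) =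
      a • (α • ∑ p, f p • X p - β • ∑ p, f p • Y p + γ • ∑ p, f p • Z p) := by
  simp only [Finset.smul_sum, ← Finset.sum_sub_distrib, ← Finset.sum_add_distrib]
  exact Finset.sum_congr rfl fun p _ => by module

end Rotation

/-! ### Transformation of □ and ∇ under a conformal map -/

section Covariance

open Filter Topology

variable {n k : ℕ} {V : Type*} [NormedAddCommGroup V] [NormedSpace ℝ V]
  [NormedSpace ℂ V] [SMulCommClass ℝ ℂ V]

theorem derivAct_comp (T : E n [⋀^Fin k]→L[ℝ] V) (A W W' : E n →L[ℝ] E n)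
    (h : A ∘L W = W' ∘L A) :
    derivAct W (T.compContinuousLinearMap A) = (derivAct W' T).compContinuousLinearMap A := by
  ext v
  rw [derivAct_apply, ContinuousAlternatingMap.compContinuousLinearMap_apply, derivAct_apply]
  refine Finset.sum_congr rfl fun a _ => congrArg T (funext fun j => ?_)
  by_cases hj : j = a
  · subst hj
    simpa using congrArg (fun L => L (v j)) h
  · simp [Function.update_of_ne hj]

/-- The pullback of forms by an endomorphism, times a scalar. -/
def scaledPull (κ : ℂ) (A : E n →L[ℝ] E n) : Module.End ℂ (E n [⋀^Fin k]→L[ℝ] V) where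
  toFun T := κ • T.compContinuousLinearMap A
  map_add' S T := smul_add κ (S.compContinuousLinearMap A) (T.compContinuousLinearMap A)
  map_smul' c T := smul_comm κ c (T.compContinuousLinearMap A)

variable [IsScalarTower ℝ ℂ V]

/-- Carrying the rank one map v ↦ v_i e_j through an orthogonal matrix m gives ∑ m_pi m_qj (v ↦ v_p
e_q), and the dilation c commutes with everything. -/
theorem opN_scaledPull (κ : ℂ) (c : ℝ) {m : Matrix (Fin n) (Fin n) ℝ} (hm : mᵀ * m = 1)
    (i j : Fin n) (T : E n [⋀^Fin k]→L[ℝ] V) :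
    opN i j (scaledPull κ (c • matMap m) T) =
      ∑ p, (m p i : ℂ) • ∑ q, (m q j : ℂ) • scaledPull κ (c • matMap m) (opN p q T) := by
  have h : (c • matMap m) ∘L unitMap i j =
      (∑ p, ∑ q, (m p i * m q j) • unitMap p q) ∘L (c • matMap m) := by
    ext v r
    have h1 : ∑ p, m p i * (matMap m v) p = v i := by
      have := congrFun (congrArg (fun A => A *ᵥ (v : Fin n → ℝ)) hm) i
      rw [← Matrix.mulVec_mulVec, Matrix.one_mulVec] at this
      exact this
    have h2 : ∀ p q, (unitMap p q (matMap m v) : E n) r = if r = q then matMap m v p else 0 := by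
      intro p q
      rw [unitMap_apply, PiLp.smul_apply, e_apply, smul_eq_mul, mul_ite, mul_one, mul_zero]
    have h0 : (matMap m (unitMap i j v) : E n) r = v i * m r j := by
      rw [unitMap_apply, map_smul, PiLp.smul_apply, matMap_apply, smul_eq_mul]
      simp [e_apply]
    simp only [ContinuousLinearMap.comp_apply, _root_.smul_apply, _root_.sum_apply, map_smul,
      WithLp.ofLp_smul, WithLp.ofLp_sum, Pi.smul_apply, Finset.sum_apply, h2, h0, smul_eq_mul,
      mul_ite, mul_zero, Finset.sum_ite_eq, Finset.mem_univ, if_true]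
    rw [← h1]
    simp only [Finset.sum_mul, Finset.mul_sum]
    exact Finset.sum_congr rfl fun p _ => by ring
  have h3 : opN i j (scaledPull κ (c • matMap m) T) =
      κ • derivAct (unitMap i j) (T.compContinuousLinearMap (c • matMap m)) :=
    map_smul (opN i j) κ (T.compContinuousLinearMap (c • matMap m))
  have h4 : ∀ S : E n [⋀^Fin k]→L[ℝ] V, S.compContinuousLinearMap (c • matMap m) =
      ContinuousAlternatingMap.compContinuousLinearMapCLM (c • matMap m) S := fun S => rfl
  have h5 : ∀ S : E n [⋀^Fin k]→L[ℝ] V, scaledPull κ (c • matMap m) S =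
      κ • ContinuousAlternatingMap.compContinuousLinearMapCLM (c • matMap m) S := fun S => rfl
  rw [h3, derivAct_comp T _ _ _ h, derivAct_sum, h4]
  simp only [derivAct_sum, derivAct_smul, map_sum, map_smul, Finset.smul_sum, h5, opN_apply]
  refine Finset.sum_congr rfl fun p _ => Finset.sum_congr rfl fun q _ => ?_
  rw [← ofReal_smul', Complex.ofReal_mul]
  module

/-- The coefficient of the zeroth order terms. -/
def coefC (n k : ℕ) (s : ℂ) : ℂ := (s - 2) * (s - n - 2) * (s - n + 2 * k) * (s + n - 2 * k)

variable {h : E n → E n} {A : E n → E n →L[ℝ] E n} {Ω : E n → ℝ} {b : E n → E n} {x : E n}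

theorem orthogonal_rows {m : Matrix (Fin n) (Fin n) ℝ} (hm : mᵀ * m = 1) (q r : Fin n) :
    ∑ j, (m q j : ℂ) * (m r j : ℂ) = if q = r then 1 else 0 := by
  have h1 : m * mᵀ = 1 := mul_eq_one_comm.mp hm
  have h2 := congrFun (congrFun h1 q) r
  rw [Matrix.mul_apply, Matrix.one_apply] at h2
  simp only [Matrix.transpose_apply] at h2
  have h3 := congrArg (fun a : ℝ => (a : ℂ)) h2
  push_cast at h3
  rw [h3]
  simp [apply_ite]

/-- The transformation of `∇_{k,s,j}` and `□_{k,s}` under a conformal map. -/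
theorem conformal_transform (H : ∀ᶠ y in 𝓝 x, IsConformalAt h A Ω b y) (lam : ℂ)
    {φ : Form n k V} (hφ : ContDiff ℝ ∞ φ) {c : ℝ} {m : Matrix (Fin n) (Fin n) ℝ}
    (hm : mᵀ * m = 1) (hA : A x = c • matMap m) :
    let s : ℂ := n - 2 * (lam + k)
    let ψ := confPull lam h A Ω φ
    let R : Module.End ℂ (E n [⋀^Fin k]→L[ℝ] V) := scaledPull ((Ω x : ℂ) ^ lam) (A x)
    TwiceDiffAt ψ x ∧
    (∀ j, nabla s j ψ x = (c : ℂ) • ∑ p, (m p j : ℂ) • R (nabla s p φ (h x))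
      + (coefC n k s / 2 * cvec (b x) j) • R (φ (h x))) ∧
    box s ψ x = ((c : ℂ) ^ 2) • R (box s φ (h x))
      - ∑ j, cvec (b x) j • (c : ℂ) • ∑ p, (m p j : ℂ) • R (nabla s p φ (h x))
      - (coefC n k s / 4 * ∑ j, cvec (b x) j * cvec (b x) j) • R (φ (h x)) := by
  intro s ψ R
  obtain ⟨h1, h2, h3⟩ := confPull_jets H lam hφ
  have hpd : ∀ p, ContDiff ℝ ∞ (pd p φ) := fun p =>
    (hφ.fderiv_right (m := ∞) (by norm_cast)).clm_apply contDiff_const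
  have hφ2 : TwiceDiffAt φ (h x) := hφ.contDiffAt.twiceDiffAt
  have hR : ∀ χ : Form n k V, confPull lam h A Ω χ x = R (χ (h x)) := fun χ => rfl
  have hAe : ∀ j p, (A x (e j)) p = c * m p j := by
    intro j p
    rw [hA, _root_.smul_apply, PiLp.smul_apply, matMap_apply, smul_eq_mul]
    simp [e_apply]
  have hM := orthogonal_rows hm
  have hNR : ∀ i j T, opN i j (R T) = ∑ p, (m p i : ℂ) • ∑ q, (m q j : ℂ) • R (opN p q T) := by
    intro i j T
    simp only [R, hA]
    exact opN_scaledPull _ c hm i j T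
  simp only [hR, hAe, ← ofReal_smul', Complex.ofReal_mul, mul_smul, ← Finset.smul_sum] at h2 h3
  simp only [smul_comm _ (c : ℂ), ← Finset.smul_sum] at h3
  set φ₁ : Fin n → E n [⋀^Fin k]→L[ℝ] V := fun j =>
    (c : ℂ) • ∑ p, (m p j : ℂ) • R (pd p φ (h x)) with hφ₁
  set φ₂ : Fin n → Fin n → E n [⋀^Fin k]→L[ℝ] V := fun i j =>
    (c : ℂ) • (c : ℂ) • ∑ p, (m p j : ℂ) • ∑ q, (m q i : ℂ) • R (pd q (pd p φ) (h x)) with hφ₂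
  have h3' : ∀ i j, pd2 i j (confPull lam h A Ω φ) x =
      ctrD (fun i j => opN i j) (lam + k) (cvec (b x)) i j (R (φ (h x)))
      + ctrS (fun i j => opN i j) (lam + k) (cvec (b x)) j (φ₁ i)
      + ctrS (fun i j => opN i j) (lam + k) (cvec (b x)) i (φ₁ j)
      + cvec (b x) i • φ₁ j + cvec (b x) j • φ₁ i
      - (if i = j then ∑ m, cvec (b x) m • φ₁ m else 0) + φ₂ i j := by
    intro i j
    rw [h3 i j]
    simp only [hφ₁, hφ₂, smul_comm _ (c : ℂ), ← Finset.smul_sum]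
  have hN := isExteriorGl_opN (n := n) (k := k) (V := V)
  -- The two linear factors of the coefficients of □ and ∇ are the parameters A and B of the jet
  -- identities, with ρ = λ + k and s = n - 2ρ.
  set AA : ℂ := s + n - 2 * k with hAA
  set BB : ℂ := s - n + 2 * k with hBB
  have hA' : AA = 2 * (n - (lam + k) - k) := by simp only [hAA, s]; ring
  have hB' : BB = -2 * ((lam + k) - k) := by simp only [hBB, s]; ring
  have hR' : ∀ p, R (nabla s p φ (h x)) = (2 - s) • (alphaC n k s • R (pd p φ (h x))
      - (2 * BB) • R (∑ q, opN p q (pd q φ (h x))) + (2 * AA) • R (∑ q, opN q p (pd q φ (h x)))) := by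
    intro p
    rw [nabla_eq _ hφ2.differentiableAt, nablaJet]
    simp only [map_smul, map_add, map_sub, AA, BB]
  have hrhs : ∀ j, (2 - s) • (alphaC n k s • φ₁ j - (2 * BB) • ∑ q, opN j q (φ₁ q)
      + (2 * AA) • ∑ q, opN q j (φ₁ q)) =
      (c : ℂ) • ∑ p, (m p j : ℂ) • R (nabla s p φ (h x)) := by
    intro j
    simp only [hφ₁, map_smul, ← Finset.smul_sum, sum_rotate_right hM hNR, sum_rotate_left hM hNR, hR',
      sum_smul_comb]
    module
  have hab : alphaC n k s = AA * (BB - 2) := by simp only [alphaC, AA, BB]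
  have hab' : alphaC n k s - betaC n k s = 2 * BB - 2 * AA := by
    simp only [alphaC, betaC, AA, BB]; ring
  have hco : coefC n k s = 2 * ((2 - s) * ((lam + k) + 1) * AA * BB) := by
    simp only [coefC, AA, BB, s]; ring
  -- This factor, produced by differentiating the pullback twice, is the prefactor 2 - s of ∇: the
  -- first order defect of □ is thus b contracted with ∇ itself.
  have hs : (2 : ℂ) + 2 * (lam + k) - n = 2 - s := by simp only [s]; ring
  refine ⟨h1, fun j => ?_, ?_⟩
  · have key := congrArg (fun L : Module.End ℂ _ => L (R (φ (h x))))
      (hN.nabla_transform (b := cvec (b x)) hA' hB' j)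
    simp only [LinearMap.add_apply, LinearMap.sub_apply, LinearMap.smul_apply, LinearMap.sum_apply,
      Module.End.mul_apply, Module.End.one_apply, ← hab] at key
    rw [nabla_eq _ h1.differentiableAt, nablaJet, ← hrhs, hco]
    simp only [h2, map_add, Finset.sum_add_distrib]
    linear_combination (norm := module) (2 - s) • key
  · have key := hN.box_transform (b := cvec (b x)) hA' hB' (R (φ (h x))) φ₁ φ₂
    simp only [hs, ← hab, ← hab', hrhs] at key
    have h4 : ∀ i j, pd2 i j φ (h x) = pd i (pd j φ) (h x) := pd2_eq_pd_pd hφ2.2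
    have h5 : ∑ i, φ₂ i i = ((c : ℂ) ^ 2) • ∑ i, R (pd i (pd i φ) (h x)) := by
      rw [sq, mul_smul]
      simp only [hφ₂, ← Finset.smul_sum]
      congr 2
      rw [Finset.sum_comm]
      exact Finset.sum_congr rfl fun p _ =>
        orthogonal_contract hM p (fun q => R (pd q (pd p φ) (h x)))
    have h6 : ∑ i, ∑ j, opN i j (φ₂ i j) =
        ((c : ℂ) ^ 2) • R (∑ i, ∑ j, opN i j (pd i (pd j φ) (h x))) := by
      simp only [hφ₂, map_smul, ← Finset.smul_sum]
      rw [sum_rotate_both hM hNR (fun q p => pd q (pd p φ) (h x)), smul_smul, sq]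
    have h7 : box s φ (h x) = boxJet s (fun i j => pd i (pd j φ) (h x)) := by
      rw [box_eq hφ2]; simp only [h4]
    rw [box_eq h1, boxJet]
    simp only [h3']
    refine key.trans ?_
    rw [h5, h6, h7, boxJet, hco, hab']
    simp only [map_add, map_smul, map_sum, smul_comm _ (c : ℂ)]
    module

end Covariance

/-! ### How g moves the frame X, Z_j, Y -/

section Frames

variable {n : ℕ}

/-- The derivative of `coneLift` in the direction `e_j`. -/
def tangentLift (x : E n) (j : Fin n) : Idx n → ℝ := lc 0 (e j) (2 * x j)

theorem sum_lc {ι : Type*} (s : Finset ι) (p : ι → ℝ) (u : ι → E n) (q : ι → ℝ) :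
    ∑ i ∈ s, lc (p i) (u i) (q i) = lc (∑ i ∈ s, p i) (∑ i ∈ s, u i) (∑ i ∈ s, q i) := by
  funext a
  rcases a with ⟨⟩ | i | ⟨⟩ <;>
    simp [lc, Finset.sum_add_distrib, Finset.sum_sub_distrib, Finset.mul_sum]

theorem matNbar_mulVec_tangent (x v : E n) (r : ℝ) : matNbar x *ᵥ lc r v 0 =
    r • coneLift x + ∑ j, v j • tangentLift x j := by
  simp only [tangentLift, smul_lc, sum_lc, coneLift, lc_add, matNbar_mulVec, mul_zero,
    Finset.sum_const_zero, sum_smul_e, inner_eq_sum x v]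
  congr 1
  · ring
  · module
  · rw [Finset.mul_sum, zero_add, add_comm]
    congr 1
    · ring
    · exact Finset.sum_congr rfl fun j _ => by ring

theorem matNbar_mulVec_infinity (x : E n) : matNbar x *ᵥ lc 0 0 1 = lc 0 0 1 := by
  rw [matNbar_mulVec]; simp

variable {g : Matrix (Idx n) (Idx n) ℝ} {x₀ y z : E n} {m : SO n} {t : ℝ}

theorem mulVec_frame (hg : IsLorentz g)
    (h : g⁻¹ * matNbar x₀ = matNbar y * matM m * matA t * matN z) (p : ℝ) (u : E n) (q : ℝ) :
    g *ᵥ (matNbar y *ᵥ lc (Real.exp t * (p + 2 * inner ℝ z u + inner ℝ z z * q))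
      (matMap (m : Matrix _ _ ℝ) (u + q • z)) (Real.exp (-t) * q)) = matNbar x₀ *ᵥ lc p u q := by
  have h1 : matNbar x₀ = g * (matNbar y * matM m * matA t * matN z) := by
    rw [← h, ← mul_assoc, Matrix.mul_nonsing_inv g hg.isUnit_det, one_mul]
  rw [h1, ← Matrix.mulVec_mulVec, ← Matrix.mulVec_mulVec, ← Matrix.mulVec_mulVec,
    ← Matrix.mulVec_mulVec, matN_mulVec, matA_mulVec, matM_mulVec]

theorem mulVec_coneLift (hg : IsLorentz g)
    (h : g⁻¹ * matNbar x₀ = matNbar y * matM m * matA t * matN z) :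
    g *ᵥ coneLift y = Real.exp (-t) • coneLift x₀ := by
  have := mulVec_frame hg h (Real.exp (-t)) 0 0
  rw [mul_zero (Real.exp (-t)), matNbar_mulVec_tangent, matNbar_mulVec_tangent] at this
  simpa [← Real.exp_add] using this

/-- The vector -2z is the value at x₀ of the logarithmic gradient `moebB`; it enters because n_z
fixes X only and adds multiples of X to the tangent vectors. -/
theorem mulVec_tangentLift (hg : IsLorentz g)
    (h : g⁻¹ * matNbar x₀ = matNbar y * matM m * matA t * matN z) (p : Fin n) :
    g *ᵥ tangentLift y p = ∑ j, (m : Matrix (Fin n) (Fin n) ℝ) p j •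
      (tangentLift x₀ j + ((-2 : ℝ) • z) j • coneLift x₀) := by
  have hm := mul_eq_one_comm.mp (SO.transpose_mul m)
  set v : E n := ∑ j, (m : Matrix (Fin n) (Fin n) ℝ) p j • e j with hv
  have hvj : ∀ j, v j = (m : Matrix (Fin n) (Fin n) ℝ) p j := by
    intro j
    rw [hv]
    simp [e_apply]
  have hmv : matMap (m : Matrix (Fin n) (Fin n) ℝ) v = e p := by
    ext i
    rw [matMap_apply, e_apply]
    simp only [hvj]
    have := congrFun (congrFun hm i) p
    rw [Matrix.mul_apply, Matrix.one_apply] at this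
    simpa using this
  -- The first coordinate is chosen so that n_z maps it to 0, and v is the row p of m, so that m v =
  -- e_p.
  have := mulVec_frame hg h (-2 * inner ℝ z v) v 0
  rw [mul_zero (Real.exp (-t)), matNbar_mulVec_tangent, matNbar_mulVec_tangent, zero_smul, add_zero, hmv, inner_eq_sum] at this
  have h0 : Real.exp t * (-2 * ∑ j, z j * v j + 2 * ∑ j, z j * v j + inner ℝ z z * 0) = 0 := by ring
  rw [h0, zero_smul, zero_add] at this
  simp only [e_apply, ite_smul, one_smul, zero_smul, Finset.sum_ite_eq', Finset.mem_univ, if_true,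
    hvj] at this
  rw [this, add_comm, Finset.mul_sum, Finset.sum_smul, ← Finset.sum_add_distrib]
  refine Finset.sum_congr rfl fun j _ => ?_
  rw [PiLp.smul_apply, smul_eq_mul]
  module

theorem mulVec_infinity (hg : IsLorentz g)
    (h : g⁻¹ * matNbar x₀ = matNbar y * matM m * matA t * matN z) :
    Real.exp (-t) • (g *ᵥ lc 0 0 1) = lc 0 0 1 + (1 / 2 : ℝ) • ∑ j, ((-2 : ℝ) • z) j • tangentLift x₀ j
      + (1 / 4 * ∑ j, ((-2 : ℝ) • z) j * ((-2 : ℝ) • z) j) • coneLift x₀ := by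
  -- The vector (|z|², -z, 1) is the one that n_z maps to (0, 0, 1).
  have := mulVec_frame hg h (inner ℝ z z) (-z) 1
  have h0 : Real.exp t * (inner ℝ z z + 2 * inner ℝ z (-z) + inner ℝ z z * 1) = 0 := by
    rw [inner_neg_right]; ring
  have h1 : lc (inner ℝ z z) (-z) 1 = lc (inner ℝ z z) (-z) 0 + lc 0 0 1 := by simp [lc_add]
  have h2 : lc 0 (matMap (m : Matrix (Fin n) (Fin n) ℝ) (-z + (1 : ℝ) • z)) (Real.exp (-t) * 1) =
      Real.exp (-t) • lc 0 0 1 := by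
    rw [smul_lc]; simp
  rw [h0, h2, Matrix.mulVec_smul, Matrix.mulVec_smul, matNbar_mulVec_infinity, h1,
    Matrix.mulVec_add, matNbar_mulVec_tangent, matNbar_mulVec_infinity] at this
  rw [this, inner_eq_sum]
  have h3 : (1 / 4 * ∑ j, ((-2 : ℝ) • z) j * ((-2 : ℝ) • z) j) = ∑ j, z j * z j := by
    rw [Finset.mul_sum]
    refine Finset.sum_congr rfl fun j _ => ?_
    rw [PiLp.smul_apply, smul_eq_mul]; ring
  have h4 : (1 / 2 : ℝ) • ∑ j, ((-2 : ℝ) • z) j • tangentLift x₀ j =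
      ∑ j, (-z) j • tangentLift x₀ j := by
    rw [Finset.smul_sum]
    refine Finset.sum_congr rfl fun j _ => ?_
    rw [PiLp.smul_apply, PiLp.neg_apply, smul_eq_mul]
    module
  rw [h3, h4]
  abel

end Frames

/-! ### The action of G as a conformal map; covariance of the operator D -/

section Action

open Filter Topology

variable {n k : ℕ} {V : Type*} [NormedAddCommGroup V] [NormedSpace ℝ V]
  [NormedSpace ℂ V] [SMulCommClass ℝ ℂ V] [IsScalarTower ℝ ℂ V]

theorem IsConformalAt.congr {h h' : E n → E n} {A A' : E n → E n →L[ℝ] E n} {Ω Ω' : E n → ℝ}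
    {b : E n → E n} {x : E n} (H : IsConformalAt h A Ω b x) (h1 : h' =ᶠ[𝓝 x] h) (h2 : A' =ᶠ[𝓝 x] A)
    (h3 : Ω' =ᶠ[𝓝 x] Ω) : IsConformalAt h' A' Ω' b x := by
  obtain ⟨B, hB, hB'⟩ := H.diff
  refine ⟨?_, ⟨B, hB.congr_of_eventuallyEq h2, fun a => ?_⟩, ?_, ?_, H.logGrad⟩
  · rw [h2.eq_of_nhds]; exact H.map.congr_of_eventuallyEq h1
  · rw [h2.eq_of_nhds, hB']
  · rw [h3.eq_of_nhds]; exact H.pos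
  · rw [h3.eq_of_nhds]; exact H.factor.congr_of_eventuallyEq h3

variable {g : Matrix (Idx n) (Idx n) ℝ} {x₀ y z : E n} {m : SO n} {t : ℝ}

theorem fderiv_act_inv (h : g⁻¹ * matNbar x₀ = matNbar y * matM m * matA t * matN z) {x : E n}
    (hx : 0 < moebQ z (x - x₀)) : HasFDerivAt (act g⁻¹)
      (Real.exp (-t) • matMap (m : Matrix _ _ ℝ) ∘L moebA z (x - x₀)) x := by
  have H := (isConformalAt_moeb y z (Real.exp_pos (-t)) (matMap (m : Matrix _ _ ℝ)) hx).map
  refine H.congr_of_eventuallyEq ?_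
  have : ContinuousAt (fun x => moebQ z (x - x₀)) x := by unfold moebQ; fun_prop
  filter_upwards [this.eventually_const_lt hx] with x' hx'
  exact act_inv_of_decomposition h hx'

/-- The differential multiplies all lengths by e^{-t} Q⁻¹, and since ℝⁿ is nonzero this ratio is its
operator norm. -/
theorem Omega_inv (hn : 1 ≤ n) (h : g⁻¹ * matNbar x₀ = matNbar y * matM m * matA t * matN z)
    {x : E n} (hx : 0 < moebQ z (x - x₀)) :
    Omega g⁻¹ x = Real.exp (-t) * (moebQ z (x - x₀))⁻¹ := by
  have : Nonempty (Fin n) := ⟨⟨0, hn⟩⟩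
  rw [Omega, (fderiv_act_inv h hx).fderiv]
  refine ContinuousLinearMap.homothety_norm _ fun v => ?_
  rw [_root_.smul_apply, norm_smul, Real.norm_of_nonneg (Real.exp_pos _).le, mul_assoc]
  congr 1
  rw [ContinuousLinearMap.comp_apply, ← sq_eq_sq₀ (by positivity) (by positivity), mul_pow,
    ← real_inner_self_eq_norm_sq, ← real_inner_self_eq_norm_sq, inner_matMap (SO.transpose_mul m),
    inner_moebA_self hx.ne']

theorem eventually_isConformalAt (hn : 1 ≤ n)
    (h : g⁻¹ * matNbar x₀ = matNbar y * matM m * matA t * matN z) :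
    ∀ᶠ x in 𝓝 x₀, IsConformalAt (act g⁻¹) (fderiv ℝ (act g⁻¹)) (Omega g⁻¹)
      (fun x => moebB z (x - x₀)) x := by
  filter_upwards [(eventually_moebQ_pos z x₀).eventually_nhds, eventually_moebQ_pos z x₀] with x hx hx'
  refine (isConformalAt_moeb y z (Real.exp_pos (-t)) (matMap (m : Matrix _ _ ℝ)) hx').congr ?_ ?_ ?_
  · exact hx.mono fun x' h' => act_inv_of_decomposition h h'
  · exact hx.mono fun x' h' => (fderiv_act_inv h h').fderiv
  · exact hx.mono fun x' h' => Omega_inv hn h h'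

theorem act_inv_center (h : g⁻¹ * matNbar x₀ = matNbar y * matM m * matA t * matN z) :
    act g⁻¹ x₀ = y ∧
    fderiv ℝ (act g⁻¹) x₀ = Real.exp (-t) • matMap (m : Matrix (Fin n) (Fin n) ℝ) := by
  have h0 : 0 < moebQ z (x₀ - x₀) := by rw [sub_self, moebQ_zero]; exact one_pos
  constructor
  · rw [act_inv_of_decomposition h h0, sub_self, moeb_zero]; simp
  · rw [(fderiv_act_inv h h0).fderiv, sub_self, moebA_zero]; rfl

theorem Omega_inv_center (hn : 1 ≤ n)
    (h : g⁻¹ * matNbar x₀ = matNbar y * matM m * matA t * matN z) :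
    Omega g⁻¹ x₀ = Real.exp (-t) := by
  rw [Omega_inv hn h (by rw [sub_self, moebQ_zero]; exact one_pos), sub_self, moebQ_zero]
  simp

/-- The tractor `D`-operator: the second order operator on forms with values in
`ℂ ⊗ ℝ^{1,n+1}` from which the source operator is built. -/
def tracD (s : ℂ) (a : Idx n) (φ : Form n k V) : Form n k V := fun x =>
  (coneLift x a : ℂ) • box s φ x - ∑ j, (tangentLift x j a : ℂ) • nabla s j φ x
    - (coefC n k s * ((lc 0 0 1 : Idx n → ℝ) a : ℂ)) • φ x

theorem sum_smul_tracD (s : ℂ) (c : Idx n → ℝ) (φ : Form n k V) (x : E n) :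
    ∑ a, (c a : ℂ) • tracD s a φ x = ((c ⬝ᵥ coneLift x : ℝ) : ℂ) • box s φ x
      - ∑ j, ((c ⬝ᵥ tangentLift x j : ℝ) : ℂ) • nabla s j φ x
      - (coefC n k s * ((c ⬝ᵥ lc 0 0 1 : ℝ) : ℂ)) • φ x := by
  simp only [tracD, smul_sub, Finset.sum_sub_distrib, smul_smul, dotProduct, Complex.ofReal_sum,
    Complex.ofReal_mul, Finset.sum_smul, Finset.smul_sum, Finset.mul_sum]
  rw [Finset.sum_comm]
  simp only [mul_left_comm]

/-- Conformal covariance of the tractor `D`-operator. -/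
theorem tracD_covariant (hn : 1 ≤ n) (hg : g ∈ G n) (hx : DefinedAt g⁻¹ x₀) (lam : ℂ)
    {φ : Form n k V} (hφ : ContDiff ℝ ∞ φ) :
    TwiceDiffAt (confPull lam (act g⁻¹) (fderiv ℝ (act g⁻¹)) (Omega g⁻¹) φ) x₀ ∧
    ∀ a, tracD (n - 2 * (lam + k)) a
        (confPull lam (act g⁻¹) (fderiv ℝ (act g⁻¹)) (Omega g⁻¹) φ) x₀ =
      ∑ b, (g a b : ℂ) • confPull (lam + 1) (act g⁻¹) (fderiv ℝ (act g⁻¹)) (Omega g⁻¹)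
        (tracD (n - 2 * (lam + k)) b φ) x₀ := by
  obtain ⟨y, z, h⟩ := bruhat_spec hg hx
  set m := mPart (g⁻¹ * matNbar x₀)
  set t := tPart (g⁻¹ * matNbar x₀)
  have hL := isLorentz_of_mem_G hg
  have hΩ := Omega_inv_center hn h
  obtain ⟨hy, hD⟩ := act_inv_center h
  obtain ⟨h1, h2, h3⟩ := conformal_transform (eventually_isConformalAt hn h) lam hφ
    (SO.transpose_mul m) hD
  refine ⟨h1, fun a => ?_⟩
  have hb : moebB z (x₀ - x₀) = (-2 : ℝ) • z := by rw [sub_self, moebB_zero]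
  simp only [hb] at h2 h3
  set s : ℂ := n - 2 * (lam + k) with hs
  set R : Module.End ℂ (E n [⋀^Fin k]→L[ℝ] V) :=
    scaledPull ((Omega g⁻¹ x₀ : ℂ) ^ lam) (fderiv ℝ (act g⁻¹) x₀) with hR
  set c := Real.exp (-t) with hc
  have hc0 : (c : ℂ) ≠ 0 := by exact_mod_cast (Real.exp_pos (-t)).ne'
  -- At x₀ the conformal factor equals c, so raising the weight by one multiplies the pullback by c.
  have hpull : ∀ χ : Form n k V, confPull (lam + 1) (act g⁻¹) (fderiv ℝ (act g⁻¹)) (Omega g⁻¹) χ x₀ =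
      (c : ℂ) • R (χ y) := by
    intro χ
    rw [hR, confPull, hΩ, hy, Complex.cpow_add _ _ hc0, Complex.cpow_one, mul_comm, mul_smul]
    rfl
  have hrhs : ∑ b, (g a b : ℂ) • confPull (lam + 1) (act g⁻¹) (fderiv ℝ (act g⁻¹)) (Omega g⁻¹)
      (tracD s b φ) x₀ = (c : ℂ) • R (∑ b, (g a b : ℂ) • tracD s b φ y) := by
    rw [map_sum, Finset.smul_sum]
    exact Finset.sum_congr rfl fun b _ => by rw [hpull, map_smul, smul_comm]
  rw [hrhs]
  rw [hy] at h2 h3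
  have hX := congrFun (mulVec_coneLift hL h) a
  have hZ := fun p => congrFun (mulVec_tangentLift hL h p) a
  have hY := congrFun (mulVec_infinity hL h) a
  have hsum := sum_smul_tracD s (g a) φ y
  rw [hsum]
  have e1 : g a ⬝ᵥ coneLift y = c * coneLift x₀ a := hX
  have e2 : ∀ p, g a ⬝ᵥ tangentLift y p = ∑ j, (m : Matrix (Fin n) (Fin n) ℝ) p j *
      (tangentLift x₀ j a + ((-2 : ℝ) • z) j * coneLift x₀ a) := by
    intro p
    refine (hZ p).trans ?_
    simp only [Finset.sum_apply, Pi.smul_apply, Pi.add_apply, smul_eq_mul]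
  have e3 : c * (g a ⬝ᵥ lc 0 0 1) = (lc 0 0 1 : Idx n → ℝ) a
      + (1 / 2 : ℝ) * ∑ j, ((-2 : ℝ) • z) j * tangentLift x₀ j a
      + (1 / 4 * ∑ j, ((-2 : ℝ) • z) j * ((-2 : ℝ) • z) j) * coneLift x₀ a := by
    refine Eq.trans ?_ (hY.trans ?_)
    · rfl
    · simp
  have e3' := congrArg (fun r : ℝ => (r : ℂ)) e3
  simp only [Complex.ofReal_mul, Complex.ofReal_add, Complex.ofReal_sum] at e3'
  rw [tracD, h3]
  simp only [h2]
  simp only [map_sub, map_smul, map_sum, e1, e2, cvec, Complex.ofReal_mul, Complex.ofReal_add, Complex.ofReal_sum]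
  set β : Fin n → ℂ := fun j => ((((-2 : ℝ) • z) j : ℝ) : ℂ) with hβ
  set τ : Fin n → ℂ := fun j => (tangentLift x₀ j a : ℂ) with hτ
  have hconf : confPull lam (act g⁻¹) (fderiv ℝ (act g⁻¹)) (Omega g⁻¹) φ x₀ = R (φ y) := by
    rw [hR, confPull, hy]; rfl
  rw [hconf]
  set T := R (φ y)
  -- Both sides are now compared term by term: the multiples of X produced by g Z_p and g Y match
  -- the first and zeroth order defects of □, and the multiples of Z_j in g Y match the zeroth order
  -- defect of ∇_j.
  have f1 : (c : ℂ) • (coefC n k s * ((g a ⬝ᵥ lc 0 0 1 : ℝ) : ℂ)) • T =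
      (coefC n k s * (((lc 0 0 1 : Idx n → ℝ) a : ℂ) + 1 / 2 * ∑ j, β j * τ j
        + 1 / 4 * (∑ j, β j * β j) * (coneLift x₀ a : ℂ))) • T := by
    rw [smul_smul, mul_left_comm, e3']
    push_cast
    rfl
  have f2 : (c : ℂ) • ∑ p, (∑ j, ((m : Matrix (Fin n) (Fin n) ℝ) p j : ℂ) *
        (τ j + β j * (coneLift x₀ a : ℂ))) • R (nabla s p φ y) =
      ∑ j, τ j • (c : ℂ) • ∑ p, ((m : Matrix (Fin n) (Fin n) ℝ) p j : ℂ) • R (nabla s p φ y) +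
      (coneLift x₀ a : ℂ) • ∑ j, β j • (c : ℂ) •
        ∑ p, ((m : Matrix (Fin n) (Fin n) ℝ) p j : ℂ) • R (nabla s p φ y) := by
    simp only [Finset.smul_sum, Finset.sum_smul]
    rw [Finset.sum_comm]
    simp only [← Finset.sum_add_distrib]
    exact Finset.sum_congr rfl fun j _ => Finset.sum_congr rfl fun p _ => by module
  have f3 : ∀ A : Fin n → E n [⋀^Fin k]→L[ℝ] V,
      ∑ j, τ j • (A j + (coefC n k s / 2 * β j) • T) =
        ∑ j, τ j • A j + (coefC n k s / 2 * ∑ j, β j * τ j) • T := by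
    intro A
    simp only [Finset.mul_sum, Finset.sum_smul, ← Finset.sum_add_distrib]
    exact Finset.sum_congr rfl fun j _ => by module
  simp only [hβ, hτ] at f1 f2 f3
  rw [f3, smul_sub (c : ℂ), smul_sub (c : ℂ), f2, f1]
  module

end Action

/-! ### Smooth operator-valued coefficients -/

section Coefficients

variable {X F : Type*} [NormedAddCommGroup X] [NormedSpace ℝ X] [NormedAddCommGroup F]
  [NormedSpace ℝ F] [NormedSpace ℂ F] [IsScalarTower ℝ ℂ F] [SMulCommClass ℝ ℂ F]

theorem fderiv_coefficient {a : X → (F →L[ℂ] F)} {f : X → F}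
    (ha : ContDiff ℝ ∞ a) (hf : ContDiff ℝ ∞ f) (p v : X) :
    fderiv ℝ (fun p => a p (f p)) p v = fderiv ℝ a p v (f p) + a p (fderiv ℝ f p v) := by
  have h1 : HasFDerivAt (fun p => (a p).restrictScalars ℝ)
      ((ContinuousLinearMap.restrictScalarsL ℂ F F ℝ ℝ) ∘L fderiv ℝ a p) p :=
    (ContinuousLinearMap.restrictScalarsL ℂ F F ℝ ℝ).hasFDerivAt.comp p
      ((ha.differentiable (by simp)) p).hasFDerivAt
  have h2 := h1.clm_apply ((hf.differentiable (by simp)) p).hasFDerivAt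
  have h3 : fderiv ℝ (fun p => a p (f p)) p = _ := h2.fderiv
  rw [h3]
  simp [add_comm]

theorem contDiff_coefficient {a : X → (F →L[ℂ] F)} {f : X → F}
    (ha : ContDiff ℝ ∞ a) (hf : ContDiff ℝ ∞ f) : ContDiff ℝ ∞ (fun p => a p (f p)) := by
  have h1 : ContDiff ℝ ∞ (fun p => (a p).restrictScalars ℝ) :=
    (ContinuousLinearMap.restrictScalarsL ℂ F F ℝ ℝ).contDiff.comp ha
  exact h1.clm_apply hf

theorem contDiff_coefficient_comp {a b : X → (F →L[ℂ] F)}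
    (ha : ContDiff ℝ ∞ a) (hb : ContDiff ℝ ∞ b) : ContDiff ℝ ∞ (fun p => b p ∘L a p) := by
  have h : IsBoundedBilinearMap ℝ (fun p : (F →L[ℂ] F) × (F →L[ℂ] F) => p.1 ∘L p.2) :=
    { add_left := fun _ _ _ => by ext; simp
      smul_left := fun _ _ _ => by ext; simp
      add_right := fun _ _ _ => by ext; simp
      smul_right := fun c x y => by ext v; exact (x.restrictScalars ℝ).map_smul c (y v)
      bound := ⟨1, one_pos, fun x y => by
        rw [one_mul]; exact ContinuousLinearMap.opNorm_comp_le x y⟩ }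
  exact h.contDiff.comp (hb.prodMk ha)

theorem contDiff_smul_id {f : X → ℂ} (hf : ContDiff ℝ ∞ f) :
    ContDiff ℝ ∞ (fun p => f p • ContinuousLinearMap.id ℂ F) := hf.smul contDiff_const

end Coefficients

/-! ### Differential operators on ℝⁿ × ℝⁿ in normal form -/

section MixedOperators

variable {n k l : ℕ}

/-- This makes linear endomorphisms of the space of values, such as ε_i ι_m and p_Γ, continuous and
hence admissible coefficients. -/
instance : FiniteDimensional ℂ (BiLam n k l) :=
  FiniteDimensional.of_injective comps comps_injective

/-- Linear differential operators on `ℝⁿ × ℝⁿ` with smooth coefficients. -/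
def IsMixedOp (A : BiForm n k l → BiForm n k l) : Prop :=
  ∃ (ι : Type) (_ : Fintype ι) (w : ι → List (Fin n) × List (Fin n))
    (a : ι → E n × E n → (BiLam n k l →L[ℂ] BiLam n k l)), (∀ i, ContDiff ℝ ∞ (a i)) ∧
    ∀ φ : BiForm n k l, ContDiff ℝ ∞ φ → ∀ p,
      A φ p = ∑ i, a i p (mixedPd (w i).1 (w i).2 φ p)

theorem contDiff_fderiv_apply {F G : Type*} [NormedAddCommGroup F] [NormedSpace ℝ F]
    [NormedAddCommGroup G] [NormedSpace ℝ G] {f : F → G} (hf : ContDiff ℝ ∞ f) (v : F) :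
    ContDiff ℝ ∞ (fun p => fderiv ℝ f p v) :=
  (hf.fderiv_right (m := ∞) (by norm_cast)).clm_apply contDiff_const

theorem contDiff_mixedPd {φ : BiForm n k l} (hφ : ContDiff ℝ ∞ φ) (u v : List (Fin n)) :
    ContDiff ℝ ∞ (mixedPd u v φ) := by
  induction u with
  | nil =>
    induction v with
    | nil => exact hφ
    | cons j v ih => exact contDiff_fderiv_apply ih (0, e j)
  | cons j u ih => exact contDiff_fderiv_apply ih (e j, 0)

theorem fderiv_fderiv_comm {F G : Type*} [NormedAddCommGroup F] [NormedSpace ℝ F]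
    [NormedAddCommGroup G] [NormedSpace ℝ G] {f : F → G} (hf : ContDiff ℝ ∞ f) (v w : F) (p : F) :
    fderiv ℝ (fun q => fderiv ℝ f q v) p w = fderiv ℝ (fun q => fderiv ℝ f q w) p v := by
  have h : DifferentiableAt ℝ (fderiv ℝ f) p :=
    ((hf.fderiv_right (m := ∞) (by norm_cast)).differentiable (by simp)) p
  have h2 : IsSymmSndFDerivAt ℝ f p := hf.contDiffAt.isSymmSndFDerivAt (by simp; norm_cast)
  rw [fderiv_clm_apply h (differentiableAt_const _), fderiv_clm_apply h (differentiableAt_const _)]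
  simpa using h2 w v

/-- In `mixedPd` the x-derivatives are outermost; symmetry of second derivatives lets a new
y-derivative pass inside them, which keeps the normal form. -/
theorem mixedPd_cons_right {φ : BiForm n k l} (hφ : ContDiff ℝ ∞ φ) (u v : List (Fin n))
    (j : Fin n) : mixedPd u (j :: v) φ = fun p => fderiv ℝ (mixedPd u v φ) p (0, e j) := by
  induction u with
  | nil => rfl
  | cons i u ih =>
    funext p
    change fderiv ℝ (mixedPd u (j :: v) φ) p (e i, 0) =
      fderiv ℝ (fun p => fderiv ℝ (mixedPd u v φ) p (e i, 0)) p (0, e j)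
    rw [ih]
    exact fderiv_fderiv_comm (contDiff_mixedPd hφ u v) _ _ p

namespace IsMixedOp

variable {A B : BiForm n k l → BiForm n k l}

theorem contDiff (hA : IsMixedOp A) {φ : BiForm n k l} (hφ : ContDiff ℝ ∞ φ) :
    ContDiff ℝ ∞ (A φ) := by
  obtain ⟨ι, _, w, a, ha, h⟩ := hA
  rw [funext (h φ hφ)]
  exact ContDiff.sum fun i _ => contDiff_coefficient (ha i) (contDiff_mixedPd hφ _ _)

theorem congr (hA : IsMixedOp A) (h : ∀ φ, ContDiff ℝ ∞ φ → ∀ p, B φ p = A φ p) :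
    IsMixedOp B := by
  obtain ⟨ι, _, w, a, ha, h'⟩ := hA
  exact ⟨ι, _, w, a, ha, fun φ hφ p => (h φ hφ p).trans (h' φ hφ p)⟩

theorem mixedPd (u v : List (Fin n)) : IsMixedOp (ConfForms.mixedPd (k := k) (l := l) u v) :=
  ⟨Unit, inferInstance, fun _ => (u, v), fun _ _ => ContinuousLinearMap.id ℂ _,
    fun _ => contDiff_const, fun φ _ p => by simp⟩

theorem id : IsMixedOp (fun φ : BiForm n k l => φ) := mixedPd [] []

theorem sum {ι : Type} [Fintype ι] {A : ι → BiForm n k l → BiForm n k l}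
    (hA : ∀ i, IsMixedOp (A i)) : IsMixedOp (fun φ p => ∑ i, A i φ p) := by
  choose κ hκ w a ha h using hA
  exact ⟨Σ i, κ i, inferInstance, fun i => w i.1 i.2, fun i => a i.1 i.2, fun i => ha i.1 i.2,
    fun φ hφ p => by simp only [Fintype.sum_sigma, h _ φ hφ p]⟩

theorem add (hA : IsMixedOp A) (hB : IsMixedOp B) : IsMixedOp (fun φ p => A φ p + B φ p) := by
  have : ∀ i : Bool, IsMixedOp (fun φ p => if i then A φ p else B φ p) := by
    intro i; cases i
    · exact hB
    · exact hA
  refine (sum this).congr fun φ _ p => ?_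
  simp

theorem coefficient (hA : IsMixedOp A) {b : E n × E n → (BiLam n k l →L[ℂ] BiLam n k l)}
    (hb : ContDiff ℝ ∞ b) : IsMixedOp (fun φ p => b p (A φ p)) := by
  obtain ⟨ι, hι, w, a, ha, h⟩ := hA
  exact ⟨ι, hι, w, fun i p => b p ∘L a i p, fun i => contDiff_coefficient_comp (ha i) hb,
    fun φ hφ p => by simp [h φ hφ p]⟩

theorem linear (hA : IsMixedOp A) (L : Module.End ℂ (BiLam n k l)) :
    IsMixedOp (fun φ p => L (A φ p)) :=
  hA.coefficient (b := fun _ => LinearMap.toContinuousLinearMap L) contDiff_const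

theorem smul (hA : IsMixedOp A) {f : E n × E n → ℂ} (hf : ContDiff ℝ ∞ f) :
    IsMixedOp (fun φ p => f p • A φ p) :=
  hA.coefficient (contDiff_smul_id hf)

theorem fderivX (hA : IsMixedOp A) (j : Fin n) :
    IsMixedOp (fun φ p => fderiv ℝ (A φ) p (e j, 0)) := by
  obtain ⟨ι, _, w, a, ha, h⟩ := hA
  refine ⟨ι ⊕ ι, inferInstance, Sum.elim w fun i => (j :: (w i).1, (w i).2),
    Sum.elim (fun i p => fderiv ℝ (a i) p (e j, 0)) a, ?_, fun φ hφ p => ?_⟩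
  · rintro (i | i)
    · exact contDiff_fderiv_apply (ha i) _
    · exact ha i
  · change fderiv ℝ (A φ) p (e j, 0) = _
    rw [(funext (h φ hφ) : A φ = _), fderiv_fun_sum fun i _ => ((contDiff_coefficient (ha i)
      (contDiff_mixedPd hφ _ _)).differentiable (by simp)) p]
    simp only [_root_.sum_apply, fderiv_coefficient (ha _) (contDiff_mixedPd hφ _ _),
      Fintype.sum_sum_type, Finset.sum_add_distrib, Sum.elim_inl, Sum.elim_inr]
    rfl

theorem fderivY (hA : IsMixedOp A) (j : Fin n) :
    IsMixedOp (fun φ p => fderiv ℝ (A φ) p (0, e j)) := by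
  obtain ⟨ι, _, w, a, ha, h⟩ := hA
  refine ⟨ι ⊕ ι, inferInstance, Sum.elim w fun i => ((w i).1, j :: (w i).2),
    Sum.elim (fun i p => fderiv ℝ (a i) p (0, e j)) a, ?_, fun φ hφ p => ?_⟩
  · rintro (i | i)
    · exact contDiff_fderiv_apply (ha i) _
    · exact ha i
  · change fderiv ℝ (A φ) p (0, e j) = _
    rw [(funext (h φ hφ) : A φ = _), fderiv_fun_sum fun i _ => ((contDiff_coefficient (ha i)
      (contDiff_mixedPd hφ _ _)).differentiable (by simp)) p]
    simp only [_root_.sum_apply, fderiv_coefficient (ha _) (contDiff_mixedPd hφ _ _),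
      Fintype.sum_sum_type, Finset.sum_add_distrib, Sum.elim_inl, Sum.elim_inr,
      mixedPd_cons_right hφ]

theorem mixedPd_comp (hA : IsMixedOp A) (u v : List (Fin n)) :
    IsMixedOp (fun φ => ConfForms.mixedPd u v (A φ)) := by
  induction u with
  | nil =>
    induction v with
    | nil => exact hA
    | cons j v ih => exact ih.fderivY j
  | cons j u ih => exact ih.fderivX j

/-- Derivatives of a normal form are again normal forms by the Leibniz rule, and multiplying by the
outer coefficients and summing preserves this. -/
theorem comp (hB : IsMixedOp B) (hA : IsMixedOp A) : IsMixedOp (fun φ => B (A φ)) := by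
  obtain ⟨ι, _, w, b, hb, h⟩ := hB
  exact (sum fun i => (hA.mixedPd_comp (w i).1 (w i).2).coefficient (hb i)).congr
    fun φ hφ p => h _ (hA.contDiff hφ) p

end IsMixedOp

/-- The restriction to the diagonal of a differential operator is bi-differential. -/
theorem IsMixedOp.isBiDifferential {A : BiForm n k l → BiForm n k l} (hA : IsMixedOp A)
    (W : Submodule ℂ (BiLam n k l)) : IsBiDifferential (fun φ x => proj W (A φ (x, x))) := by
  classical
  obtain ⟨ι, _, w, a, ha, h⟩ := hA
  set P : BiLam n k l →L[ℂ] BiLam n k l := LinearMap.toContinuousLinearMap (W.subtype ∘ₗ proj W)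
    with hP
  -- Different indices may carry the same pair of words, so the coefficient of a pair is the sum
  -- over the fibre of w.
  refine ⟨Finset.univ.image w, fun v x => ∑ i with w i = v, P ∘L a i (x, x), fun v _ => ?_,
    fun φ hφ x => ?_⟩
  · refine ContDiff.sum fun i _ => ?_
    exact contDiff_coefficient_comp ((ha i).comp (contDiff_id.prodMk contDiff_id)) contDiff_const
  · have h1 : ((proj W (A φ (x, x)) : W) : BiLam n k l) = P (A φ (x, x)) := rfl
    rw [h1, h φ hφ, map_sum, ← Finset.sum_fiberwise_of_maps_to (t := Finset.univ.image w) (g := w)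
      fun i hi => Finset.mem_image_of_mem w hi]
    refine Finset.sum_congr rfl fun v _ => ?_
    rw [_root_.sum_apply]
    refine Finset.sum_congr rfl fun i hi => ?_
    rw [← (Finset.mem_filter.mp hi).2]
    rfl

end MixedOperators

/-! ### Locality of □ and ∇ -/

section Locality

open Filter Topology

variable {n k : ℕ} {V : Type*} [NormedAddCommGroup V] [NormedSpace ℝ V]
  {x : E n}

theorem _root_.Filter.EventuallyEq.pd {F : Type*} [NormedAddCommGroup F] [NormedSpace ℝ F] {f f' : E n → F}
    (h : f =ᶠ[𝓝 x] f') (j : Fin n) : pd j f =ᶠ[𝓝 x] pd j f' :=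
  h.fderiv.mono fun y hy => congrArg (fun L : E n →L[ℝ] F => L (e j)) hy

theorem _root_.Filter.EventuallyEq.codiff {f f' : Form n (k + 1) V} (h : f =ᶠ[𝓝 x] f') :
    codiff f =ᶠ[𝓝 x] codiff f' := by
  have : ∀ᶠ y in 𝓝 x, ∀ m, ConfForms.pd m f y = ConfForms.pd m f' y := eventually_all.2 fun m => h.pd m
  exact this.mono fun y hy => by simp only [ConfForms.codiff, hy]

variable [NormedSpace ℂ V] [SMulCommClass ℝ ℂ V]

/-- Needed for iteration: covariance of one step holds only on the open set where g⁻¹ is defined,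
and the next step must not look outside it. -/
theorem box_congr {f f' : Form n k V} (h : f =ᶠ[𝓝 x] f') (s : ℂ) : box s f x = box s f' x := by
  have h1 : codiffD f x = codiffD f' x := h.extDeriv.codiff.eq_of_nhds
  have h2 : dCodiff f x = dCodiff f' x := by
    cases k with
    | zero => rfl
    | succ k => exact h.codiff.extDeriv.eq_of_nhds
  rw [box, box, h1, h2]

theorem nabla_congr {f f' : Form n k V} (h : f =ᶠ[𝓝 x] f') (s : ℂ) (j : Fin n) :
    nabla s j f x = nabla s j f' x := by
  have h1 : epsCodiff j f x = epsCodiff j f' x := by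
    cases k with
    | zero => rfl
    | succ k => exact congrArg (eps j) h.codiff.eq_of_nhds
  have h2 : dIota j f x = dIota j f' x := by
    cases k with
    | zero => rfl
    | succ k =>
      exact EventuallyEq.eq_of_nhds (EventuallyEq.extDeriv (h.mono fun y hy => congrArg (iota j) hy))
  rw [nabla, nabla, h1, h2, (h.pd j).eq_of_nhds]

end Locality

/-! ### Compatibility with linear maps of the space of values -/

section Linearity

variable {n k : ℕ} {V V' : Type*} [NormedAddCommGroup V] [NormedSpace ℝ V]
  [NormedSpace ℂ V] [SMulCommClass ℝ ℂ V] [IsScalarTower ℝ ℂ V]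
  [NormedAddCommGroup V'] [NormedSpace ℝ V']
  [NormedSpace ℂ V'] [SMulCommClass ℝ ℂ V'] [IsScalarTower ℝ ℂ V'] {x : E n}

/-- Linear maps between spaces of forms which commute with the operators `ε_i ι_m`. -/
def CommutesN (L : (E n [⋀^Fin k]→L[ℝ] V) →L[ℂ] (E n [⋀^Fin k]→L[ℝ] V')) : Prop :=
  ∀ i m T, L (opN i m T) = opN i m (L T)

/-- In jet form □ uses only second derivatives, scalars and the maps ε_i ι_m. A constant L commuting
with ε_i ι_m therefore passes through it. -/
theorem CommutesN.box {L : (E n [⋀^Fin k]→L[ℝ] V) →L[ℂ] (E n [⋀^Fin k]→L[ℝ] V')}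
    (hL : CommutesN L) (s : ℂ) {f : Form n k V} (hf : TwiceDiffAt f x) :
    box s (fun y => L (f y)) x = L (box s f x) := by
  obtain ⟨h1, -, h3⟩ := hf.clm (L.restrictScalars ℝ)
  have h1' : TwiceDiffAt (fun y => L (f y)) x := h1
  have h3' : ∀ j l, pd2 j l (fun y => L (f y)) x = L (pd2 j l f x) := h3
  rw [box_eq h1', box_eq hf, boxJet, boxJet]
  simp only [h3', map_add, map_smul, map_sum, hL _ _ _]

theorem CommutesN.nabla {L : (E n [⋀^Fin k]→L[ℝ] V) →L[ℂ] (E n [⋀^Fin k]→L[ℝ] V')}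
    (hL : CommutesN L) (s : ℂ) (j : Fin n) {f : Form n k V} (hf : TwiceDiffAt f x) :
    nabla s j (fun y => L (f y)) x = L (nabla s j f x) := by
  obtain ⟨h1, h2, -⟩ := hf.clm (L.restrictScalars ℝ)
  have h1' : TwiceDiffAt (fun y => L (f y)) x := h1
  have h2' : ∀ j, pd j (fun y => L (f y)) x = L (pd j f x) := h2
  rw [nabla_eq j h1'.differentiableAt, nabla_eq j hf.differentiableAt, nablaJet, nablaJet]
  simp only [h2', map_add, map_sub, map_smul, map_sum, hL _ _ _]

theorem CommutesN.tracD {L : (E n [⋀^Fin k]→L[ℝ] V) →L[ℂ] (E n [⋀^Fin k]→L[ℝ] V')}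
    (hL : CommutesN L) (s : ℂ) (a : Idx n) {f : Form n k V} (hf : TwiceDiffAt f x) :
    tracD s a (fun y => L (f y)) x = L (tracD s a f x) := by
  simp only [ConfForms.tracD, hL.box s hf, hL.nabla s _ hf, map_sub, map_smul, map_sum]

theorem commutesN_smul (c : ℂ) :
    CommutesN (c • ContinuousLinearMap.id ℂ (E n [⋀^Fin k]→L[ℝ] V)) := fun i m T => by
  simp

/-- Postcomposition of forms with a linear map between the spaces of values. -/
def postComp (P : V →L[ℂ] V') : (E n [⋀^Fin k]→L[ℝ] V) →L[ℂ] (E n [⋀^Fin k]→L[ℝ] V') where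
  toFun T := (P.restrictScalars ℝ).compContinuousAlternatingMap T
  map_add' S T := by ext v; exact map_add P (S v) (T v)
  map_smul' c T := by ext v; exact map_smul P c (T v)
  cont := (ContinuousLinearMap.compContinuousAlternatingMapCLM ℝ (E n) V V' (Fin k)
    (P.restrictScalars ℝ)).cont

theorem postComp_apply (P : V →L[ℂ] V') (T : E n [⋀^Fin k]→L[ℝ] V) (v : Fin k → E n) :
    postComp P T v = P (T v) := rfl

/-- Operators on the arguments commute with operators on the values. This is what lets operators in
x ignore the factor Λ^ℓ. -/
theorem commutesN_postComp (P : V →L[ℂ] V') : CommutesN (postComp (n := n) (k := k) P) := by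
  intro i m T
  ext v
  rw [postComp_apply, opN_apply, opN_apply, derivAct_apply, derivAct_apply, map_sum]
  rfl

theorem TwiceDiffAt.sum_smul {ι : Type*} [Fintype ι] (c : ι → ℂ) {f : ι → Form n k V}
    (hf : ∀ i, TwiceDiffAt (f i) x) : TwiceDiffAt (fun y => ∑ i, c i • f i y) x :=
  (TwiceDiffAt.sum Finset.univ fun i _ =>
    ((hf i).clm ((c i • ContinuousLinearMap.id ℂ (E n [⋀^Fin k]→L[ℝ] V)).restrictScalars ℝ)).1).1

theorem box_sum_smul {ι : Type*} [Fintype ι] (s : ℂ) (c : ι → ℂ) {f : ι → Form n k V}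
    (hf : ∀ i, TwiceDiffAt (f i) x) :
    box s (fun y => ∑ i, c i • f i y) x = ∑ i, c i • box s (f i) x := by
  have h : ∀ i, TwiceDiffAt (fun y => c i • f i y) x := fun i =>
    ((hf i).clm ((c i • ContinuousLinearMap.id ℂ (E n [⋀^Fin k]→L[ℝ] V)).restrictScalars ℝ)).1
  have h2 : ∀ i, box s (fun y => c i • f i y) x = c i • box s (f i) x := fun i =>
    (commutesN_smul (c i)).box s (hf i)
  obtain ⟨h3, -, h4⟩ := TwiceDiffAt.sum Finset.univ fun i _ => h i
  rw [box_eq h3]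
  simp only [← h2, box_eq (h _), boxJet, h4, map_sum, Finset.smul_sum, Finset.sum_add_distrib]
  congr 1
  · rw [Finset.sum_comm]
  · rw [Finset.sum_comm' (s := Finset.univ (α := ι)) (t' := Finset.univ)
      (s' := fun _ => Finset.univ) (by simp)]
    exact Finset.sum_congr rfl fun i _ => Finset.sum_comm

theorem nabla_sum_smul {ι : Type*} [Fintype ι] (s : ℂ) (j : Fin n) (c : ι → ℂ) {f : ι → Form n k V}
    (hf : ∀ i, TwiceDiffAt (f i) x) :
    nabla s j (fun y => ∑ i, c i • f i y) x = ∑ i, c i • nabla s j (f i) x := by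
  have h : ∀ i, TwiceDiffAt (fun y => c i • f i y) x := fun i =>
    ((hf i).clm ((c i • ContinuousLinearMap.id ℂ (E n [⋀^Fin k]→L[ℝ] V)).restrictScalars ℝ)).1
  have h2 : ∀ i, nabla s j (fun y => c i • f i y) x = c i • nabla s j (f i) x := fun i =>
    (commutesN_smul (c i)).nabla s j (hf i)
  obtain ⟨h3, h4, -⟩ := TwiceDiffAt.sum Finset.univ fun i _ => h i
  rw [nabla_eq j h3.differentiableAt]
  simp only [← h2, nabla_eq j (h _).differentiableAt, nablaJet, h4, map_sum]
  simp only [← Finset.smul_sum, Finset.sum_add_distrib, Finset.sum_sub_distrib]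
  congr 3
  · rw [Finset.sum_comm]
  · rw [Finset.sum_comm]

theorem tracD_sum_smul {ι : Type*} [Fintype ι] (s : ℂ) (a : Idx n) (c : ι → ℂ) {f : ι → Form n k V}
    (hf : ∀ i, TwiceDiffAt (f i) x) :
    tracD s a (fun y => ∑ i, c i • f i y) x = ∑ i, c i • tracD s a (f i) x := by
  simp only [tracD, box_sum_smul s c hf, nabla_sum_smul s _ c hf, smul_sub, Finset.sum_sub_distrib]
  congr 2
  · rw [Finset.smul_sum]
    exact Finset.sum_congr rfl fun i _ => smul_comm _ _ _
  · simp only [Finset.smul_sum]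
    rw [Finset.sum_comm]
    exact Finset.sum_congr rfl fun i _ => Finset.sum_congr rfl fun j _ => smul_comm _ _ _
  · rw [Finset.smul_sum]
    exact Finset.sum_congr rfl fun i _ => smul_comm _ _ _

end Linearity

/-! ### The source operator and its iterates as differential operators -/

section SourceOperators

variable {n k l : ℕ}

/-- `swap` as a linear map. -/
def swapL (n k l : ℕ) : BiLam n k l →L[ℂ] BiLam n l k :=
  LinearMap.toContinuousLinearMap
    { toFun := swap
      map_add' := fun _ _ => rfl
      map_smul' := fun _ _ => rfl }

theorem swapL_apply (T : BiLam n k l) : swapL n k l T = swap T := rfl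

theorem pd_sliceX {φ : BiForm n k l} (hφ : ContDiff ℝ ∞ φ) (y : E n) (j : Fin n) :
    pd j (fun x => φ (x, y)) = fun x => mixedPd [j] [] φ (x, y) := by
  funext x
  have h : HasFDerivAt (fun x => φ (x, y))
      (fderiv ℝ φ (x, y) ∘L (ContinuousLinearMap.inl ℝ (E n) (E n))) x :=
    ((hφ.differentiable (by simp)) (x, y)).hasFDerivAt.comp x (hasFDerivAt_prodMk_left x y)
  rw [pd, h.fderiv]
  rfl

theorem pd_sliceY {φ : BiForm n k l} (hφ : ContDiff ℝ ∞ φ) (x : E n) (j : Fin n) :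
    pd j (fun y => φ (x, y)) = fun y => mixedPd [] [j] φ (x, y) := by
  funext y
  have h : HasFDerivAt (fun y => φ (x, y))
      (fderiv ℝ φ (x, y) ∘L (ContinuousLinearMap.inr ℝ (E n) (E n))) y :=
    ((hφ.differentiable (by simp)) (x, y)).hasFDerivAt.comp y (hasFDerivAt_prodMk_right x y)
  rw [pd, h.fderiv]
  rfl

theorem contDiff_sliceX {φ : BiForm n k l} (hφ : ContDiff ℝ ∞ φ) (y : E n) :
    ContDiff ℝ ∞ (fun x => φ (x, y)) := hφ.comp (contDiff_id.prodMk contDiff_const)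

theorem contDiff_sliceY {φ : BiForm n k l} (hφ : ContDiff ℝ ∞ φ) (x : E n) :
    ContDiff ℝ ∞ (fun y => φ (x, y)) := hφ.comp (contDiff_const.prodMk contDiff_id)

theorem contDiff_swap_sliceY {φ : BiForm n k l} (hφ : ContDiff ℝ ∞ φ) (x : E n) :
    ContDiff ℝ ∞ (fun y => swap (φ (x, y))) :=
  ((swapL n k l).restrictScalars ℝ).contDiff.comp (contDiff_sliceY hφ x)

theorem isMixedOp_onX_box (s : ℂ) : IsMixedOp (onX (k := k) (l := l) (n := n) (box s)) := by
  refine (((IsMixedOp.sum fun i => IsMixedOp.mixedPd [i, i] []).smul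
    (f := fun _ => -alphaC n k s) contDiff_const).add ((IsMixedOp.sum fun i => IsMixedOp.sum fun m =>
    (IsMixedOp.mixedPd [i, m] []).linear (opN i m)).smul (f := fun _ => alphaC n k s - betaC n k s)
    contDiff_const)).congr fun φ hφ p => ?_
  have h := (contDiff_sliceX hφ p.2).contDiffAt (x := p.1).twiceDiffAt
  have h2 : ∀ i m, pd2 i m (fun x => φ (x, p.2)) p.1 = mixedPd [i, m] [] φ p := fun i m => by
    rw [pd2_eq_pd_pd h.2, pd_sliceX hφ, pd_sliceX (contDiff_mixedPd hφ _ _)]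
    rfl
  rw [onX, box_eq h, boxJet]
  simp only [h2]

theorem isMixedOp_onX_nabla (s : ℂ) (j : Fin n) :
    IsMixedOp (onX (k := k) (l := l) (n := n) (nabla s j)) := by
  refine ((((IsMixedOp.mixedPd [j] []).smul (f := fun _ => (2 - s) * alphaC n k s)
    contDiff_const).add ((IsMixedOp.sum fun m => (IsMixedOp.mixedPd [m] []).linear (opN j m)).smul
      (f := fun _ => -((2 - s) * (2 * (s - n + 2 * k)))) contDiff_const)).add
    ((IsMixedOp.sum fun m => (IsMixedOp.mixedPd [m] []).linear (opN m j)).smul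
      (f := fun _ => (2 - s) * (2 * (s + n - 2 * k))) contDiff_const)).congr fun φ hφ p => ?_
  have h := (contDiff_sliceX hφ p.2).contDiffAt (x := p.1).twiceDiffAt
  rw [onX, nabla_eq j h.differentiableAt, nablaJet]
  simp only [pd_sliceX hφ]
  module

/-- `ε_i ι_m` acting on the second factor. -/
def opNY (i m : Fin n) : Module.End ℂ (BiLam n k l) :=
  (swapL n l k).toLinearMap ∘ₗ opN i m ∘ₗ (swapL n k l).toLinearMap

theorem isMixedOp_onY_box (s : ℂ) : IsMixedOp (onY (k := k) (l := l) (n := n) (box s)) := by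
  refine (((IsMixedOp.sum fun i => IsMixedOp.mixedPd [] [i, i]).smul
    (f := fun _ => -alphaC n l s) contDiff_const).add ((IsMixedOp.sum fun i => IsMixedOp.sum fun m =>
    (IsMixedOp.mixedPd [] [i, m]).linear (opNY i m)).smul (f := fun _ => alphaC n l s - betaC n l s)
    contDiff_const)).congr fun φ hφ p => ?_
  have h := (contDiff_sliceY hφ p.1).contDiffAt (x := p.2).twiceDiffAt
  have h2 : ∀ i m, pd2 i m (fun y => φ (p.1, y)) p.2 = mixedPd [] [i, m] φ p := fun i m => by
    rw [pd2_eq_pd_pd h.2, pd_sliceY hφ, pd_sliceY (contDiff_mixedPd hφ _ _)]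
    rfl
  obtain ⟨h3, -, h4⟩ := h.clm ((swapL n k l).restrictScalars ℝ)
  have h3' : TwiceDiffAt (fun y => swap (φ (p.1, y))) p.2 := h3
  have h4' : ∀ i m, pd2 i m (fun y => swap (φ (p.1, y))) p.2 = swapL n k l (mixedPd [] [i, m] φ p) :=
    fun i m => (h4 i m).trans (congrArg _ (h2 i m))
  rw [onY, box_eq h3', boxJet, ← swapL_apply]
  simp only [h4', map_add, map_smul, map_sum]
  rfl

theorem isMixedOp_onY_nabla (s : ℂ) (j : Fin n) :
    IsMixedOp (onY (k := k) (l := l) (n := n) (nabla s j)) := by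
  refine ((((IsMixedOp.mixedPd [] [j]).smul (f := fun _ => (2 - s) * alphaC n l s)
    contDiff_const).add ((IsMixedOp.sum fun m => (IsMixedOp.mixedPd [] [m]).linear (opNY j m)).smul
      (f := fun _ => -((2 - s) * (2 * (s - n + 2 * l)))) contDiff_const)).add
    ((IsMixedOp.sum fun m => (IsMixedOp.mixedPd [] [m]).linear (opNY m j)).smul
      (f := fun _ => (2 - s) * (2 * (s + n - 2 * l))) contDiff_const)).congr fun φ hφ p => ?_
  have h := (contDiff_sliceY hφ p.1).contDiffAt (x := p.2).twiceDiffAt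
  obtain ⟨h3, h4, -⟩ := h.clm ((swapL n k l).restrictScalars ℝ)
  have h3' : TwiceDiffAt (fun y => swap (φ (p.1, y))) p.2 := h3
  have h4' : ∀ i, pd i (fun y => swap (φ (p.1, y))) p.2 = swapL n k l (mixedPd [] [i] φ p) :=
    fun i => (h4 i).trans (congrArg _ (congrFun (pd_sliceY hφ p.1 i) p.2))
  rw [onY, nabla_eq j h3'.differentiableAt, nablaJet, ← swapL_apply]
  simp only [h4', map_add, map_sub, map_smul, map_sum]
  have h5 : ∀ i m (T : BiLam n k l), swapL n l k (opN i m (swapL n k l T)) = opNY i m T :=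
    fun _ _ _ => rfl
  have h6 : ∀ T : BiLam n k l, swapL n l k (swapL n k l T) = T := fun _ => rfl
  simp only [h5, h6]
  module

theorem isMixedOp_opE (s t : ℂ) : IsMixedOp (opE (k := k) (l := l) (n := n) s t) := by
  have hx : ∀ j, ContDiff ℝ ∞ fun p : E n × E n => ((p.1 j - p.2 j : ℝ) : ℂ) := fun j => by
    have h : ∀ j, ContDiff ℝ ∞ fun x : E n => x j := fun j =>
      (EuclideanSpace.proj j : E n →L[ℝ] ℝ).contDiff
    exact Complex.ofRealCLM.contDiff.comp (((h j).comp contDiff_fst).sub ((h j).comp contDiff_snd))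
  have hn : ContDiff ℝ ∞ fun p : E n × E n => -((‖p.1 - p.2‖ ^ 2 : ℝ) : ℂ) :=
    (Complex.ofRealCLM.contDiff.comp ((contDiff_fst.sub contDiff_snd).norm_sq ℝ)).neg
  have hm1 : ContDiff ℝ ∞ fun _ : E n × E n => (-1 : ℂ) := contDiff_const
  refine ((((((isMixedOp_onX_box s).comp (isMixedOp_onY_box t)).smul hn).add
    ((IsMixedOp.sum fun j => (((isMixedOp_onX_nabla s j).comp (isMixedOp_onY_box t)).add
      (((isMixedOp_onX_box s).comp (isMixedOp_onY_nabla t j)).smul hm1)).smul (hx j)).smul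
        (f := fun _ => 2) contDiff_const)).add
    ((IsMixedOp.sum fun j => (isMixedOp_onX_nabla s j).comp (isMixedOp_onY_nabla t j)).smul
      (f := fun _ => 2) contDiff_const)).add
    ((isMixedOp_onX_box s).smul (f := fun _ =>
      (t - 2) * (t - n - 2) * (t - n + 2 * l) * (t + n - 2 * l)) contDiff_const)).add
    ((isMixedOp_onY_box t).smul (f := fun _ =>
      (s - 2) * (s - n - 2) * (s - n + 2 * k) * (s + n - 2 * k)) contDiff_const) |>.congr fun φ hφ p => ?_
  simp only [opE, neg_one_smul, sub_eq_add_neg]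

theorem isMixedOp_sourceOp (lam mu : ℂ) :
    IsMixedOp (sourceOp (k := k) (l := l) (n := n) lam mu) :=
  ((isMixedOp_opE _ _).smul (f := fun _ => (-1 : ℂ)) contDiff_const).congr fun φ hφ p => by
    rw [neg_one_smul]; rfl

theorem isMixedOp_sourceIter (lam mu : ℂ) (m : ℕ) :
    IsMixedOp (sourceIter (k := k) (l := l) (n := n) lam mu m) := by
  induction m with
  | zero => exact IsMixedOp.id
  | succ m ih => exact (isMixedOp_sourceOp _ _).comp ih

end SourceOperators

/-! ### The source operator as a Lorentz contraction of two operators D -/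

section Contraction

variable {n k l : ℕ}

/-- The signs of the Lorentz form. -/
def sgn (a : Idx n) : ℝ := Sum.elim (fun _ => 1) (fun _ => -1) a

theorem lform_eq_sum (v w : Idx n → ℝ) : lform v w = ∑ a, sgn a * v a * w a := by
  simp only [lform, lorentz, Matrix.mulVec_diagonal, dotProduct]
  exact Finset.sum_congr rfl fun a _ => by rw [sgn]; ring

theorem sgn_dotProduct (v w : Idx n → ℝ) : (fun a => sgn a * v a) ⬝ᵥ w = lform v w :=
  (lform_eq_sum v w).symm

/-- First entry of the Gram matrix between the frames at x and at y, whose entries become the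
coefficients of E. -/
theorem lform_cone_cone (x y : E n) : lform (coneLift y) (coneLift x) = 2 * ‖x - y‖ ^ 2 := by
  rw [coneLift, coneLift, lform_lc, ← real_inner_self_eq_norm_sq]
  simp only [inner_sub_left, inner_sub_right, real_inner_comm y x]
  ring

theorem lform_cone_tangent (x y : E n) (j : Fin n) :
    lform (coneLift y) (tangentLift x j) = 4 * (x j - y j) := by
  rw [coneLift, tangentLift, lform_lc, inner_e_right]
  ring

theorem lform_tangent_cone (x y : E n) (j : Fin n) :
    lform (tangentLift y j) (coneLift x) = 4 * (y j - x j) := by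
  rw [coneLift, tangentLift, lform_lc, inner_e_left]
  ring

theorem lform_tangent_tangent (x y : E n) (i j : Fin n) :
    lform (tangentLift y i) (tangentLift x j) = if i = j then -4 else 0 := by
  rw [tangentLift, tangentLift, lform_lc, inner_e_left, e_apply]
  split_ifs <;> simp

theorem lform_cone_infinity (y : E n) : lform (coneLift y) (lc 0 0 1) = 2 := by
  rw [coneLift, lform_lc]; simp

theorem lform_infinity_cone (x : E n) : lform (lc 0 0 1) (coneLift x) = 2 := by
  rw [coneLift, lform_lc]; simp

theorem lform_tangent_infinity (y : E n) (j : Fin n) :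
    lform (tangentLift y j) (lc 0 0 1) = 0 := by
  rw [tangentLift, lform_lc]; simp

theorem lform_infinity_tangent (x : E n) (j : Fin n) :
    lform (lc 0 0 1) (tangentLift x j) = 0 := by
  rw [tangentLift, lform_lc]; simp

theorem lform_infinity_infinity : lform (lc 0 0 1 : Idx n → ℝ) (lc 0 0 1) = 0 := by
  rw [lform_lc]; simp

section
variable {V : Type*} [NormedAddCommGroup V] [NormedSpace ℝ V]
  [NormedSpace ℂ V] [SMulCommClass ℝ ℂ V] [IsScalarTower ℝ ℂ V]

theorem contract_tracD (s : ℂ) (v : Idx n → ℝ) (φ : Form n k V) (x : E n) :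
    ∑ a, ((sgn a : ℂ) * v a) • tracD s a φ x = (lform v (coneLift x) : ℂ) • box s φ x
      - ∑ j, (lform v (tangentLift x j) : ℂ) • nabla s j φ x
      - (coefC n k s * (lform v (lc 0 0 1) : ℂ)) • φ x := by
  simpa only [sgn_dotProduct, Complex.ofReal_mul] using sum_smul_tracD s (fun a => sgn a * v a) φ x

/-- Pairing D with Y isolates □, since Y is orthogonal to Z_j and to itself and pairs to 2 with X.
This transfers regularity from D to □; pairing with Z_j does the same for ∇_j. -/
theorem box_eq_contract (s : ℂ) (φ : Form n k V) (x : E n) :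
    box s φ x = ∑ a, (1 / 2 * ((sgn a : ℂ) * (lc 0 0 1 : Idx n → ℝ) a)) • tracD s a φ x := by
  simp only [mul_smul (1 / 2 : ℂ), ← Finset.smul_sum]
  rw [contract_tracD, lform_infinity_cone, lform_infinity_infinity]
  simp only [lform_infinity_tangent]
  simp [smul_smul]

theorem nabla_eq_contract (s : ℂ) (j : Fin n) (φ : Form n k V) (x : E n) :
    nabla s j φ x = ∑ a, (1 / 4 * ((sgn a : ℂ) * tangentLift x j a)) • tracD s a φ x := by
  simp only [mul_smul (1 / 4 : ℂ), ← Finset.smul_sum]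
  rw [contract_tracD, lform_tangent_cone, lform_tangent_infinity]
  simp only [lform_tangent_tangent]
  have : ∀ i, (((if j = i then -4 else 0 : ℝ) : ℝ) : ℂ) • nabla s i φ x =
      if j = i then (-4 : ℂ) • nabla s i φ x else 0 := fun i => by split_ifs <;> simp
  simp only [this, Finset.sum_ite_eq, Finset.mem_univ, if_true]
  simp [smul_smul]

end

/-- The terms of the tractor `D`-operator. -/
def tracPart {V : Type*} [NormedAddCommGroup V] [NormedSpace ℝ V] [NormedSpace ℂ V]
    [SMulCommClass ℝ ℂ V] (s : ℂ) (φ : Form n k V) : Idx n → Form n k V :=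
  Sum.elim (fun _ => box s φ) (Sum.elim (fun j => nabla s j φ) (fun _ => φ))

/-- The coefficients of the tractor `D`-operator. -/
def tracFrame (n k : ℕ) (s : ℂ) (x : E n) (a : Idx n) : Idx n → ℂ :=
  Sum.elim (fun _ => (coneLift x a : ℂ)) (Sum.elim (fun j => -(tangentLift x j a : ℂ))
    (fun _ => -(coefC n k s * ((lc 0 0 1 : Idx n → ℝ) a : ℂ))))

theorem onY_tracD (t : ℂ) (a : Idx n) (φ : BiForm n k l) (p : E n × E n) :
    onY (tracD t a) φ p = ∑ i, tracFrame n l t p.2 a i • onY (fun ψ => tracPart t ψ i) φ p := by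
  simp only [onY, tracD, tracFrame, tracPart, Fintype.sum_sum_type, Sum.elim_inl, Sum.elim_inr,
    Finset.univ_unique, Finset.sum_singleton, ← swapL_apply, map_sub, map_smul, map_sum, neg_smul,
    Finset.sum_neg_distrib]
  abel

/-- The source operator is a contraction of two tractor `D`-operators. -/
theorem opE_eq_tracD (s t : ℂ) {φ : BiForm n k l} {p : E n × E n}
    (h : ∀ i, TwiceDiffAt (fun x => onY (fun ψ => tracPart t ψ i) φ (x, p.2)) p.1) :
    opE s t φ p = -(1 / 2 : ℂ) • ∑ a : Idx n, (sgn a : ℂ) • onX (tracD s a) (onY (tracD t a) φ) p := by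
  set f : Idx n → Form n k (Lam n l) := fun i x => onY (fun ψ => tracPart t ψ i) φ (x, p.2) with hf
  -- For fixed y the frame coefficients of the inner D are constants, so the outer D passes through
  -- them.
  have h1 : ∀ a, onX (tracD s a) (onY (tracD t a) φ) p =
      ∑ i, tracFrame n l t p.2 a i • tracD s a (f i) p.1 := by
    intro a
    rw [← tracD_sum_smul s a _ h, onX]
    simp only [onY_tracD, hf]
  have h2 : ∀ v : Idx n → ℝ, ∀ (ψ : Form n k (Lam n l)),
      ∑ a, (sgn a : ℂ) • (v a : ℂ) • tracD s a ψ p.1 =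
        (lform v (coneLift p.1) : ℂ) • box s ψ p.1
      - ∑ j, (lform v (tangentLift p.1 j) : ℂ) • nabla s j ψ p.1
      - (coefC n k s * (lform v (lc 0 0 1) : ℂ)) • ψ p.1 := by
    intro v ψ
    rw [← contract_tracD]
    exact Finset.sum_congr rfl fun a _ => smul_smul _ _ _
  have h3 : ∑ a : Idx n, (sgn a : ℂ) • onX (tracD s a) (onY (tracD t a) φ) p =
      ∑ i, ∑ a, (sgn a : ℂ) • tracFrame n l t p.2 a i • tracD s a (f i) p.1 := by
    simp only [h1, Finset.smul_sum]
    rw [Finset.sum_comm]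
  have h4 : ∀ i j : Fin n, ∀ T : BiLam n k l, (((if i = j then -4 else 0 : ℝ) : ℝ) : ℂ) • T =
      if i = j then (-4 : ℂ) • T else 0 := fun i j T => by split_ifs <;> simp
  set B := f (Sum.inl ())
  set N : Fin n → Form n k (Lam n l) := fun j => f (Sum.inr (Sum.inl j))
  set F := f (Sum.inr (Sum.inr ()))
  -- Each of the next three identities pairs one frame vector at y (X, then Z_j, then Y) with the
  -- whole frame at x.
  have e1 : ∑ a, (sgn a : ℂ) • tracFrame n l t p.2 a (Sum.inl ()) • tracD s a B p.1 =
      ((2 * ‖p.1 - p.2‖ ^ 2 : ℝ) : ℂ) • box s B p.1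
        - ∑ j, ((4 * (p.1 j - p.2 j) : ℝ) : ℂ) • nabla s j B p.1 - (coefC n k s * 2) • B p.1 := by
    have := h2 (coneLift p.2) B
    simp only [lform_cone_cone, lform_cone_tangent, lform_cone_infinity] at this
    exact_mod_cast this
  have e2 : ∀ j, ∑ a, (sgn a : ℂ) • tracFrame n l t p.2 a (Sum.inr (Sum.inl j)) •
      tracD s a (N j) p.1 = ((4 * (p.1 j - p.2 j) : ℝ) : ℂ) • box s (N j) p.1
        - (4 : ℂ) • nabla s j (N j) p.1 := by
    intro j
    have := h2 (tangentLift p.2 j) (N j)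
    simp only [lform_tangent_cone, lform_tangent_tangent, lform_tangent_infinity, h4,
      Finset.sum_ite_eq, Finset.mem_univ, if_true] at this
    have h5 : ∀ a, tracFrame n l t p.2 a (Sum.inr (Sum.inl j)) = -(tangentLift p.2 j a : ℂ) :=
      fun a => rfl
    simp only [h5, neg_smul, smul_neg, Finset.sum_neg_distrib, this]
    push_cast
    module
  have e3 : ∑ a, (sgn a : ℂ) • tracFrame n l t p.2 a (Sum.inr (Sum.inr ())) • tracD s a F p.1 =
      (-(coefC n l t * 2)) • box s F p.1 := by
    have := h2 (lc 0 0 1) F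
    simp only [lform_infinity_cone, lform_infinity_tangent, lform_infinity_infinity,
      Complex.ofReal_zero, zero_smul, mul_zero, Finset.sum_const_zero, sub_zero] at this
    have h5 : ∀ a, tracFrame n l t p.2 a (Sum.inr (Sum.inr ())) =
      -coefC n l t * ((lc 0 0 1 : Idx n → ℝ) a : ℂ) := fun a => (neg_mul _ _).symm
    simp only [h5, mul_smul, smul_comm _ (-coefC n l t), ← Finset.smul_sum, this]
    push_cast
    module
  rw [h3, Fintype.sum_sum_type, Fintype.sum_sum_type]
  simp only [Finset.univ_unique, Finset.sum_singleton]
  rw [show (default : Unit) = () from rfl, e1, e3, Finset.sum_congr rfl fun j _ => e2 j, opE]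
  have g1 : onX (box s) (onY (box t) φ) p = box s B p.1 := rfl
  have g2 : ∀ j, onX (nabla s j) (onY (box t) φ) p = nabla s j B p.1 := fun _ => rfl
  have g3 : ∀ j, onX (box s) (onY (nabla t j) φ) p = box s (N j) p.1 := fun _ => rfl
  have g4 : ∀ j, onX (nabla s j) (onY (nabla t j) φ) p = nabla s j (N j) p.1 := fun _ => rfl
  have g5 : onX (box s) φ p = box s F p.1 := rfl
  have g6 : onY (box t) φ p = B p.1 := rfl
  simp only [g1, g2, g3, g4, g5, g6, Finset.sum_sub_distrib, smul_sub]
  simp only [Complex.ofReal_mul, mul_smul, ← Finset.smul_sum, coefC]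
  push_cast
  module

end Contraction

/-! ### Covariance of the source operator -/

section SourceCovariance

open Filter Topology

variable {n k l : ℕ}

/-- `pullLam` as a complex linear map. -/
def pullC {p : ℕ} (A : E n →L[ℝ] E n) : Lam n p →L[ℂ] Lam n p where
  toFun := pullLam A
  map_add' _ _ := rfl
  map_smul' _ _ := rfl
  cont := (pullLam A).cont

theorem IsLorentz.sum_sgn {g : Matrix (Idx n) (Idx n) ℝ} (hg : IsLorentz g) (c d : Idx n) :
    ∑ a, (sgn a : ℂ) * (g a c : ℂ) * (g a d : ℂ) = if c = d then (sgn c : ℂ) else 0 := by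
  have h := congrFun (congrFun (show gᵀ * lorentz n * g = lorentz n from hg) c) d
  have h1 : ∑ a, sgn a * g a c * g a d = if c = d then sgn c else 0 := by
    rw [lorentz, Matrix.diagonal_apply, Matrix.mul_apply] at h
    simp only [Matrix.mul_diagonal, Matrix.transpose_apply] at h
    refine Eq.trans (Finset.sum_congr rfl fun a _ => ?_) h
    rw [sgn]; ring
  have h2 := congrArg (fun r : ℝ => (r : ℂ)) h1
  push_cast at h2
  rw [h2]
  split_ifs <;> simp

theorem contDiff_coneLift_apply (a : Idx n) : ContDiff ℝ ∞ fun x : E n => coneLift x a := by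
  have h : ∀ j, ContDiff ℝ ∞ fun x : E n => x j := fun j =>
    (EuclideanSpace.proj j : E n →L[ℝ] ℝ).contDiff
  have hi : ContDiff ℝ ∞ fun x : E n => (inner ℝ x x : ℝ) := contDiff_id.inner ℝ contDiff_id
  rcases a with ⟨⟩ | i | ⟨⟩
  · exact contDiff_const.add hi
  · exact contDiff_const.mul (h i)
  · exact contDiff_const.sub hi

theorem contDiff_tangentLift_apply (j : Fin n) (a : Idx n) :
    ContDiff ℝ ∞ fun x : E n => tangentLift x j a := by
  have h : ContDiff ℝ ∞ fun x : E n => 2 * x j :=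
    contDiff_const.mul (EuclideanSpace.proj j : E n →L[ℝ] ℝ).contDiff
  rcases a with ⟨⟩ | i | ⟨⟩
  · exact contDiff_const.add h
  · exact contDiff_const
  · exact contDiff_const.sub h

theorem isMixedOp_onY_tracPart (t : ℂ) (i : Idx n) :
    IsMixedOp (onY (k := k) (l := l) (fun ψ => tracPart t ψ i)) := by
  rcases i with ⟨⟩ | j | ⟨⟩
  · exact isMixedOp_onY_box t
  · exact isMixedOp_onY_nabla t j
  · exact IsMixedOp.id

theorem isMixedOp_onY_tracD (t : ℂ) (a : Idx n) :
    IsMixedOp (onY (k := k) (l := l) (tracD t a)) := by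
  have hf : ∀ i, ContDiff ℝ ∞ fun p : E n × E n => tracFrame n l t p.2 a i := by
    rintro (⟨⟩ | j | ⟨⟩)
    · exact Complex.ofRealCLM.contDiff.comp ((contDiff_coneLift_apply a).comp contDiff_snd)
    · exact (Complex.ofRealCLM.contDiff.comp
        ((contDiff_tangentLift_apply j a).comp contDiff_snd)).neg
    · exact contDiff_const
  exact (IsMixedOp.sum fun i => (isMixedOp_onY_tracPart t i).smul (hf i)).congr fun φ _ p =>
    onY_tracD t a φ p

variable {g : Matrix (Idx n) (Idx n) ℝ}

/-- The conformal pullback in the first variable. -/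
abbrev pullX (lam : ℂ) (g : Matrix (Idx n) (Idx n) ℝ) (f : Form n k (Lam n l)) :
    Form n k (Lam n l) := confPull lam (act g⁻¹) (fderiv ℝ (act g⁻¹)) (Omega g⁻¹) f

/-- The pullback of values at a fixed second variable. -/
def fiberPull (mu : ℂ) (g : Matrix (Idx n) (Idx n) ℝ) (y : E n) : BiLam n k l →L[ℂ] BiLam n k l :=
  postComp (((Omega g⁻¹ y : ℂ) ^ mu) • pullC (fderiv ℝ (act g⁻¹) y))

/-- For fixed y the action on the second factor is a constant linear map of the values, so only a
conformal pullback in x remains. -/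
theorem tensorRep_eq_pullX (lam mu : ℂ) (φ : BiForm n k l) (x y : E n) :
    tensorRep lam mu g φ (x, y) =
      pullX lam g (fun x' => fiberPull mu g y (φ (x', act g⁻¹ y))) x := by
  ext v : 1
  refine Lam.ext fun w => ?_
  change (_ * _ : ℂ) * _ = _ * (_ * _)
  rw [mul_assoc]
  rfl

/-- Covariance of D in the variable y with x frozen: the action in x is a postcomposition on the
values, through which D passes. -/
theorem onY_tracD_tensorRep (hn : 1 ≤ n) (hg : g ∈ G n) {y : E n} (hy : DefinedAt g⁻¹ y)
    (lam mu : ℂ) {φ : BiForm n k l} (hφ : ContDiff ℝ ∞ φ) (a : Idx n) (x : E n) :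
    onY (tracD (n - 2 * (mu + l)) a) (tensorRep lam mu g φ) (x, y) =
      ∑ c, (g a c : ℂ) • pullX lam g (fun x' => fiberPull (mu + 1) g y
        (onY (tracD (n - 2 * (mu + l)) c) φ (x', act g⁻¹ y))) x := by
  set P : Lam n k →L[ℂ] Lam n k := ((Omega g⁻¹ x : ℂ) ^ lam) • pullC (fderiv ℝ (act g⁻¹) x) with hP
  set χ : Form n l (Lam n k) := fun y' => swap (φ (act g⁻¹ x, y')) with hχ
  have hχs : ContDiff ℝ ∞ χ := contDiff_swap_sliceY hφ _
  have h1 : (fun y' => swap (tensorRep lam mu g φ (x, y'))) =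
      confPull mu (act g⁻¹) (fderiv ℝ (act g⁻¹)) (Omega g⁻¹) (fun y' => postComp P (χ y')) := by
    funext y'
    ext w : 1
    refine Lam.ext fun v => ?_
    change (_ * _ : ℂ) * _ = _ * (_ * _)
    rw [mul_assoc, mul_left_comm]
    rfl
  have h2 := (tracD_covariant hn hg hy mu (φ := fun y' => postComp P (χ y'))
    (((postComp P).restrictScalars ℝ).contDiff.comp hχs)).2 a
  have h3 : ∀ c, tracD (n - 2 * (mu + l)) c (fun y' => postComp P (χ y')) =
      fun y' => postComp P (tracD (n - 2 * (mu + l)) c χ y') := fun c => funext fun y' =>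
    (commutesN_postComp P).tracD _ c hχs.contDiffAt.twiceDiffAt
  rw [onY, h1, h2, ← swapL_apply, map_sum]
  refine Finset.sum_congr rfl fun c _ => ?_
  rw [map_smul, h3, swapL_apply]
  congr 1
  ext v : 1
  refine Lam.ext fun w => ?_
  change (_ : ℂ) * (_ * _) = _ * (_ * _)
  rw [mul_left_comm]
  rfl

/-- The transformed form need not be smooth everywhere, so the regularity required by the outer
operator is extracted from the covariance formula, whose right side is a sum of pullbacks of smooth
forms. -/
theorem twiceDiffAt_onY_tracD_tensorRep (hn : 1 ≤ n) (hg : g ∈ G n) {x y : E n}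
    (hx : DefinedAt g⁻¹ x) (hy : DefinedAt g⁻¹ y) (lam mu : ℂ) {φ : BiForm n k l}
    (hφ : ContDiff ℝ ∞ φ) (a : Idx n) :
    TwiceDiffAt (fun x' => onY (tracD (n - 2 * (mu + l)) a) (tensorRep lam mu g φ) (x', y)) x := by
  rw [funext (onY_tracD_tensorRep hn hg hy lam mu hφ a)]
  refine TwiceDiffAt.sum_smul (fun c => (g a c : ℂ)) fun c => ?_
  exact (tracD_covariant hn hg hx lam (((fiberPull (mu + 1) g y).restrictScalars ℝ).contDiff.comp
    (contDiff_sliceX ((isMixedOp_onY_tracD _ c).contDiff hφ) _))).1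

/-- For fixed y, □ and ∇_j in the variable y are constant combinations of the components of D, so
they inherit the regularity in x. -/
theorem twiceDiffAt_onY_tracPart_tensorRep (hn : 1 ≤ n) (hg : g ∈ G n) {x y : E n}
    (hx : DefinedAt g⁻¹ x) (hy : DefinedAt g⁻¹ y) (lam mu : ℂ) {φ : BiForm n k l}
    (hφ : ContDiff ℝ ∞ φ) (i : Idx n) :
    TwiceDiffAt (fun x' => onY (fun ψ => tracPart (n - 2 * (mu + l)) ψ i)
      (tensorRep lam mu g φ) (x', y)) x := by
  have h := twiceDiffAt_onY_tracD_tensorRep hn hg hx hy lam mu hφ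
  rcases i with ⟨⟩ | j | ⟨⟩
  · have e : ∀ x', onY (fun ψ => tracPart (n - 2 * (mu + l)) ψ (Sum.inl ()))
        (tensorRep lam mu g φ) (x', y) = ∑ a, (1 / 2 * ((sgn a : ℂ) * (lc 0 0 1 : Idx n → ℝ) a)) •
          onY (tracD (n - 2 * (mu + l)) a) (tensorRep lam mu g φ) (x', y) := by
      intro x'
      have := congrArg (swapL n l k) (box_eq_contract (n - 2 * (mu + l))
        (fun y' => swap (tensorRep lam mu g φ (x', y'))) y)
      rw [map_sum] at this
      simp only [map_smul] at this
      exact this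
    rw [funext e]
    exact TwiceDiffAt.sum_smul _ h
  · have e : ∀ x', onY (fun ψ => tracPart (n - 2 * (mu + l)) ψ (Sum.inr (Sum.inl j)))
        (tensorRep lam mu g φ) (x', y) = ∑ a, (1 / 4 * ((sgn a : ℂ) * tangentLift y j a)) •
          onY (tracD (n - 2 * (mu + l)) a) (tensorRep lam mu g φ) (x', y) := by
      intro x'
      have := congrArg (swapL n l k) (nabla_eq_contract (n - 2 * (mu + l)) j
        (fun y' => swap (tensorRep lam mu g φ (x', y'))) y)
      rw [map_sum] at this
      simp only [map_smul] at this
      exact this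
    rw [funext e]
    exact TwiceDiffAt.sum_smul _ h
  · have e : ∀ x', onY (fun ψ => tracPart (n - 2 * (mu + l)) ψ (Sum.inr (Sum.inr ())))
        (tensorRep lam mu g φ) (x', y) = _ := fun x' => tensorRep_eq_pullX lam mu φ x' y
    rw [funext e]
    exact (tracD_covariant hn hg hx lam (((fiberPull mu g y).restrictScalars ℝ).contDiff.comp
      (contDiff_sliceX hφ _))).1

/-- Conformal covariance of the source operator. -/
theorem sourceOp_covariant (hn : 1 ≤ n) (hg : g ∈ G n) {p : E n × E n}
    (hx : DefinedAt g⁻¹ p.1) (hy : DefinedAt g⁻¹ p.2) (lam mu : ℂ) {φ : BiForm n k l}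
    (hφ : ContDiff ℝ ∞ φ) :
    sourceOp (lam + k) (mu + l) (tensorRep lam mu g φ) p =
      tensorRep (lam + 1) (mu + 1) g (sourceOp (lam + k) (mu + l) φ) p := by
  obtain ⟨x, y⟩ := p
  set s : ℂ := n - 2 * (lam + k) with hs
  set t : ℂ := n - 2 * (mu + l) with ht
  set O : Idx n → Form n k (Lam n l) := fun c x' => onY (tracD t c) φ (x', act g⁻¹ y) with hO
  have hOs : ∀ c, ContDiff ℝ ∞ (O c) := fun c =>
    contDiff_sliceX ((isMixedOp_onY_tracD t c).contDiff hφ) _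
  have hMO : ∀ c, ContDiff ℝ ∞ fun x' => fiberPull (mu + 1) g y (O c x') := fun c =>
    ((fiberPull (mu + 1) g y).restrictScalars ℝ).contDiff.comp (hOs c)
  set Q : BiLam n k l →ₗ[ℂ] BiLam n k l := scaledPull ((Omega g⁻¹ x : ℂ) ^ (lam + 1))
    (fderiv ℝ (act g⁻¹) x) ∘ₗ (fiberPull (mu + 1) g y).toLinearMap with hQ
  have h1 : ∀ a, onX (tracD s a) (onY (tracD t a) (tensorRep lam mu g φ)) (x, y) =
      ∑ c, ∑ d, ((g a c : ℂ) * (g a d : ℂ)) • Q (tracD s d (O c) (act g⁻¹ x)) := by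
    intro a
    rw [onX]
    simp only [onY_tracD_tensorRep hn hg hy lam mu hφ a, t]
    rw [tracD_sum_smul s a (fun c => (g a c : ℂ)) fun c => (tracD_covariant hn hg hx lam (hMO c)).1]
    refine Finset.sum_congr rfl fun c _ => ?_
    rw [(tracD_covariant hn hg hx lam (hMO c)).2 a, Finset.smul_sum]
    refine Finset.sum_congr rfl fun d _ => ?_
    rw [smul_smul]
    congr 1
    have : tracD s d (fun x' => fiberPull (mu + 1) g y (O c x')) (act g⁻¹ x) =
        fiberPull (mu + 1) g y (tracD s d (O c) (act g⁻¹ x)) :=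
      (commutesN_postComp _).tracD s d (hOs c).contDiffAt.twiceDiffAt
    rw [hQ, LinearMap.comp_apply]
    exact congrArg (scaledPull ((Omega g⁻¹ x : ℂ) ^ (lam + 1)) (fderiv ℝ (act g⁻¹) x)) this
  -- The two factors g disappear because ∑_a ± g_ac g_ad equals ± δ_cd.
  have h2 : ∑ a : Idx n, (sgn a : ℂ) • onX (tracD s a) (onY (tracD t a) (tensorRep lam mu g φ)) (x, y)
      = Q (∑ c : Idx n, (sgn c : ℂ) • onX (tracD s c) (onY (tracD t c) φ) (act g⁻¹ x, act g⁻¹ y)) := by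
    simp only [h1, Finset.smul_sum, smul_smul, ← mul_assoc]
    rw [Finset.sum_comm]
    have h3 : ∀ c : Idx n, ∑ a, ∑ d, ((sgn a : ℂ) * (g a c : ℂ) * (g a d : ℂ)) •
        Q (tracD s d (O c) (act g⁻¹ x)) = (sgn c : ℂ) • Q (tracD s c (O c) (act g⁻¹ x)) := by
      intro c
      rw [Finset.sum_comm]
      simp only [← Finset.sum_smul, (isLorentz_of_mem_G hg).sum_sgn, ite_smul, zero_smul,
        Finset.sum_ite_eq, Finset.mem_univ, if_true]
    simp only [h3, map_sum, map_smul]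
    rfl
  have h4 : opE s t (tensorRep lam mu g φ) (x, y) = Q (opE s t φ (act g⁻¹ x, act g⁻¹ y)) := by
    rw [opE_eq_tracD s t (twiceDiffAt_onY_tracPart_tensorRep hn hg hx hy lam mu hφ), h2,
      opE_eq_tracD s t fun i => (contDiff_sliceX
        ((isMixedOp_onY_tracPart t i).contDiff hφ) _).contDiffAt.twiceDiffAt, map_smul]
  have h5 : sourceOp (lam + k) (mu + l) (tensorRep lam mu g φ) (x, y) =
      -opE s t (tensorRep lam mu g φ) (x, y) := rfl
  rw [h5, h4, ← map_neg, tensorRep_eq_pullX]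
  rfl

end SourceCovariance

/-! ### Locality of the source operator and covariance of its iterates -/

section SourceLocality

open Filter Topology

variable {n k l : ℕ}

theorem onY_congr {A : Form n l (Lam n k) → Form n l (Lam n k)}
    (hA : ∀ f f' x, f =ᶠ[𝓝 x] f' → A f x = A f' x) {φ φ' : BiForm n k l} {U : Set (E n)}
    (hU : IsOpen U) (h : ∀ x ∈ U, ∀ y ∈ U, φ (x, y) = φ' (x, y)) :
    ∀ x ∈ U, ∀ y ∈ U, onY A φ (x, y) = onY A φ' (x, y) := by
  intro x hx y hy
  refine congrArg swap (hA _ _ _ ?_)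
  filter_upwards [hU.mem_nhds hy] with y' hy'
  exact congrArg swap (h x hx y' hy')

theorem onX_congr {A : Form n k (Lam n l) → Form n k (Lam n l)}
    (hA : ∀ f f' x, f =ᶠ[𝓝 x] f' → A f x = A f' x) {φ φ' : BiForm n k l} {U : Set (E n)}
    (hU : IsOpen U) (h : ∀ x ∈ U, ∀ y ∈ U, φ (x, y) = φ' (x, y)) :
    ∀ x ∈ U, ∀ y ∈ U, onX A φ (x, y) = onX A φ' (x, y) := by
  intro x hx y hy
  refine hA _ _ _ ?_
  filter_upwards [hU.mem_nhds hx] with x' hx'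
  exact h x' hx' y hy

theorem sourceOp_congr (lam mu : ℂ) {φ φ' : BiForm n k l} {U : Set (E n)}
    (hU : IsOpen U) (h : ∀ x ∈ U, ∀ y ∈ U, φ (x, y) = φ' (x, y)) :
    ∀ x ∈ U, ∀ y ∈ U, sourceOp lam mu φ (x, y) = sourceOp lam mu φ' (x, y) := by
  have hb := onY_congr (A := box (n - 2 * mu)) (fun _ _ _ h => box_congr h _) hU h
  have hn := fun j => onY_congr (A := nabla (n - 2 * mu) j) (fun _ _ _ h => nabla_congr h _ j) hU h
  have Xb : ∀ {φ φ' : BiForm n k l}, (∀ x ∈ U, ∀ y ∈ U, φ (x, y) = φ' (x, y)) →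
      ∀ x ∈ U, ∀ y ∈ U, onX (box (n - 2 * lam)) φ (x, y) = onX (box (n - 2 * lam)) φ' (x, y) :=
    fun h => onX_congr (fun _ _ _ h => box_congr h _) hU h
  have Xn : ∀ {φ φ' : BiForm n k l}, (∀ x ∈ U, ∀ y ∈ U, φ (x, y) = φ' (x, y)) →
      ∀ j, ∀ x ∈ U, ∀ y ∈ U,
        onX (nabla (n - 2 * lam) j) φ (x, y) = onX (nabla (n - 2 * lam) j) φ' (x, y) :=
    fun h j => onX_congr (fun _ _ _ h => nabla_congr h _ j) hU h
  intro x hx y hy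
  refine congrArg (fun T : BiLam n k l => -T) ?_
  simp only [opE, Xb hb x hx y hy, Xn hb _ x hx y hy, Xb (hn _) x hx y hy, Xn (hn _) _ x hx y hy,
    Xb h x hx y hy, hb x hx y hy]

/-- The sum of the first and last coordinates of g⁻¹ X is 2p, a continuous function of x, and g⁻¹ is
defined where it does not vanish. -/
theorem isOpen_definedAt {g : Matrix (Idx n) (Idx n) ℝ} (hg : g ∈ G n) :
    IsOpen {x : E n | DefinedAt g⁻¹ x} := by
  have h : {x : E n | DefinedAt g⁻¹ x} = {x : E n | (g⁻¹ *ᵥ coneLift x) (Sum.inl ()) +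
      (g⁻¹ *ᵥ coneLift x) (Sum.inr (Sum.inr ())) ≠ 0} := by
    ext x
    obtain ⟨p, u, q, h⟩ := exists_eq_lc (g⁻¹ *ᵥ coneLift x)
    rw [Set.mem_ofPred_eq, Set.mem_ofPred_eq,
      definedAt_iff _ _ h ((isLorentz_of_mem_G hg).inv.coneLift_ne h), h]
    have : (lc p u q : Idx n → ℝ) (Sum.inl ()) + (lc p u q : Idx n → ℝ) (Sum.inr (Sum.inr ())) = 2 * p := by
      simp only [lc, Sum.elim_inl, Sum.elim_inr]; ring
    rw [this]
    simp
  have hc : Continuous fun x : E n => g⁻¹ *ᵥ coneLift x :=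
    continuous_const.matrix_mulVec (continuous_pi fun a => (contDiff_coneLift_apply a).continuous)
  rw [h]
  exact isOpen_ne_fun (((continuous_apply _).comp hc).add ((continuous_apply _).comp hc))
    continuous_const

/-- The inductive identity holds on U × U with U open, so locality allows it to be inserted into the
next F, which then raises both weights by one. -/
theorem sourceIter_covariant (hn : 1 ≤ n) {g : Matrix (Idx n) (Idx n) ℝ} (hg : g ∈ G n)
    (lam mu : ℂ) {φ : BiForm n k l} (hφ : ContDiff ℝ ∞ φ) (m : ℕ) :
    ∀ x ∈ {x : E n | DefinedAt g⁻¹ x}, ∀ y ∈ {x : E n | DefinedAt g⁻¹ x},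
      sourceIter (lam + k) (mu + l) m (tensorRep lam mu g φ) (x, y) =
        tensorRep (lam + m) (mu + m) g (sourceIter (lam + k) (mu + l) m φ) (x, y) := by
  induction m with
  | zero => intro x _ y _; simp [sourceIter]
  | succ m ih =>
    intro x hx y hy
    have e : ∀ c : ℂ, c + ((m + 1 : ℕ) : ℂ) = c + m + 1 := fun c => by push_cast; ring
    have hx' : DefinedAt g⁻¹ x := hx
    have hy' : DefinedAt g⁻¹ y := hy
    have h1 : sourceOp (lam + m + k) (mu + m + l) (sourceIter (lam + k) (mu + l) m (tensorRep lam mu g φ)) (x, y) =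
        sourceOp (lam + m + k) (mu + m + l)
          (tensorRep (lam + m) (mu + m) g (sourceIter (lam + k) (mu + l) m φ)) (x, y) :=
      sourceOp_congr _ _ (isOpen_definedAt hg) ih x hx y hy
    have h2 := sourceOp_covariant hn hg (p := (x, y)) hx' hy' (lam + m) (mu + m)
      ((isMixedOp_sourceIter (lam + k) (mu + l) m).contDiff hφ)
    have h3 : ∀ ψ : BiForm n k l, sourceIter (lam + k) (mu + l) (m + 1) ψ =
        sourceOp (lam + m + k) (mu + m + l) (sourceIter (lam + k) (mu + l) m ψ) := fun ψ => by
      rw [sourceIter, add_right_comm lam (k : ℂ), add_right_comm mu (l : ℂ)]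
    rw [h3, h3, e, e]
    exact h1.trans h2

end SourceLocality

/-! ### Unitarity of σ_k ⊗ σ_ℓ and equivariance of p_Γ -/

section Unitarity

variable {n k l : ℕ}

theorem matMap_e (m : Matrix (Fin n) (Fin n) ℝ) (a : Fin n) : matMap m (e a) = ∑ c, m c a • e c := by
  ext i
  rw [matMap_apply]
  simp [e_apply]

theorem comps_apply (T : BiLam n k l) (a : (Fin k → Fin n) × (Fin l → Fin n)) :
    comps T a = T (fun i => e (a.1 i)) (fun i => e (a.2 i)) := rfl

theorem comps_pull (m : Matrix (Fin n) (Fin n) ℝ) (T : BiLam n k l)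
    (a : (Fin k → Fin n) × (Fin l → Fin n)) :
    comps (pull (matMap m) (matMap m) T) a =
      ∑ c : (Fin k → Fin n) × (Fin l → Fin n),
        ((∏ i, m (c.1 i) (a.1 i) : ℝ) * (∏ i, m (c.2 i) (a.2 i) : ℝ) : ℂ) * comps T c := by
  have hX : ∀ (S : Lam n l) (b : Fin l → Fin n), S (fun i => matMap m (e (b i))) =
      ∑ d : Fin l → Fin n, ((∏ i, m (d i) (b i) : ℝ) : ℂ) * S (fun i => e (d i)) := by
    intro S b
    simp only [matMap_e]
    refine ((S : E n [⋀^Fin l]→L[ℝ] ℂ).toContinuousMultilinearMap.map_sum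
      (fun i c => m c (b i) • e c)).trans (Finset.sum_congr rfl fun d _ => ?_)
    refine ((S : E n [⋀^Fin l]→L[ℝ] ℂ).toContinuousMultilinearMap.map_smul_univ
      (fun i => m (d i) (b i)) (fun i => e (d i))).trans ?_
    rw [Complex.real_smul]
    rfl
  have hY : T (fun i => matMap m (e (a.1 i))) =
      ∑ c : Fin k → Fin n, (∏ i, m (c i) (a.1 i)) • T (fun i => e (c i)) := by
    simp only [matMap_e]
    refine (T.toContinuousMultilinearMap.map_sum
      (fun i c => m c (a.1 i) • e c)).trans (Finset.sum_congr rfl fun c _ => ?_)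
    exact T.toContinuousMultilinearMap.map_smul_univ _ _
  rw [comps_apply, pull_apply, hY, Fintype.sum_prod_type]
  have hev : ∀ (f : (Fin k → Fin n) → Lam n l) (w : Fin l → E n), (∑ c, f c) w = ∑ c, f c w :=
    fun f w => map_sum (⟨⟨fun S : Lam n l => S w, rfl⟩, fun _ _ => rfl⟩ : Lam n l →+ ℂ) f _
  rw [hev]
  refine Finset.sum_congr rfl fun c _ => ?_
  rw [Lam.real_smul_apply, hX, Complex.real_smul, Finset.mul_sum]
  exact Finset.sum_congr rfl fun d _ => by rw [← mul_assoc]; rfl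

/-- On components the pullback is a matrix with real entries, products of entries of m, so its
adjoint is the pullback by the transpose. -/
theorem inner_comps_pull (m : Matrix (Fin n) (Fin n) ℝ) (S T : BiLam n k l) :
    inner ℂ (comps S) (comps (pull (matMap m) (matMap m) T)) =
      inner ℂ (comps (pull (matMap mᵀ) (matMap mᵀ) S)) (comps T) := by
  simp only [PiLp.inner_apply, RCLike.inner_apply, comps_pull, map_sum, map_mul, Finset.sum_mul,
    Finset.mul_sum, Complex.conj_ofReal, Matrix.transpose_apply]
  rw [Finset.sum_comm]
  exact Finset.sum_congr rfl fun a _ => Finset.sum_congr rfl fun b _ => by ring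

theorem sigmaBi_mem_orth (Γ : Subrepresentation (sigmaBi n k l)) (m : SO n) {T : BiLam n k l}
    (hT : T ∈ orth Γ.toSubmodule) : sigmaBi n k l m T ∈ orth Γ.toSubmodule := by
  intro S' hS'
  obtain ⟨S, hS, rfl⟩ := hS'
  have h1 : sigmaBi n k l m T = pull (matMap ((m⁻¹ : SO n) : Matrix _ _ ℝ))
    (matMap ((m⁻¹ : SO n) : Matrix _ _ ℝ)) T := rfl
  rw [h1, inner_comps_pull]
  -- The inverse in SO(n) is the transpose, so the adjoint of σ(m) is σ(m⁻¹), which preserves Γ.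
  refine hT _ ⟨sigmaBi n k l m⁻¹ S, Γ.apply_mem_toSubmodule _ hS, ?_⟩
  rfl

/-- The orthogonal complement of an invariant subspace is invariant. -/
def orthRep (Γ : Subrepresentation (sigmaBi n k l)) : Subrepresentation (sigmaBi n k l) :=
  ⟨orth Γ.toSubmodule, fun m _ hT => sigmaBi_mem_orth Γ m hT⟩

theorem proj_of_mem {W : Submodule ℂ (BiLam n k l)} {T : BiLam n k l} (hT : T ∈ W) :
    proj W T = ⟨T, hT⟩ := Submodule.projectionOnto_apply_of_mem_left _ hT

theorem proj_of_mem_orth {W : Submodule ℂ (BiLam n k l)} {T : BiLam n k l} (hT : T ∈ orth W) :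
    proj W T = 0 := (Submodule.projectionOnto_apply_eq_zero_iff _).mpr hT

theorem proj_sigmaBi (Γ : Subrepresentation (sigmaBi n k l)) (m : SO n) (T : BiLam n k l) :
    proj Γ.toSubmodule (sigmaBi n k l m T) = Γ.toRepresentation m (proj Γ.toSubmodule T) := by
  obtain ⟨S, hS, R, hR, rfl⟩ := Submodule.mem_sup.mp
    ((isCompl_orth Γ.toSubmodule).sup_eq_top ▸ Submodule.mem_top (x := T))
  rw [map_add, map_add, map_add, proj_of_mem hS, proj_of_mem_orth hR,
    proj_of_mem (Γ.apply_mem_toSubmodule m hS), proj_of_mem_orth (sigmaBi_mem_orth Γ m hR), add_zero, add_zero]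
  rfl

end Unitarity

/-! ### Covariance of the operators B -/

section Covariance

variable {n k l : ℕ}

theorem pull_smul_smul (c : ℝ) (A : E n →L[ℝ] E n) (T : BiLam n k l) :
    pull (c • A) (c • A) T = ((c : ℂ) ^ (k + l)) • pull A A T := by
  ext v : 1
  refine Lam.ext fun w => ?_
  rw [pull_apply]
  have h1 : T (fun i => (c • A) (v i)) = c ^ k • T (fun i => A (v i)) := by
    refine (T.toContinuousMultilinearMap.map_smul_univ (fun _ => c) (fun i => A (v i))).trans ?_
    rw [Finset.prod_const, Finset.card_univ, Fintype.card_fin]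
    rfl
  have h2 : ∀ S : Lam n l, S (fun i => (c • A) (w i)) = c ^ l • S (fun i => A (w i)) := by
    intro S
    refine ((S : E n [⋀^Fin l]→L[ℝ] ℂ).toContinuousMultilinearMap.map_smul_univ (fun _ => c)
      (fun i => A (w i))).trans ?_
    rw [Finset.prod_const, Finset.card_univ, Fintype.card_fin]
    rfl
  rw [h1, Lam.real_smul_apply, h2, Complex.real_smul, Complex.real_smul]
  change _ = ((c : ℂ) ^ (k + l)) * T (fun i => A (v i)) (fun i => A (w i))
  push_cast
  ring

/-- On the diagonal the differential is e^{-t} m. The two conformal factors give the exponent λ+μ+2m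
and the homogeneity of bidegree (k, ℓ) adds k+ℓ, while the remaining pullback by the rotation is σ
of its inverse and commutes with p_Γ. -/
theorem isCovariant_opB (hn : 1 ≤ n) (Γ : Subrepresentation (sigmaBi n k l)) (lam mu : ℂ) (m : ℕ) :
    IsCovariant (opB Γ (lam + k) (mu + l) m) lam mu Γ.toRepresentation
      (lam + mu + k + l + 2 * m) := by
  intro g hg φ hφ x hx
  rw [opB, sourceIter_covariant hn hg lam mu hφ m x hx x hx, indRep, opB, tensorRep]
  obtain ⟨y, z, h⟩ := bruhat_spec hg hx
  set M := mPart (g⁻¹ * matNbar x)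
  set t := tPart (g⁻¹ * matNbar x)
  obtain ⟨hy, hD⟩ := act_inv_center h
  rw [Omega_inv_center hn h, hD, hy]
  rw [pull_smul_smul, smul_smul, map_smul]
  have hexp : ∀ c : ℂ, (Real.exp (-t) : ℂ) ^ c = Complex.exp (-(t * c)) := by
    intro c
    rw [Complex.cpow_def_of_ne_zero (by exact_mod_cast (Real.exp_pos (-t)).ne'),
      ← Complex.ofReal_log (Real.exp_pos (-t)).le, Real.log_exp]
    push_cast
    ring_nf
  have hsig : ∀ T, pull (matMap (M : Matrix (Fin n) (Fin n) ℝ)) (matMap (M : Matrix (Fin n) (Fin n) ℝ)) T =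
      sigmaBi n k l M⁻¹ T := by
    intro T
    change _ = pull (matMap ((M⁻¹⁻¹ : SO n) : Matrix (Fin n) (Fin n) ℝ))
      (matMap ((M⁻¹⁻¹ : SO n) : Matrix (Fin n) (Fin n) ℝ)) T
    rw [inv_inv]
  rw [hsig, proj_sigmaBi, ← Complex.cpow_natCast, hexp, hexp, hexp, ← Complex.exp_add,
    ← Complex.exp_add]
  congr 2
  push_cast
  ring

theorem isBiDifferential_opB (Γ : Subrepresentation (sigmaBi n k l)) (lam mu : ℂ) (m : ℕ) :
    IsBiDifferential (opB Γ lam mu m) :=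
  (isMixedOp_sourceIter lam mu m).isBiDifferential Γ.toSubmodule

end Covariance

/-! ### The copy of Λ^{k+ℓ} in Λ^k ⊗ Λ^ℓ -/

section WedgeProduct

variable {n k l : ℕ}

/-- `wedge` as a linear map. -/
def wedgeL (n k l : ℕ) : BiLam n k l →ₗ[ℂ] Lam n (k + l) where
  toFun := wedge
  map_add' S T := Lam.ext fun v => by
    rw [Lam.add_apply]
    simp only [wedge_apply, ← mul_add, ← Finset.sum_add_distrib]
    refine congrArg _ (Finset.sum_congr rfl fun σ _ => ?_)
    exact smul_add _ (S _ _) (T _ _)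
  map_smul' c T := Lam.ext fun v => by
    rw [RingHom.id_apply, Lam.smul_apply]
    simp only [wedge_apply, Finset.mul_sum]
    refine Finset.sum_congr rfl fun σ _ => ?_
    change _ * (_ • (c * T _ _)) = c * (_ * _)
    rw [← mul_smul_comm _ c, mul_left_comm]

theorem wedgeL_apply (T : BiLam n k l) : wedgeL n k l T = wedge T := rfl

theorem wedge_sigmaBi (g : SO n) (T : BiLam n k l) :
    wedge (sigmaBi n k l g T) = sigma n (k + l) g (wedge T) := Lam.ext fun v => by
  change _ = wedge T _
  rw [wedge_apply, wedge_apply]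
  rfl

/-- The decidability instance is arbitrary because the fields of a multilinear map quantify over
one. -/
theorem append_update_natAdd [inst : DecidableEq (Fin l)] {α : Type*} (v : Fin k → α) (w : Fin l → α)
    (i : Fin l) (x : α) : Fin.append v (Function.update w i x) =
      Function.update (Fin.append v w) (Fin.natAdd k i) x := by
  obtain rfl : inst = instDecidableEqFin l := Subsingleton.elim _ _
  funext j
  induction j using Fin.addCases with
  | left j =>
    rw [Fin.append_left, Function.update_of_ne, Fin.append_left]
    intro h
    have := congrArg Fin.val h
    simp only [Fin.val_castAdd, Fin.val_natAdd] at this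
    omega
  | right j =>
    rw [Fin.append_right]
    by_cases h : j = i
    · rw [h, Function.update_self, Function.update_self]
    · rw [Function.update_of_ne h, Function.update_of_ne (by simpa using h), Fin.append_right]

theorem append_update_castAdd [inst : DecidableEq (Fin k)] {α : Type*} (v : Fin k → α) (w : Fin l → α)
    (i : Fin k) (x : α) : Fin.append (Function.update v i x) w =
      Function.update (Fin.append v w) (Fin.castAdd l i) x := by
  obtain rfl : inst = instDecidableEqFin k := Subsingleton.elim _ _
  funext j
  induction j using Fin.addCases with
  | left j =>
    rw [Fin.append_left]
    by_cases h : j = i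
    · rw [h, Function.update_self, Function.update_self]
    · rw [Function.update_of_ne h, Function.update_of_ne (by simpa using h), Fin.append_left]
  | right j =>
    rw [Fin.append_right, Function.update_of_ne, Fin.append_right]
    intro h
    have := congrArg Fin.val h
    simp only [Fin.val_castAdd, Fin.val_natAdd] at this
    omega

/-- The element `(v, w) ↦ η(v, w)` of `Λ^k ⊗ Λ^l`. -/
def splitForm (η : Lam n (k + l)) : BiLam n k l :=
  AlternatingMap.mkContinuousAlternating
    { toFun := fun v =>
        { toFun := fun w => η (Fin.append v w)
          map_update_add' := fun w i x y => by
            simp only [append_update_natAdd]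
            exact ContinuousAlternatingMap.map_update_add (η : E n [⋀^Fin (k + l)]→L[ℝ] ℂ) _ _ x y
          map_update_smul' := fun w i c x => by
            simp only [append_update_natAdd]
            exact ContinuousAlternatingMap.map_update_smul (η : E n [⋀^Fin (k + l)]→L[ℝ] ℂ) _ _ c x
          map_eq_zero_of_eq' := fun w i j h hij => by
            refine ContinuousAlternatingMap.map_eq_zero_of_eq (η : E n [⋀^Fin (k + l)]→L[ℝ] ℂ)
              (Fin.append v w) (i := Fin.natAdd k i) (j := Fin.natAdd k j) ?_ ?_
            · simpa using h
            · simpa using hij }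
      map_update_add' := fun v i x y => by
        ext w
        change η _ = η _ + η _
        simp only [append_update_castAdd]
        exact ContinuousAlternatingMap.map_update_add (η : E n [⋀^Fin (k + l)]→L[ℝ] ℂ) _ _ x y
      map_update_smul' := fun v i c x => by
        ext w
        change η _ = c • η _
        simp only [append_update_castAdd]
        exact ContinuousAlternatingMap.map_update_smul (η : E n [⋀^Fin (k + l)]→L[ℝ] ℂ) _ _ c x
      map_eq_zero_of_eq' := fun v i j h hij => by
        ext w
        change η _ = 0
        refine ContinuousAlternatingMap.map_eq_zero_of_eq (η : E n [⋀^Fin (k + l)]→L[ℝ] ℂ)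
          (Fin.append v w) (i := Fin.castAdd l i) (j := Fin.castAdd l j) ?_ ?_
        · simpa using h
        · simpa using hij }
    ‖η‖ (fun v w => by
      refine (ContinuousAlternatingMap.le_opNorm (η : E n [⋀^Fin (k + l)]→L[ℝ] ℂ)
        (Fin.append v w)).trans_eq ?_
      rw [Fin.prod_univ_add]
      simp only [Fin.append_left, Fin.append_right]
      rw [mul_assoc]
      rfl)

theorem splitForm_apply (η : Lam n (k + l)) (v : Fin k → E n) (w : Fin l → E n) :
    splitForm η v w = η (Fin.append v w) := rfl

/-- For alternating η each of the (k+ℓ)! permutations contributes η(v), so splitting is a right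
inverse of the wedge product up to a nonzero constant. -/
theorem wedge_splitForm (η : Lam n (k + l)) : wedge (splitForm η) =
    ((k.factorial * l.factorial : ℂ)⁻¹ * (k + l).factorial) • η := Lam.ext fun v => by
  have h : ∀ σ : Equiv.Perm (Fin (k + l)), Fin.append (fun i => v (σ (Fin.castAdd l i)))
      (fun i => v (σ (Fin.natAdd k i))) = fun i => v (σ i) := fun σ =>
    Fin.append_castAdd_natAdd (f := fun i => v (σ i))
  have h2 : ∀ σ : Equiv.Perm (Fin (k + l)), (Equiv.Perm.sign σ : ℤ) • η (fun i => v (σ i)) = η v := by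
    intro σ
    have h3 : η (fun i => v (σ i)) = (Equiv.Perm.sign σ : ℤ) • η v :=
      (η : E n [⋀^Fin (k + l)]→L[ℝ] ℂ).toAlternatingMap.map_perm v σ
    rw [h3, smul_smul, ← Units.val_mul, Int.units_mul_self, Units.val_one, one_smul]
  rw [wedge_apply, Lam.smul_apply]
  simp only [splitForm_apply, h, h2, Finset.sum_const, Finset.card_univ, Fintype.card_perm,
    Fintype.card_fin, nsmul_eq_mul]
  rw [mul_assoc]

theorem wedge_surjective (η : Lam n (k + l)) : ∃ T : BiLam n k l, wedge T = η := by
  set c : ℂ := (k.factorial * l.factorial : ℂ)⁻¹ * (k + l).factorial with hc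
  have hc0 : c ≠ 0 := by
    have h : ∀ m : ℕ, (m.factorial : ℂ) ≠ 0 := fun m => by exact_mod_cast m.factorial_ne_zero
    exact mul_ne_zero (inv_ne_zero (mul_ne_zero (h k) (h l))) (h _)
  refine ⟨c⁻¹ • splitForm η, ?_⟩
  rw [← wedgeL_apply, map_smul, wedgeL_apply, wedge_splitForm, ← hc, smul_smul,
    inv_mul_cancel₀ hc0, one_smul]

/-- The kernel of the wedge product. -/
def wedgeKer (n k l : ℕ) : Subrepresentation (sigmaBi n k l) where
  toSubmodule := LinearMap.ker (wedgeL n k l)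
  apply_mem_toSubmodule g T hT := by
    rw [LinearMap.mem_ker, wedgeL_apply] at *
    rw [wedge_sigmaBi, hT, map_zero]

/-- The copy of `Λ^{k+l}` in `Λ^k ⊗ Λ^l`. -/
def wedgeRep (n k l : ℕ) : Subrepresentation (sigmaBi n k l) := orthRep (wedgeKer n k l)

theorem mem_orth_wedgeRep {T : BiLam n k l} (hT : wedge T = 0) :
    T ∈ orth (wedgeRep n k l).toSubmodule := by
  rintro _ ⟨S, hS, rfl⟩
  have := hS (comps T) ⟨T, hT, rfl⟩
  rw [← inner_conj_symm, this, map_zero]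

theorem exists_wedge_decomposition (T : BiLam n k l) : ∃ S R : BiLam n k l, wedge S = 0 ∧
    R ∈ (wedgeRep n k l).toSubmodule ∧ S + R = T := by
  obtain ⟨S, hS, R, hR, h⟩ := Submodule.mem_sup.mp
    ((isCompl_orth (wedgeKer n k l).toSubmodule).sup_eq_top ▸ Submodule.mem_top (x := T))
  exact ⟨S, R, hS, hR, h⟩

/-- What the projection removes lies in the kernel of the wedge product. This identifies p_Γ with
the wedge product under `wedgeEquiv`. -/
theorem wedge_proj (T : BiLam n k l) :
    wedge (proj (wedgeRep n k l).toSubmodule T : BiLam n k l) = wedge T := by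
  obtain ⟨S, R, hS, hR, rfl⟩ := exists_wedge_decomposition T
  rw [map_add, proj_of_mem hR, proj_of_mem_orth (mem_orth_wedgeRep hS), zero_add, ← wedgeL_apply (S + R),
    map_add, wedgeL_apply, wedgeL_apply, hS, zero_add]

/-- The isomorphism of `wedgeRep` with `Λ^{k+l}`. -/
def wedgeEquiv (n k l : ℕ) : (wedgeRep n k l).toSubmodule ≃ₗ[ℂ] Lam n (k + l) :=
  LinearEquiv.ofBijective (wedgeL n k l ∘ₗ (wedgeRep n k l).toSubmodule.subtype) <| by
    constructor
    · rw [← LinearMap.ker_eq_bot, LinearMap.ker_eq_bot']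
      rintro ⟨T, hT⟩ h
      have h' : T ∈ (wedgeKer n k l).toSubmodule := h
      have := (Submodule.disjoint_def.mp (isCompl_orth (wedgeKer n k l).toSubmodule).disjoint) T h' hT
      exact Subtype.ext this
    · intro η
      obtain ⟨T, rfl⟩ := wedge_surjective (k := k) (l := l) η
      exact ⟨proj (wedgeRep n k l).toSubmodule T, wedge_proj T⟩

theorem wedgeEquiv_toRepresentation (g : SO n) (T : (wedgeRep n k l).toSubmodule) :
    wedgeEquiv n k l ((wedgeRep n k l).toRepresentation g T) =
      sigma n (k + l) g (wedgeEquiv n k l T) := wedge_sigmaBi g (T : BiLam n k l)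

theorem wedgeEquiv_apply (T : (wedgeRep n k l).toSubmodule) :
    wedgeEquiv n k l T = wedge (T : BiLam n k l) := rfl

end WedgeProduct

/-! ### The first order case on decomposable forms -/

section TensorProducts

variable {n k l : ℕ}

theorem swap_tensor (φ : Lam n k) (ψ : Lam n l) : swap (tensor φ ψ) = tensor ψ φ := by
  ext w : 1
  refine Lam.ext fun v => ?_
  change φ v * ψ w = ψ w * φ v
  exact mul_comm _ _

/-- Tensoring with the fixed value of χ is a postcomposition on the values, so □ passes through it.
-/
theorem onX_box_tensor (s : ℂ) {φ : E n → Lam n k} (hφ : ContDiff ℝ ∞ φ) (χ : E n → Lam n l) :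
    onX (box s) (fun p => tensor (φ p.1) (χ p.2)) = fun p => tensor (box s φ p.1) (χ p.2) :=
  funext fun p => (commutesN_postComp (ContinuousLinearMap.toSpanSingleton ℂ (χ p.2))).box s
    (f := φ) (x := p.1) (ContDiffAt.twiceDiffAt (F := E n [⋀^Fin k]→L[ℝ] ℂ) hφ.contDiffAt)

theorem onX_nabla_tensor (s : ℂ) (j : Fin n) {φ : E n → Lam n k} (hφ : ContDiff ℝ ∞ φ)
    (χ : E n → Lam n l) : onX (nabla s j) (fun p => tensor (φ p.1) (χ p.2)) =
      fun p => tensor (nabla s j φ p.1) (χ p.2) :=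
  funext fun p => (commutesN_postComp (ContinuousLinearMap.toSpanSingleton ℂ (χ p.2))).nabla s j
    (f := φ) (x := p.1) (ContDiffAt.twiceDiffAt (F := E n [⋀^Fin k]→L[ℝ] ℂ) hφ.contDiffAt)

theorem onY_box_tensor (t : ℂ) {ψ : E n → Lam n l} (hψ : ContDiff ℝ ∞ ψ) (χ : E n → Lam n k) :
    onY (box t) (fun p => tensor (χ p.1) (ψ p.2)) = fun p => tensor (χ p.1) (box t ψ p.2) := by
  funext p
  simp only [onY, swap_tensor]
  exact (congrArg swap (congrFun (onX_box_tensor t hψ χ) (p.2, p.1))).trans (swap_tensor _ _)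

theorem onY_nabla_tensor (t : ℂ) (j : Fin n) {ψ : E n → Lam n l} (hψ : ContDiff ℝ ∞ ψ)
    (χ : E n → Lam n k) : onY (nabla t j) (fun p => tensor (χ p.1) (ψ p.2)) =
      fun p => tensor (χ p.1) (nabla t j ψ p.2) := by
  funext p
  simp only [onY, swap_tensor]
  exact (congrArg swap (congrFun (onX_nabla_tensor t j hψ χ) (p.2, p.1))).trans (swap_tensor _ _)

/-- The source operator on the diagonal, applied to a tensor product of forms. -/
theorem sourceIter_one_tensor (lam mu : ℂ) {φ : E n → Lam n k} {ψ : E n → Lam n l}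
    (hφ : ContDiff ℝ ∞ φ) (hψ : ContDiff ℝ ∞ ψ) (x : E n) :
    sourceIter lam mu 1 (fun p => tensor (φ p.1) (ψ p.2)) (x, x) =
      -((2 : ℂ) • ∑ j, tensor (nabla (n - 2 * lam) j φ x) (nabla (n - 2 * mu) j ψ x)
        + coefC n l (n - 2 * mu) • tensor (box (n - 2 * lam) φ x) (ψ x)
        + coefC n k (n - 2 * lam) • tensor (φ x) (box (n - 2 * mu) ψ x)) := by
  have h : sourceIter lam mu 1 (fun p => tensor (φ p.1) (ψ p.2)) (x, x) =
      -opE (n - 2 * (lam + (0 : ℕ))) (n - 2 * (mu + (0 : ℕ))) (fun p => tensor (φ p.1) (ψ p.2)) (x, x) := rfl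
  have h1 : ∀ j, onX (nabla (n - 2 * lam) j)
      (fun p => tensor (φ p.1) (nabla (n - 2 * mu) j ψ p.2)) (x, x) =
        tensor (nabla (n - 2 * lam) j φ x : Lam n k) (nabla (n - 2 * mu) j ψ x : Lam n l) :=
    fun j => congrFun (onX_nabla_tensor _ j hφ (nabla (n - 2 * mu) j ψ)) (x, x)
  rw [h, Nat.cast_zero, add_zero, add_zero, opE]
  simp only [onY_box_tensor _ hψ, onY_nabla_tensor _ _ hψ, onX_box_tensor _ hφ,
    sub_self, norm_zero]
  simp [coefC]
  exact Finset.sum_congr rfl fun j _ => h1 j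

/-- At s = n-2λ each of the four linear factors equals -2 times a factor of □̃, so each product
contributes 4. -/
theorem box_eq_boxT (lam : ℂ) (φ : Form n k ℂ) (x : E n) :
    box (n - 2 * lam) φ x = (4 : ℂ) • boxT lam φ x := by
  rw [box, boxT]
  module

theorem nabla_eq_nablaT (lam : ℂ) (j : Fin n) (φ : Form n k ℂ) (x : E n) :
    nabla (n - 2 * lam) j φ x = (4 * (2 * lam - n + 2)) • nablaT lam j φ x := by
  rw [nabla, nablaT]
  module

theorem coefC_eq (lam : ℂ) : coefC n k (n - 2 * lam) =
    8 * ((2 * lam - n + 2) * (lam + 1) * (lam - k) * (lam - n + k)) := by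
  rw [coefC]
  ring

theorem smul_tensor (c : ℂ) (φ : Lam n k) (ψ : Lam n l) :
    tensor (c • φ) ψ = c • tensor φ ψ := (postComp (ContinuousLinearMap.toSpanSingleton ℂ ψ)).map_smul c φ

theorem tensor_smul (c : ℂ) (φ : Lam n k) (ψ : Lam n l) :
    tensor φ (c • ψ) = c • tensor φ ψ := by
  rw [← swap_tensor, smul_tensor, ← swap_tensor φ ψ]
  rfl

/-- The common factor 32 is 2·4·4 in the ∇ ⊗ ∇ term and 8·4 in the two □ terms; the outer sign is
that of F = -E. -/
theorem wedge_opB_tensor (lam mu : ℂ) {φ : E n → Lam n k} {ψ : E n → Lam n l}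
    (hφ : ContDiff ℝ ∞ φ) (hψ : ContDiff ℝ ∞ ψ) (x : E n) :
    wedgeEquiv n k l (opB (wedgeRep n k l) lam mu 1 (fun p => tensor (φ p.1) (ψ p.2)) x) =
      (-32 : ℂ) •
        (((2 * mu - n + 2) * (mu + 1) * (mu - l) * (mu - n + l)) •
            wedge (tensor (boxT lam φ x) (ψ x))
          + ((2 * lam - n + 2) * (2 * mu - n + 2)) •
            ∑ j : Fin n, wedge (tensor (nablaT lam j φ x) (nablaT mu j ψ x))
          + ((2 * lam - n + 2) * (lam + 1) * (lam - k) * (lam - n + k)) •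
            wedge (tensor (φ x) (boxT mu ψ x))) := by
  have h1 : ∀ j, tensor (nabla (n - 2 * lam) j φ x : Lam n k) (nabla (n - 2 * mu) j ψ x : Lam n l) =
      (16 * ((2 * lam - n + 2) * (2 * mu - n + 2))) •
        tensor (nablaT lam j φ x : Lam n k) (nablaT mu j ψ x : Lam n l) := by
    intro j
    have e1 : (nabla (n - 2 * lam) j φ x : Lam n k) =
        (4 * (2 * lam - n + 2)) • (nablaT lam j φ x : Lam n k) := nabla_eq_nablaT lam j φ x
    have e2 : (nabla (n - 2 * mu) j ψ x : Lam n l) =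
        (4 * (2 * mu - n + 2)) • (nablaT mu j ψ x : Lam n l) := nabla_eq_nablaT mu j ψ x
    refine (congrArg₂ tensor e1 e2).trans ((smul_tensor _ _ _).trans ?_)
    refine (congrArg _ (tensor_smul _ _ _)).trans ?_
    rw [smul_smul]
    congr 1
    ring
  have h2 : tensor (box (n - 2 * lam) φ x : Lam n k) (ψ x) = (4 : ℂ) • tensor (boxT lam φ x) (ψ x) := by
    refine (congrArg (fun T : Lam n k => tensor T (ψ x)) (box_eq_boxT lam φ x)).trans ?_
    exact smul_tensor _ _ _
  have h3 : tensor (φ x) (box (n - 2 * mu) ψ x : Lam n l) = (4 : ℂ) • tensor (φ x) (boxT mu ψ x) := by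
    refine (congrArg (fun T : Lam n l => tensor (φ x) T) (box_eq_boxT mu ψ x)).trans ?_
    exact tensor_smul _ _ _
  rw [wedgeEquiv_apply, opB, wedge_proj, sourceIter_one_tensor lam mu hφ hψ, h2, h3,
    Finset.sum_congr rfl fun j _ => h1 j, coefC_eq, coefC_eq, ← wedgeL_apply]
  simp only [map_neg, map_add, map_smul, map_sum, ← Finset.smul_sum, wedgeL_apply]
  module

end TensorProducts

/-! ### Functions: the Rankin–Cohen operators -/

section Scalars

variable {n : ℕ}

/-- Functions as `0`-forms. -/
def scalarForm (n : ℕ) (c : ℂ) : Lam n 0 :=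
  ContinuousAlternatingMap.constOfIsEmpty ℝ (E n) (Fin 0) c

/-- `scalarForm` as a continuous linear map. -/
def scalarFormL (n : ℕ) : ℂ →L[ℝ] (E n [⋀^Fin 0]→L[ℝ] ℂ) :=
  (ContinuousAlternatingMap.constOfIsEmptyLIE ℝ (E n) ℂ (Fin 0)).toLinearIsometry.toContinuousLinearMap

theorem scalarFormL_smul (c a : ℂ) : scalarFormL n (c * a) = c • scalarFormL n a := rfl

theorem contDiff_scalarForm {f : E n → ℂ} (hf : ContDiff ℝ ∞ f) :
    ContDiff ℝ ∞ fun x => scalarForm n (f x) := (scalarFormL n).contDiff.comp hf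

theorem opN_zero_forms (i m : Fin n) (T : E n [⋀^Fin 0]→L[ℝ] ℂ) : opN i m T = 0 := by
  ext v; simp [opN_apply_apply]

theorem box_scalarForm (s : ℂ) {f : E n → ℂ} (hf : ContDiff ℝ ∞ f) (x : E n) :
    box s (fun y => scalarFormL n (f y)) x =
      scalarFormL n (-alphaC n 0 s * ∑ j, pd j (pd j f) x) := by
  have h : TwiceDiffAt f x := hf.contDiffAt.twiceDiffAt
  obtain ⟨h1, -, h2⟩ := h.clm (scalarFormL n)
  rw [box_eq h1, boxJet, scalarFormL_smul, map_sum]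
  simp only [h2, opN_zero_forms, Finset.sum_const_zero, smul_zero, add_zero, pd2_eq_pd_pd h.2]

theorem nabla_scalarForm (s : ℂ) (j : Fin n) {f : E n → ℂ} (hf : ContDiff ℝ ∞ f) (x : E n) :
    nabla s j (fun y => scalarFormL n (f y)) x =
      scalarFormL n ((2 - s) * alphaC n 0 s * pd j f x) := by
  have h : TwiceDiffAt f x := hf.contDiffAt.twiceDiffAt
  obtain ⟨h1, h2, -⟩ := h.clm (scalarFormL n)
  rw [nabla_eq j h1.differentiableAt, nablaJet, scalarFormL_smul]
  simp only [h2, opN_zero_forms, Finset.sum_const_zero, smul_zero, add_zero, sub_zero]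
  exact smul_smul _ _ _

theorem tensor_scalarForm (a b : ℂ) (v w : Fin 0 → E n) :
    tensor (scalarForm n a) (scalarForm n b) v w = a * b := rfl

/-- In degree 0 every ε_i ι_j vanishes, so □ is a multiple of the Laplacian and ∇_j a multiple of
∂_j; p_Γ is the identity, and the rest is collecting factors. -/
theorem opB_scalars (lam mu : ℂ) {f h : E n → ℂ} (hf : ContDiff ℝ ∞ f) (hh : ContDiff ℝ ∞ h)
    (x : E n) : (opB (⊤ : Subrepresentation (sigmaBi n 0 0)) lam mu 1
      (fun p => tensor (scalarForm n (f p.1)) (scalarForm n (h p.2))) x : BiLam n 0 0) ![] ![] =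
    -64 * (lam + 1) * (lam - n) * (mu + 1) * (mu - n) *
      (-(mu * (mu - n / 2 + 1) * (∑ j, pd j (pd j f) x) * h x)
        + 2 * (lam - n / 2 + 1) * (mu - n / 2 + 1) * ∑ j, pd j f x * pd j h x
        - lam * (lam - n / 2 + 1) * f x * ∑ j, pd j (pd j h) x) := by
  have h1 : ∀ j, tensor (nabla (n - 2 * lam) j (fun y => scalarForm n (f y)) x : Lam n 0)
      (nabla (n - 2 * mu) j (fun y => scalarForm n (h y)) x : Lam n 0) = tensor
      (scalarForm n ((2 - (n - 2 * lam)) * alphaC n 0 (n - 2 * lam) * pd j f x))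
      (scalarForm n ((2 - (n - 2 * mu)) * alphaC n 0 (n - 2 * mu) * pd j h x)) :=
    fun j => congrArg₂ tensor (nabla_scalarForm _ j hf x) (nabla_scalarForm _ j hh x)
  have h2 : (box (n - 2 * lam) (fun y => scalarForm n (f y)) x : Lam n 0) =
      scalarForm n (-alphaC n 0 (n - 2 * lam) * ∑ j, pd j (pd j f) x) := box_scalarForm _ hf x
  have h3 : (box (n - 2 * mu) (fun y => scalarForm n (h y)) x : Lam n 0) =
      scalarForm n (-alphaC n 0 (n - 2 * mu) * ∑ j, pd j (pd j h) x) := box_scalarForm _ hh x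
  have h4 : ∀ T U : BiLam n 0 0, ∀ V : Fin n → BiLam n 0 0, ∀ c d : ℂ,
      (-((2 : ℂ) • ∑ j, V j + c • T + d • U)) ![] ![] =
        -(2 * ∑ j, V j ![] ![] + c * T ![] ![] + d * U ![] ![]) := by
    intro T U V c d
    have : (∑ j, V j) ![] ![] = ∑ j, V j ![] ![] :=
      map_sum (⟨⟨fun T => T ![] ![], rfl⟩, fun _ _ => rfl⟩ : BiLam n 0 0 →+ ℂ) V Finset.univ
    rw [← this]
    rfl
  have h5 : ∀ lam : ℂ, alphaC n 0 (n - 2 * lam) = 4 * ((lam - n) * (lam + 1)) := fun lam => by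
    rw [alphaC]; push_cast; ring
  have h6 : ∀ T : BiLam n 0 0,
      (proj (⊤ : Subrepresentation (sigmaBi n 0 0)).toSubmodule T : BiLam n 0 0) = T :=
    fun T => congrArg Subtype.val (proj_of_mem (Submodule.mem_top (x := T)))
  rw [opB, h6, sourceIter_one_tensor lam mu (contDiff_scalarForm hf) (contDiff_scalarForm hh), h4]
  simp only [h1]
  rw [h2, h3]
  simp only [tensor_scalarForm, coefC_eq, h5]
  have h7 : ∑ j, (2 - (n - 2 * lam)) * (4 * ((lam - n) * (lam + 1))) * pd j f x *
      ((2 - (n - 2 * mu)) * (4 * ((mu - n) * (mu + 1))) * pd j h x) =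
      ((2 - (n - 2 * lam)) * (4 * ((lam - n) * (lam + 1))) *
      ((2 - (n - 2 * mu)) * (4 * ((mu - n) * (mu + 1))))) * ∑ j, pd j f x * pd j h x := by
    rw [Finset.mul_sum]
    exact Finset.sum_congr rfl fun j _ => by ring
  rw [h7]
  push_cast
  ring

theorem eq_smul_tensor_scalarForm (T : BiLam n 0 0) :
    T = T ![] ![] • tensor (scalarForm n 1) (scalarForm n 1) := by
  refine ContinuousAlternatingMap.ext fun v => Lam.ext fun w => ?_
  rw [Subsingleton.elim v ![], Subsingleton.elim w ![]]
  have h : T ![] ![] = T ![] ![] * (1 * 1) := by rw [mul_one, mul_one]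
  exact h

/-- The space of bidegree (0,0) is a line, so a nonzero vector of a subrepresentation spans
everything. -/
theorem isIrreducible_scalars :
    (⊤ : Subrepresentation (sigmaBi n 0 0)).toRepresentation.IsIrreducible := by
  let u : BiLam n 0 0 := tensor (scalarForm n 1) (scalarForm n 1)
  have hu : u ≠ 0 := fun h => one_ne_zero (α := ℂ) <| by
    have := congrArg (fun T : BiLam n 0 0 => T ![] ![]) h
    exact (mul_one (1 : ℂ)).symm.trans this
  have key : ∀ S : Subrepresentation (⊤ : Subrepresentation (sigmaBi n 0 0)).toRepresentation,
      S = ⊥ ∨ S = ⊤ := by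
    intro S
    by_cases hS : S.toSubmodule = ⊥
    · exact Or.inl (Subrepresentation.toSubmodule_injective hS)
    · refine Or.inr (Subrepresentation.toSubmodule_injective ?_)
      obtain ⟨⟨T, hT⟩, hTS, hT0⟩ := Submodule.exists_mem_ne_zero_of_ne_bot hS
      refine (Submodule.eq_top_iff').mpr fun ⟨R, hR⟩ => ?_
      have hc : T ![] ![] ≠ 0 := fun h => hT0 <| Subtype.ext <| by
        change T = 0
        rw [eq_smul_tensor_scalarForm T, h, zero_smul]
      have : (⟨R, hR⟩ : (⊤ : Subrepresentation (sigmaBi n 0 0)).toSubmodule) =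
          (R ![] ![] * (T ![] ![])⁻¹) • ⟨T, hT⟩ := Subtype.ext <| by
        change R = (R ![] ![] * (T ![] ![])⁻¹) • T
        conv_lhs => rw [eq_smul_tensor_scalarForm R]
        conv_rhs => rw [eq_smul_tensor_scalarForm T]
        rw [smul_smul, ← eq_smul_tensor_scalarForm T, mul_assoc, inv_mul_cancel₀ hc, mul_one]
      rw [this]
      exact S.toSubmodule.smul_mem _ hTS
  have hne : (⊥ : Subrepresentation (⊤ : Subrepresentation (sigmaBi n 0 0)).toRepresentation) ≠ ⊤ := by
    intro h
    have h1 : (⟨u, trivial⟩ : (⊤ : Subrepresentation (sigmaBi n 0 0)).toSubmodule) ∈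
        (⊥ : Subrepresentation (⊤ : Subrepresentation (sigmaBi n 0 0)).toRepresentation).toSubmodule := by
      rw [h]; trivial
    exact hu (congrArg Subtype.val h1)
  have : Nontrivial (Subrepresentation (⊤ : Subrepresentation (sigmaBi n 0 0)).toRepresentation) :=
    ⟨⟨_, _, hne⟩⟩
  exact { eq_bot_or_eq_top := key }

end Scalars

end ConfForms

end

open ConfForms in
theorem mainTheorem2 (n : ℕ) (hn : 1 ≤ n) :
    (∀ k l : ℕ, k ≤ n → l ≤ n →
      ∀ Γ : Subrepresentation (sigmaBi n k l), Γ.toRepresentation.IsIrreducible →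
      ∀ (lam mu : ℂ) (m : ℕ), 1 ≤ m →
        IsBiDifferential (opB Γ lam mu m) ∧
        IsCovariant (opB Γ (lam + k) (mu + l) m) lam mu Γ.toRepresentation
          (lam + mu + k + l + 2 * m)) ∧
    (∀ k l : ℕ, k + l ≤ n →
      ∃ (Γ : Subrepresentation (sigmaBi n k l)) (J : Γ.toSubmodule ≃ₗ[ℂ] Lam n (k + l)),
        (∀ (g : SO n) (T : Γ.toSubmodule),
          J (Γ.toRepresentation g T) = sigma n (k + l) g (J T)) ∧
        (∀ T : BiLam n k l, J (proj Γ.toSubmodule T) = wedge T) ∧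
        (∀ (lam mu : ℂ) (m : ℕ), 1 ≤ m →
          IsBiDifferential (opB Γ lam mu m) ∧
          IsCovariant (opB Γ (lam + k) (mu + l) m) lam mu Γ.toRepresentation
            (lam + mu + k + l + 2 * m)) ∧
        ∀ (lam mu : ℂ) (φ : E n → Lam n k) (ψ : E n → Lam n l),
          ContDiff ℝ ∞ φ → ContDiff ℝ ∞ ψ → ∀ x : E n,
          J (opB Γ lam mu 1 (fun p => tensor (φ p.1) (ψ p.2)) x) =
            (-32 : ℂ) •
              (((2 * mu - n + 2) * (mu + 1) * (mu - l) * (mu - n + l)) •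
                  wedge (tensor (boxT lam φ x) (ψ x))
                + ((2 * lam - n + 2) * (2 * mu - n + 2)) •
                  ∑ j : Fin n, wedge (tensor (nablaT lam j φ x) (nablaT mu j ψ x))
                + ((2 * lam - n + 2) * (lam + 1) * (lam - k) * (lam - n + k)) •
                  wedge (tensor (φ x) (boxT mu ψ x)))) ∧
    ((⊤ : Subrepresentation (sigmaBi n 0 0)).toRepresentation.IsIrreducible ∧
      ∀ (lam mu : ℂ) (f h : E n → ℂ), ContDiff ℝ ∞ f → ContDiff ℝ ∞ h → ∀ x : E n,
        (opB (⊤ : Subrepresentation (sigmaBi n 0 0)) lam mu 1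
            (fun p => tensor (ContinuousAlternatingMap.constOfIsEmpty ℝ (E n) (Fin 0) (f p.1))
              (ContinuousAlternatingMap.constOfIsEmpty ℝ (E n) (Fin 0) (h p.2))) x : BiLam n 0 0)
            ![] ![] =
          -64 * (lam + 1) * (lam - n) * (mu + 1) * (mu - n) *
            (-(mu * (mu - n / 2 + 1) * (∑ j, pd j (pd j f) x) * h x)
              + 2 * (lam - n / 2 + 1) * (mu - n / 2 + 1) * ∑ j, pd j f x * pd j h x
              - lam * (lam - n / 2 + 1) * f x * ∑ j, pd j (pd j h) x)) := 
  ⟨fun _ _ _ _ Γ _ lam mu m _ => ⟨isBiDifferential_opB Γ lam mu m, isCovariant_opB hn Γ lam mu m⟩,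
    fun k l _ => ⟨wedgeRep n k l, wedgeEquiv n k l, wedgeEquiv_toRepresentation, wedge_proj,
      fun lam mu m _ => ⟨isBiDifferential_opB _ lam mu m, isCovariant_opB hn _ lam mu m⟩,
      fun lam mu _ _ hφ hψ x => wedge_opB_tensor lam mu hφ hψ x⟩,
    isIrreducible_scalars, fun lam mu _ _ hf hh x => opB_scalars lam mu hf hh x⟩
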